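/- **Setting.** Let $k$ be an algebraically closed field of characteristic $0$ and let $H$ be a factorizable (ribbon) Hopf algebra over $k$: a finite-dimensional Hopf algebra with product $m$, unit $\eta$, coproduct $\Delta$, counit $\varepsilon$ and antipode $S$, with an R-matrix $R\in (H\otimes H)^\times$ (so $R\,\Delta(h)\,R^{-1}=\Delta^{\rm op}(h)$, $(\Delta\otimes{\rm id})(R)=R_{13}R_{23}$, $({\rm id}\otimes\Delta)(R)=R_{13}R_{12}$) and a central invertible ribbon element $v$ ($S(v)=v$, $\varepsilon(v)=1$, $\Delta(v)=(v\otimes v)\,Q^{-1}$ with $Q=R_{21}R$), such that $Q$ is non-degenerate, i.e. $Q=\sum_\ell h_\ell\otimes k_\ell$ for two bases $(h_\ell)$, $(k_\ell)$ of $H$. Let $H\text{-Bimod}$ be the category of finite-dimensional $H$-bimodules, as a ribbon category: tensor product over $k$ with both actions pulled back along $\Delta$, tensor unit $k$ with both actions through $\varepsilon$, braiding $x\otimes y\mapsto R^{-1}\cdot(y\otimes x)\cdot R$, dual $X^*$ with $(h\cdot f)(x)=f(S(h)\cdot x)$ and $(f\cdot h)(x)=f(x\cdot S^{-1}(h))$,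 twist $x\mapsto v\cdot x\cdot v^{-1}$. Let $F$ be the coregular bimodule: $H^*$ with $(h\cdot f)(x)=f(S(h)x)$ and $(f\cdot h)(x)=f(xS^{-1}(h))$. For a Hopf algebra automorphism $\omega$ of $H$ let $F_\omega$ be $F$ with right action twisted by $\omega$: $f\cdot_\omega h=f\cdot\omega(h)$. For finite-dimensional left $H$-modules $U,W$ let $U^\vee\boxtimes W$ be the bimodule $U^*\otimes W$ with $h\cdot(f\otimes w)=f(S(h)\,\cdot)\otimes w$ and $(f\otimes w)\cdot h=f\otimes S^{-1}(h)w$, and let $\omega(W)$ be the pull-back of $W$ along $\omega$. For a left integral $\Lambda\in H$ and a right cointegral $\lambda\in H^*$, identify $H^*\otimes H^*$ with $(H\otimes H)^*$ by $(f\otimes g)(x\otimes y)=f(y)\,g(x)$ (the duality of the rigid category of vector spaces) and put $$m_F=\Delta^*,\qquad \eta_F=\varepsilon^*,\qquad \Delta_F=\big[({\rm id}\otimes(\lambda\circ m))\circ({\rm id}\otimes S\otimes{\rm id})\circ(\Delta\otimes{\rm id})\big]^*,\qquad \varepsilon_F=\Lambda^* .$$ **Theorem.** 1. $F$, with the maps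 $U^*\otimes U\to H^*$, $f\otimes u\mapsto (x\mapsto f(xu))$, is the coend $\int^U U^\vee\boxtimes U$ in $H\text{-Bimod}$. For every Hopf algebra automorphism $\omega$, $F_\omega$, with the same linear maps, is the coend $\int^U U^\vee\boxtimes\omega(U)$. 2. There are a left integral $\Lambda$ and a right cointegral $\lambda$ normalized by $\lambda(\Lambda)=1$ and $(\lambda\otimes{\rm id})(Q)=\Lambda$. 3. For all such $\Lambda$, $\lambda$, the maps $m_F,\eta_F,\Delta_F,\varepsilon_F$ are morphisms of $H$-bimodules, and they make $F$ a commutative symmetric Frobenius algebra with trivial twist in the ribbon category $H\text{-Bimod}$. 4. For all such $\Lambda$, $\lambda$ and every Hopf algebra automorphism $\omega$ of $H$, the same linear maps are bimodule morphisms for $F_\omega$ and make it a Frobenius algebra in $H\text{-Bimod}$. If $\omega$ is an automorphism of ribbon Hopf algebras, i.e. also $(\omega\otimes\omega)(R)=R$ and $\omega(v)=v$, then this Frobenius algebra is commutative and symmetric, and $F_\omega$ has trivial twist. -/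

import Mathlib

open TensorProduct CategoryTheory

universe u

noncomputable section

set_option linter.unusedVariables false
set_option linter.unusedSectionVars false

namespace FactorizableHopf

section Actions

variable {k : Type u} [Field k]

/-- Two families of operators `ρ : A → End X`, `σ : B → End Y` combine to a family of operators
`A ⊗ B → End (X ⊗ Y)`, namely `a ⊗ b ↦ ρ a ⊗ σ b`. -/
def act₂ {A B X Y : Type u} [AddCommGroup A] [Module k A] [AddCommGroup B] [Module k B]
    [AddCommGroup X] [Module k X] [AddCommGroup Y] [Module k Y]
    (ρ : A →ₗ[k] (X →ₗ[k] X)) (σ : B →ₗ[k] (Y →ₗ[k] Y)) :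
    A ⊗[k] B →ₗ[k] (X ⊗[k] Y →ₗ[k] X ⊗[k] Y) :=
  TensorProduct.lift ((TensorProduct.mapBilinear (RingHom.id k) X Y X Y).compl₁₂ ρ σ)

section
variable {A B C X Y Z X' Y' : Type u} [AddCommGroup A] [Module k A] [AddCommGroup B] [Module k B]
    [AddCommGroup C] [Module k C]
    [AddCommGroup X] [Module k X] [AddCommGroup Y] [Module k Y]
    [AddCommGroup Z] [Module k Z]
    [AddCommGroup X'] [Module k X'] [AddCommGroup Y'] [Module k Y']

@[simp] theorem act₂_tmul (ρ : A →ₗ[k] (X →ₗ[k] X)) (σ : B →ₗ[k] (Y →ₗ[k] Y)) (a : A) (b : B) :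
    act₂ ρ σ (a ⊗ₜ b) = TensorProduct.map (ρ a) (σ b) := rfl

theorem act₂_intertwine {ρ : A →ₗ[k] (X →ₗ[k] X)} {σ : B →ₗ[k] (Y →ₗ[k] Y)}
    {ρ' : A →ₗ[k] (X' →ₗ[k] X')} {σ' : B →ₗ[k] (Y' →ₗ[k] Y')} {f : X →ₗ[k] X'} {g : Y →ₗ[k] Y'}
    (hf : ∀ a, f ∘ₗ ρ a = ρ' a ∘ₗ f) (hg : ∀ b, g ∘ₗ σ b = σ' b ∘ₗ g) (p : A ⊗[k] B) :
    TensorProduct.map f g ∘ₗ act₂ ρ σ p = act₂ ρ' σ' p ∘ₗ TensorProduct.map f g := by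
  induction p with
  | zero => simp
  | add p q hp hq => simp [LinearMap.comp_add, LinearMap.add_comp, hp, hq]
  | tmul a b => simp [← TensorProduct.map_comp, hf, hg]

theorem act₂_assoc (ρ : A →ₗ[k] (X →ₗ[k] X)) (σ : B →ₗ[k] (Y →ₗ[k] Y)) (τ : C →ₗ[k] (Z →ₗ[k] Z))
    (p : (A ⊗[k] B) ⊗[k] C) :
    (TensorProduct.assoc k X Y Z).toLinearMap ∘ₗ act₂ (act₂ ρ σ) τ p =
      act₂ ρ (act₂ σ τ) (TensorProduct.assoc k A B C p) ∘ₗ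
        (TensorProduct.assoc k X Y Z).toLinearMap := by
  induction p with
  | zero => simp
  | add p q hp hq => simp only [map_add, LinearMap.comp_add, LinearMap.add_comp, hp, hq]
  | tmul p c =>
    induction p with
    | zero => simp
    | add p q hp hq =>
      simp only [map_add, LinearMap.comp_add, LinearMap.add_comp, hp, hq, TensorProduct.add_tmul]
    | tmul a b => apply TensorProduct.ext_threefold; intro x y z; simp

theorem act₂_comp_left {A' : Type u} [AddCommGroup A'] [Module k A']
    (φ : A' →ₗ[k] A) (ρ : A →ₗ[k] (X →ₗ[k] X)) (σ : B →ₗ[k] (Y →ₗ[k] Y)) (p : A' ⊗[k] B) :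
    act₂ (ρ ∘ₗ φ) σ p = act₂ ρ σ (φ.rTensor B p) := by
  induction p with
  | zero => simp
  | add p q hp hq => simp only [map_add, hp, hq]
  | tmul a b => simp

theorem act₂_comp_right {B' : Type u} [AddCommGroup B'] [Module k B']
    (φ : B' →ₗ[k] B) (ρ : A →ₗ[k] (X →ₗ[k] X)) (σ : B →ₗ[k] (Y →ₗ[k] Y)) (p : A ⊗[k] B') :
    act₂ ρ (σ ∘ₗ φ) p = act₂ ρ σ (φ.lTensor A p) := by
  induction p with
  | zero => simp
  | add p q hp hq => simp only [map_add, hp, hq]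
  | tmul a b => simp

theorem act₂_flip (ρ : A →ₗ[k] (X →ₗ[k] X)) (σ : B →ₗ[k] (Y →ₗ[k] Y)) (p : A ⊗[k] B) :
    (TensorProduct.comm k X Y).toLinearMap ∘ₗ act₂ ρ σ p =
      act₂ σ ρ (TensorProduct.comm k A B p) ∘ₗ (TensorProduct.comm k X Y).toLinearMap := by
  induction p with
  | zero => simp
  | add p q hp hq => simp only [map_add, LinearMap.comp_add, LinearMap.add_comp, hp, hq]
  | tmul a b => apply TensorProduct.ext'; intro x y; simp

end

section
variable {A B X Y : Type u} [Ring A] [Algebra k A] [Ring B] [Algebra k B]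
    [AddCommGroup X] [Module k X] [AddCommGroup Y] [Module k Y]

theorem act₂_mul {ρ : A →ₗ[k] (X →ₗ[k] X)} {σ : B →ₗ[k] (Y →ₗ[k] Y)}
    (hρ : ∀ a b, ρ (a * b) = ρ a ∘ₗ ρ b) (hσ : ∀ a b, σ (a * b) = σ a ∘ₗ σ b)
    (p q : A ⊗[k] B) : act₂ ρ σ (p * q) = act₂ ρ σ p ∘ₗ act₂ ρ σ q := by
  induction p with
  | zero => simp
  | add p q hp hq => simp only [map_add, LinearMap.add_comp, hp, hq, add_mul]
  | tmul a b =>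
    induction q with
    | zero => simp
    | add p q hp hq => simp only [map_add, LinearMap.comp_add, hp, hq, mul_add]
    | tmul c d => simp [hρ, hσ, TensorProduct.map_comp]

theorem act₂_mul_rev {ρ : A →ₗ[k] (X →ₗ[k] X)} {σ : B →ₗ[k] (Y →ₗ[k] Y)}
    (hρ : ∀ a b, ρ (a * b) = ρ b ∘ₗ ρ a) (hσ : ∀ a b, σ (a * b) = σ b ∘ₗ σ a)
    (p q : A ⊗[k] B) : act₂ ρ σ (p * q) = act₂ ρ σ q ∘ₗ act₂ ρ σ p := by
  induction p with
  | zero => simp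
  | add p q hp hq => simp only [map_add, LinearMap.comp_add, hp, hq, add_mul]
  | tmul a b =>
    induction q with
    | zero => simp
    | add p q hp hq => simp only [map_add, LinearMap.add_comp, hp, hq, mul_add]
    | tmul c d => simp [hρ, hσ, TensorProduct.map_comp]

theorem act₂_one {ρ : A →ₗ[k] (X →ₗ[k] X)} {σ : B →ₗ[k] (Y →ₗ[k] Y)}
    (hρ : ρ 1 = LinearMap.id) (hσ : σ 1 = LinearMap.id) :
    act₂ ρ σ 1 = LinearMap.id := by
  rw [Algebra.TensorProduct.one_def, act₂_tmul, hρ, hσ, TensorProduct.map_id]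

/-- Left and right operators that commute factorwise commute. -/
theorem act₂_commute {A' B' : Type u} [AddCommGroup A'] [Module k A'] [AddCommGroup B'] [Module k B']
    {ρ : A →ₗ[k] (X →ₗ[k] X)} {σ : B →ₗ[k] (Y →ₗ[k] Y)}
    {ρ' : A' →ₗ[k] (X →ₗ[k] X)} {σ' : B' →ₗ[k] (Y →ₗ[k] Y)}
    (hρ : ∀ a b, ρ a ∘ₗ ρ' b = ρ' b ∘ₗ ρ a) (hσ : ∀ a b, σ a ∘ₗ σ' b = σ' b ∘ₗ σ a)
    (p : A ⊗[k] B) (q : A' ⊗[k] B') : act₂ ρ σ p ∘ₗ act₂ ρ' σ' q = act₂ ρ' σ' q ∘ₗ act₂ ρ σ p := by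
  induction p with
  | zero => simp
  | add p q hp hq => simp only [map_add, LinearMap.comp_add, LinearMap.add_comp, hp, hq]
  | tmul a b =>
    induction q with
    | zero => simp
    | add p q hp hq => simp only [map_add, LinearMap.comp_add, LinearMap.add_comp, hp, hq]
    | tmul c d => simp [← TensorProduct.map_comp, hρ, hσ]
end

section
variable {H X Y Z : Type u} [Ring H] [Bialgebra k H]
    [AddCommGroup X] [Module k X] [AddCommGroup Y] [Module k Y] [AddCommGroup Z] [Module k Z]

/-- Pull-back of `ρ ⊗ σ` along the coproduct. -/
def tensAct (ρ : H →ₗ[k] (X →ₗ[k] X)) (σ : H →ₗ[k] (Y →ₗ[k] Y)) :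
    H →ₗ[k] (X ⊗[k] Y →ₗ[k] X ⊗[k] Y) :=
  act₂ ρ σ ∘ₗ Coalgebra.comul

theorem tensAct_apply (ρ : H →ₗ[k] (X →ₗ[k] X)) (σ : H →ₗ[k] (Y →ₗ[k] Y)) (h : H) :
    tensAct ρ σ h = act₂ ρ σ (Coalgebra.comul h) := rfl

theorem tensAct_assoc (ρ : H →ₗ[k] (X →ₗ[k] X)) (σ : H →ₗ[k] (Y →ₗ[k] Y))
    (τ : H →ₗ[k] (Z →ₗ[k] Z)) (h : H) :
    (TensorProduct.assoc k X Y Z).toLinearMap ∘ₗ tensAct (tensAct ρ σ) τ h =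
      tensAct ρ (tensAct σ τ) h ∘ₗ (TensorProduct.assoc k X Y Z).toLinearMap := by
  rw [tensAct_apply, tensAct_apply, tensAct, tensAct, act₂_comp_left, act₂_comp_right, act₂_assoc,
    Coalgebra.coassoc_apply]

/-- The action through the counit. -/
def trivAct : H →ₗ[k] (k →ₗ[k] k) :=
  LinearMap.toSpanSingleton k (k →ₗ[k] k) LinearMap.id ∘ₗ Coalgebra.counit

theorem trivAct_apply (h : H) (c : k) :
    trivAct (k := k) h c = Coalgebra.counit (R := k) h * c := rfl

theorem tensAct_lid (ρ : H →ₗ[k] (X →ₗ[k] X)) (h : H) :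
    (TensorProduct.lid k X).toLinearMap ∘ₗ tensAct trivAct ρ h =
      ρ h ∘ₗ (TensorProduct.lid k X).toLinearMap := by
  have key : ∀ p : H ⊗[k] H, (TensorProduct.lid k X).toLinearMap ∘ₗ act₂ trivAct ρ p =
      ρ (TensorProduct.lid k H (Coalgebra.counit.rTensor H p)) ∘ₗ
        (TensorProduct.lid k X).toLinearMap := by
    intro p
    induction p with
    | zero => simp
    | add p q hp hq => simp only [map_add, LinearMap.comp_add, LinearMap.add_comp, hp, hq]
    | tmul a b =>
      apply TensorProduct.ext'; intro c x
      simp only [LinearMap.comp_apply, LinearEquiv.coe_coe, act₂_tmul, TensorProduct.map_tmul, trivAct_apply,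
        TensorProduct.lid_tmul, LinearMap.rTensor_tmul, map_smul, LinearMap.smul_apply, mul_smul]
      rw [smul_comm]
  rw [tensAct_apply, key, Coalgebra.rTensor_counit_comul]; simp

theorem tensAct_rid (ρ : H →ₗ[k] (X →ₗ[k] X)) (h : H) :
    (TensorProduct.rid k X).toLinearMap ∘ₗ tensAct ρ trivAct h =
      ρ h ∘ₗ (TensorProduct.rid k X).toLinearMap := by
  have key : ∀ p : H ⊗[k] H, (TensorProduct.rid k X).toLinearMap ∘ₗ act₂ ρ trivAct p =
      ρ (TensorProduct.rid k H (Coalgebra.counit.lTensor H p)) ∘ₗ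
        (TensorProduct.rid k X).toLinearMap := by
    intro p
    induction p with
    | zero => simp
    | add p q hp hq => simp only [map_add, LinearMap.comp_add, LinearMap.add_comp, hp, hq]
    | tmul a b =>
      apply TensorProduct.ext'; intro c x
      simp only [LinearMap.comp_apply, LinearEquiv.coe_coe, act₂_tmul, TensorProduct.map_tmul, trivAct_apply,
        TensorProduct.rid_tmul, LinearMap.lTensor_tmul, map_smul, LinearMap.smul_apply, mul_smul]
      rw [smul_comm]
  rw [tensAct_apply, key, Coalgebra.lTensor_counit_comul]; simp

end

end Actions

/-! ### Quasitriangular, ribbon and factorizable Hopf algebras -/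

/-- An R-matrix on a Hopf algebra. `R₁₃ = ∑ (a ⊗ 1) ⊗ b`, `R₂₃ = ∑ (1 ⊗ a) ⊗ b` in
`(H ⊗ H) ⊗ H`, and `R₁₃ = ∑ a ⊗ (1 ⊗ b)`, `R₁₂ = ∑ a ⊗ (b ⊗ 1)` in `H ⊗ (H ⊗ H)`, for
`R = ∑ a ⊗ b`. -/
class QuasitriangularHopfAlgebra (k H : Type u) [Field k] [Ring H] [HopfAlgebra k H] where
  /-- The R-matrix. -/
  R : (H ⊗[k] H)ˣ
  R_mul_comul_mul_inv : ∀ h : H, (R : H ⊗[k] H) * Coalgebra.comul (R := k) h * (R⁻¹ : (H ⊗[k] H)ˣ) =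
    TensorProduct.comm k H H (Coalgebra.comul (R := k) h)
  comul_rTensor_R : (Coalgebra.comul (R := k) (A := H)).rTensor H (R : H ⊗[k] H) =
    (Algebra.TensorProduct.includeLeft : H →ₐ[k] H ⊗[k] H).toLinearMap.rTensor H (R : H ⊗[k] H) *
    (Algebra.TensorProduct.includeRight : H →ₐ[k] H ⊗[k] H).toLinearMap.rTensor H (R : H ⊗[k] H)
  comul_lTensor_R : (Coalgebra.comul (R := k) (A := H)).lTensor H (R : H ⊗[k] H) =
    (Algebra.TensorProduct.includeRight : H →ₐ[k] H ⊗[k] H).toLinearMap.lTensor H (R : H ⊗[k] H) *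
    (Algebra.TensorProduct.includeLeft : H →ₐ[k] H ⊗[k] H).toLinearMap.lTensor H (R : H ⊗[k] H)

/-- The R-matrix as an invertible element of `H ⊗ H`. -/
abbrev rMatrix (k H : Type u) [Field k] [Ring H] [HopfAlgebra k H]
    [QuasitriangularHopfAlgebra k H] : (H ⊗[k] H)ˣ := QuasitriangularHopfAlgebra.R

/-- The flip of `H ⊗ H` as an algebra automorphism. -/
abbrev flipAlg (k H : Type u) [Field k] [Ring H] [HopfAlgebra k H] : H ⊗[k] H ≃ₐ[k] H ⊗[k] H :=
  Algebra.TensorProduct.comm k H H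

/-- The monodromy matrix `Q = R₂₁ R`. -/
def monodromy (k H : Type u) [Field k] [Ring H] [HopfAlgebra k H]
    [QuasitriangularHopfAlgebra k H] : (H ⊗[k] H)ˣ :=
  Units.map (flipAlg k H).toAlgHom.toMonoidHom (rMatrix k H) * rMatrix k H

/-- A ribbon Hopf algebra: a quasitriangular Hopf algebra with a central invertible element `v`
such that `S(v) = v`, `ε(v) = 1` and `Δ(v) = (v ⊗ v) Q⁻¹`. -/
class RibbonHopfAlgebra (k H : Type u) [Field k] [Ring H] [HopfAlgebra k H]
    extends QuasitriangularHopfAlgebra k H where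
  /-- The ribbon element. -/
  v : Hˣ
  v_central : ∀ h : H, (v : H) * h = h * v
  antipode_v : HopfAlgebra.antipode k (v : H) = v
  counit_v : Coalgebra.counit (R := k) (v : H) = 1
  comul_v : Coalgebra.comul (R := k) (v : H) =
    ((v : H) ⊗ₜ[k] (v : H)) * ((monodromy k H)⁻¹ : (H ⊗[k] H)ˣ)

/-- The ribbon element as a unit. -/
abbrev ribbonElt (k H : Type u) [Field k] [Ring H] [HopfAlgebra k H]
    [RibbonHopfAlgebra k H] : Hˣ := RibbonHopfAlgebra.v k

/-- The monodromy matrix is non-degenerate: `Q = ∑ h_ℓ ⊗ k_ℓ` for two bases of `H`. -/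
def IsFactorizable (k H : Type u) [Field k] [Ring H] [HopfAlgebra k H]
    [QuasitriangularHopfAlgebra k H] : Prop :=
  ∃ (n : ℕ) (b c : Module.Basis (Fin n) k H),
    (monodromy k H : H ⊗[k] H) = ∑ i, b i ⊗ₜ[k] c i

section Antipode

variable {k H : Type u} [Field k] [Ring H] [HopfAlgebra k H]

open HopfAlgebra Coalgebra

theorem r_intertwine [QuasitriangularHopfAlgebra k H] (h : H) :
    (rMatrix k H : H ⊗[k] H) * comul (R := k) h =
      TensorProduct.comm k H H (comul (R := k) h) * (rMatrix k H : H ⊗[k] H) := by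
  rw [← QuasitriangularHopfAlgebra.R_mul_comul_mul_inv]; simp

theorem r_inv_intertwine [QuasitriangularHopfAlgebra k H] (h : H) :
    comul (R := k) h * ((rMatrix k H)⁻¹ : (H ⊗[k] H)ˣ) =
      ((rMatrix k H)⁻¹ : (H ⊗[k] H)ˣ) * TensorProduct.comm k H H (comul (R := k) h) := by
  rw [← QuasitriangularHopfAlgebra.R_mul_comul_mul_inv]; simp [mul_assoc]

/-- Twisted commutation with the Drinfeld element. -/
theorem antipode_sq_mul_drinfeld [QuasitriangularHopfAlgebra k H] (h : H) :
    antipode k (antipode k h) * (LinearMap.mul' k H ∘ₗ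
      (TensorProduct.comm k H H).toLinearMap ∘ₗ (antipode k).lTensor H) (rMatrix k H : H ⊗[k] H) =
    (LinearMap.mul' k H ∘ₗ (TensorProduct.comm k H H).toLinearMap ∘ₗ (antipode k).lTensor H)
      (rMatrix k H : H ⊗[k] H) * h := by
  set G : H ⊗[k] H →ₗ[k] H := LinearMap.mul' k H ∘ₗ
      (TensorProduct.comm k H H).toLinearMap ∘ₗ (antipode k).lTensor H with hG
  have G_tmul : ∀ x y : H, G (x ⊗ₜ y) = antipode k y * x := by intro x y; simp [hG]
  set u := G (rMatrix k H : H ⊗[k] H) with hu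
  -- `∑ S(h₂) u h₁ = ε(h) u`
  have hdag : ∀ h : H, G.comp (LinearMap.mulLeft k (rMatrix k H : H ⊗[k] H)) (comul (R := k) h) =
      counit (R := k) h • u := by
    intro h
    rw [LinearMap.comp_apply, LinearMap.mulLeft_apply, r_intertwine]
    have : ∀ q : H ⊗[k] H, G (TensorProduct.comm k H H (comul (R := k) h) * q) =
        counit (R := k) h • G q := by
      intro q
      induction q with
      | zero => simp
      | add p q hp hq => simp only [mul_add, map_add, hp, hq, smul_add]
      | tmul a b =>
        let 𝓡 := Coalgebra.Repr.arbitrary k h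
        have e := sum_antipode_mul_eq_smul 𝓡
        rw [← 𝓡.eq]
        simp only [map_sum, TensorProduct.comm_tmul, Finset.sum_mul,
          Algebra.TensorProduct.tmul_mul_tmul, G_tmul, antipode_mul_antidistrib]
        calc _ = antipode k b * (∑ i ∈ 𝓡.index, antipode k (𝓡.left i) * 𝓡.right i) * a := by
                simp only [Finset.mul_sum, Finset.sum_mul, mul_assoc]
          _ = _ := by rw [e]; simp
    rw [this]
  have hG2 : ∀ x y : H, G ((rMatrix k H : H ⊗[k] H) * (x ⊗ₜ y)) = antipode k y * u * x := by
    intro x y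
    rw [hu]
    generalize (rMatrix k H : H ⊗[k] H) = r
    induction r with
    | zero => simp
    | add p q hp hq => simp only [mul_add, add_mul, map_add, hp, hq]
    | tmul a b =>
      simp only [Algebra.TensorProduct.tmul_mul_tmul, G_tmul, antipode_mul_antidistrib, mul_assoc]
  -- apply `x ⊗ (y ⊗ z) ↦ S²(z) S(y) u x` to the two sides of coassociativity
  let T' : H →ₗ[k] H ⊗[k] H →ₗ[k] H :=
    (LinearMap.mul k H).flip.compl₂
        (LinearMap.mul' k H ∘ₗ (TensorProduct.comm k H H).toLinearMap ∘ₗ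
          TensorProduct.map (antipode k) (antipode k ∘ₗ antipode k)) ∘ₗ
      LinearMap.mulLeft k u
  have T'_apply : ∀ x y z, TensorProduct.lift T' (x ⊗ₜ (y ⊗ₜ z)) =
      antipode k (antipode k z) * antipode k y * (u * x) := by
    intro x y z; simp [T']
  have key := congrArg (TensorProduct.lift T') (Coalgebra.coassoc_apply (R := k) h)
  have lhs : TensorProduct.lift T' (TensorProduct.assoc k H H H
      ((comul (R := k)).rTensor H (comul (R := k) h))) = antipode k (antipode k h) * u := by
    have : ∀ q : H ⊗[k] H, TensorProduct.lift T' (TensorProduct.assoc k H H H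
        ((comul (R := k)).rTensor H q)) =
        antipode k (antipode k (TensorProduct.lid k H ((counit (R := k)).rTensor H q))) * u := by
      intro q
      induction q with
      | zero => simp
      | add p q hp hq => simp only [map_add, hp, hq, add_mul]
      | tmul a b =>
        have e : ∀ p : H ⊗[k] H, TensorProduct.lift T' (TensorProduct.assoc k H H H (p ⊗ₜ b)) =
            antipode k (antipode k b) * G.comp (LinearMap.mulLeft k (rMatrix k H : H ⊗[k] H)) p := by
          intro p
          induction p with
          | zero => simp
          | add p q hp hq => simp only [TensorProduct.add_tmul, map_add, hp, hq, mul_add]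
          | tmul x y =>
            rw [TensorProduct.assoc_tmul, T'_apply, LinearMap.comp_apply, LinearMap.mulLeft_apply,
              hG2]
            simp only [mul_assoc]
        rw [LinearMap.rTensor_tmul, e, hdag, LinearMap.rTensor_tmul, TensorProduct.lid_tmul]
        simp
    rw [this, Coalgebra.rTensor_counit_comul]; simp
  have rhs : TensorProduct.lift T' ((comul (R := k)).lTensor H (comul (R := k) h)) = u * h := by
    have : ∀ q : H ⊗[k] H, TensorProduct.lift T' ((comul (R := k)).lTensor H q) =
        u * TensorProduct.rid k H ((counit (R := k)).lTensor H q) := by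
      intro q
      induction q with
      | zero => simp
      | add p q hp hq => simp only [map_add, hp, hq, mul_add]
      | tmul a b =>
        let 𝓡 := Coalgebra.Repr.arbitrary k b
        have e := sum_mul_antipode_eq_smul 𝓡
        have e' : ∑ i ∈ 𝓡.index, antipode k (antipode k (𝓡.right i)) * antipode k (𝓡.left i) =
            counit (R := k) b • (1 : H) := by
          have := congrArg (antipode k) e
          simpa [map_sum, antipode_mul_antidistrib] using this
        rw [LinearMap.lTensor_tmul, ← 𝓡.eq]
        simp only [TensorProduct.tmul_sum, map_sum, T'_apply]
        rw [← Finset.sum_mul, e']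
        simp
    rw [this, Coalgebra.lTensor_counit_comul]; simp
  rw [← lhs, key, rhs]

/-- `(ε ⊗ id) R = 1`. -/
theorem counit_rTensor_R [QuasitriangularHopfAlgebra k H] :
    TensorProduct.lid k H ((counit (R := k)).rTensor H (rMatrix k H : H ⊗[k] H)) = 1 := by
  set r := TensorProduct.lid k H ((counit (R := k)).rTensor H (rMatrix k H : H ⊗[k] H)) with hr
  have h := QuasitriangularHopfAlgebra.comul_rTensor_R (k := k) (H := H)
  -- the algebra map `ε ⊗ id ⊗ id`
  let E : (H ⊗[k] H) ⊗[k] H →ₐ[k] H ⊗[k] H := Algebra.TensorProduct.map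
    ((Algebra.TensorProduct.lid k H).toAlgHom.comp
      (Algebra.TensorProduct.map (Bialgebra.counitAlgHom k H) (AlgHom.id k H))) (AlgHom.id k H)
  have h2 := congrArg E h
  rw [map_mul] at h2
  have e1 : E ((comul (R := k)).rTensor H (rMatrix k H : H ⊗[k] H)) = (rMatrix k H : H ⊗[k] H) := by
    have : E.toLinearMap ∘ₗ (comul (R := k)).rTensor H = LinearMap.id := by
      apply TensorProduct.ext'; intro a b
      have e : ∀ p : H ⊗[k] H, E (p ⊗ₜ b) =
          (TensorProduct.lid k H ((counit (R := k)).rTensor H p)) ⊗ₜ b := by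
        intro p
        induction p with
        | zero => simp
        | add p q hp hq => simp only [TensorProduct.add_tmul, map_add, hp, hq]
        | tmul x y => simp [E]
      simp [e]
    exact LinearMap.congr_fun this _
  have e2 : E ((Algebra.TensorProduct.includeLeft : H →ₐ[k] H ⊗[k] H).toLinearMap.rTensor H
      (rMatrix k H : H ⊗[k] H)) = 1 ⊗ₜ r := by
    rw [hr]; generalize (rMatrix k H : H ⊗[k] H) = p
    induction p with
    | zero => simp
    | add p q hp hq => simp only [map_add, hp, hq, TensorProduct.tmul_add]
    | tmul x y => simp [E, TensorProduct.smul_tmul]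
  have e3 : E ((Algebra.TensorProduct.includeRight : H →ₐ[k] H ⊗[k] H).toLinearMap.rTensor H
      (rMatrix k H : H ⊗[k] H)) = (rMatrix k H : H ⊗[k] H) := by
    generalize (rMatrix k H : H ⊗[k] H) = p
    induction p with
    | zero => simp
    | add p q hp hq => simp only [map_add, hp, hq]
    | tmul x y => simp [E]
  erw [e1, e2, e3] at h2
  have h3 : (1 : H ⊗[k] H) = 1 ⊗ₜ[k] r := by
    have := congrArg (· * (((rMatrix k H)⁻¹ : (H ⊗[k] H)ˣ) : H ⊗[k] H)) h2
    simpa [mul_assoc] using this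
  have h4 := congrArg (fun p => TensorProduct.lid k H ((counit (R := k)).rTensor H p)) h3
  simpa [Algebra.TensorProduct.one_def] using h4.symm

/-- `(S ⊗ id) R = R⁻¹`. -/
theorem antipode_rTensor_R [QuasitriangularHopfAlgebra k H] :
    (antipode k).rTensor H (rMatrix k H : H ⊗[k] H) = ((rMatrix k H)⁻¹ : (H ⊗[k] H)ˣ) := by
  have h := QuasitriangularHopfAlgebra.comul_rTensor_R (k := k) (H := H)
  let M : (H ⊗[k] H) ⊗[k] H →ₗ[k] H ⊗[k] H :=
    (LinearMap.mul' k H ∘ₗ (antipode k).rTensor H).rTensor H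
  have h2 := congrArg M h
  have e1 : M ((comul (R := k)).rTensor H (rMatrix k H : H ⊗[k] H)) = 1 := by
    have : ∀ p : H ⊗[k] H, M ((comul (R := k)).rTensor H p) =
        1 ⊗ₜ TensorProduct.lid k H ((counit (R := k)).rTensor H p) := by
      intro p
      induction p with
      | zero => simp
      | add p q hp hq => simp only [map_add, hp, hq, TensorProduct.tmul_add]
      | tmul x y =>
        simp [M, Algebra.algebraMap_eq_smul_one, TensorProduct.smul_tmul]
    rw [this, counit_rTensor_R]; rfl
  have e2 : ∀ p q : H ⊗[k] H,
      M ((Algebra.TensorProduct.includeLeft : H →ₐ[k] H ⊗[k] H).toLinearMap.rTensor H p *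
        (Algebra.TensorProduct.includeRight : H →ₐ[k] H ⊗[k] H).toLinearMap.rTensor H q) =
      (antipode k).rTensor H p * q := by
    intro p q
    induction p with
    | zero => simp
    | add p p' hp hq => simp only [map_add, add_mul, hp, hq]
    | tmul a b =>
      induction q with
      | zero => simp
      | add p p' hp hq => simp only [map_add, mul_add, hp, hq]
      | tmul c d => simp [M]
  erw [e1, e2] at h2
  exact (Units.inv_eq_of_mul_eq_one_left h2.symm).symm

theorem comul_rTensor_R_inv [QuasitriangularHopfAlgebra k H] :
    (comul (R := k) (A := H)).rTensor H (((rMatrix k H)⁻¹ : (H ⊗[k] H)ˣ) : H ⊗[k] H) =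
    (Algebra.TensorProduct.includeRight : H →ₐ[k] H ⊗[k] H).toLinearMap.rTensor H
      (((rMatrix k H)⁻¹ : (H ⊗[k] H)ˣ) : H ⊗[k] H) *
    (Algebra.TensorProduct.includeLeft : H →ₐ[k] H ⊗[k] H).toLinearMap.rTensor H
      (((rMatrix k H)⁻¹ : (H ⊗[k] H)ˣ) : H ⊗[k] H) := by
  have h := QuasitriangularHopfAlgebra.comul_rTensor_R (k := k) (H := H)
  let D := Algebra.TensorProduct.map (Bialgebra.comulAlgHom k H) (AlgHom.id k H)
  let A := Algebra.TensorProduct.map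
    (Algebra.TensorProduct.includeLeft : H →ₐ[k] H ⊗[k] H) (AlgHom.id k H)
  let B := Algebra.TensorProduct.map
    (Algebra.TensorProduct.includeRight : H →ₐ[k] H ⊗[k] H) (AlgHom.id k H)
  change D (rMatrix k H : H ⊗[k] H) = A (rMatrix k H : H ⊗[k] H) * B (rMatrix k H : H ⊗[k] H) at h
  change D _ = B _ * A _
  have hu : Units.map D.toMonoidHom (rMatrix k H) =
      Units.map A.toMonoidHom (rMatrix k H) * Units.map B.toMonoidHom (rMatrix k H) :=
    Units.ext h
  have := congrArg (fun x => ((x⁻¹ : Units _) : (H ⊗[k] H) ⊗[k] H)) hu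
  simp only [mul_inv_rev, ← map_inv] at this
  exact this

theorem comul_lTensor_R_inv [QuasitriangularHopfAlgebra k H] :
    (comul (R := k) (A := H)).lTensor H (((rMatrix k H)⁻¹ : (H ⊗[k] H)ˣ) : H ⊗[k] H) =
    (Algebra.TensorProduct.includeLeft : H →ₐ[k] H ⊗[k] H).toLinearMap.lTensor H
      (((rMatrix k H)⁻¹ : (H ⊗[k] H)ˣ) : H ⊗[k] H) *
    (Algebra.TensorProduct.includeRight : H →ₐ[k] H ⊗[k] H).toLinearMap.lTensor H
      (((rMatrix k H)⁻¹ : (H ⊗[k] H)ˣ) : H ⊗[k] H) := by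
  have h := QuasitriangularHopfAlgebra.comul_lTensor_R (k := k) (H := H)
  let D := Algebra.TensorProduct.map (AlgHom.id k H) (Bialgebra.comulAlgHom k H)
  let A := Algebra.TensorProduct.map (AlgHom.id k H)
    (Algebra.TensorProduct.includeLeft : H →ₐ[k] H ⊗[k] H)
  let B := Algebra.TensorProduct.map (AlgHom.id k H)
    (Algebra.TensorProduct.includeRight : H →ₐ[k] H ⊗[k] H)
  change D (rMatrix k H : H ⊗[k] H) = B (rMatrix k H : H ⊗[k] H) * A (rMatrix k H : H ⊗[k] H) at h
  change D _ = A _ * B _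
  have hu : Units.map D.toMonoidHom (rMatrix k H) =
      Units.map B.toMonoidHom (rMatrix k H) * Units.map A.toMonoidHom (rMatrix k H) :=
    Units.ext h
  have := congrArg (fun x => ((x⁻¹ : Units _) : H ⊗[k] (H ⊗[k] H))) hu
  simp only [mul_inv_rev, ← map_inv] at this
  exact this

/-- `(id ⊗ ε) R⁻¹ = 1`. -/
theorem counit_lTensor_R_inv [QuasitriangularHopfAlgebra k H] :
    TensorProduct.rid k H ((counit (R := k)).lTensor H
      (((rMatrix k H)⁻¹ : (H ⊗[k] H)ˣ) : H ⊗[k] H)) = 1 := by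
  set r := TensorProduct.rid k H ((counit (R := k)).lTensor H
      (((rMatrix k H)⁻¹ : (H ⊗[k] H)ˣ) : H ⊗[k] H)) with hr
  have h := comul_lTensor_R_inv (k := k) (H := H)
  let E : H ⊗[k] (H ⊗[k] H) →ₐ[k] H ⊗[k] H := Algebra.TensorProduct.map (AlgHom.id k H)
    ((Algebra.TensorProduct.lid k H).toAlgHom.comp
      (Algebra.TensorProduct.map (Bialgebra.counitAlgHom k H) (AlgHom.id k H)))
  have h2 := congrArg E h
  rw [map_mul] at h2
  have e1 : ∀ p : H ⊗[k] H, E ((comul (R := k)).lTensor H p) = p := by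
    have : E.toLinearMap ∘ₗ (comul (R := k)).lTensor H = LinearMap.id := by
      apply TensorProduct.ext'; intro b a
      have e : ∀ p : H ⊗[k] H, E (b ⊗ₜ p) =
          b ⊗ₜ (TensorProduct.lid k H ((counit (R := k)).rTensor H p)) := by
        intro p
        induction p with
        | zero => simp
        | add p q hp hq => simp only [TensorProduct.tmul_add, map_add, hp, hq]
        | tmul x y => simp [E]
      simp [e]
    exact fun p => LinearMap.congr_fun this p
  have e2 : E ((Algebra.TensorProduct.includeLeft : H →ₐ[k] H ⊗[k] H).toLinearMap.lTensor H
      (((rMatrix k H)⁻¹ : (H ⊗[k] H)ˣ) : H ⊗[k] H)) = r ⊗ₜ 1 := by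
    rw [hr]; generalize (((rMatrix k H)⁻¹ : (H ⊗[k] H)ˣ) : H ⊗[k] H) = p
    induction p with
    | zero => simp
    | add p q hp hq => simp only [map_add, hp, hq, TensorProduct.add_tmul]
    | tmul x y => simp [E, TensorProduct.smul_tmul]
  have e3 : ∀ p : H ⊗[k] H, E ((Algebra.TensorProduct.includeRight :
      H →ₐ[k] H ⊗[k] H).toLinearMap.lTensor H p) = p := by
    intro p
    induction p with
    | zero => simp
    | add p q hp hq => simp only [map_add, hp, hq]
    | tmul x y => simp [E]
  erw [e1, e2, e3] at h2
  have h3 : (1 : H ⊗[k] H) = r ⊗ₜ[k] 1 := by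
    have := congrArg (· * ((rMatrix k H : (H ⊗[k] H)ˣ) : H ⊗[k] H)) h2
    simpa [mul_assoc] using this
  have h4 := congrArg (fun p => TensorProduct.rid k H ((counit (R := k)).lTensor H p)) h3
  simpa [Algebra.TensorProduct.one_def] using h4.symm

/-- `(id ⊗ S) R⁻¹ = R`. -/
theorem antipode_lTensor_R_inv [QuasitriangularHopfAlgebra k H] :
    (antipode k).lTensor H (((rMatrix k H)⁻¹ : (H ⊗[k] H)ˣ) : H ⊗[k] H) = rMatrix k H := by
  have h := comul_lTensor_R_inv (k := k) (H := H)
  let M : H ⊗[k] (H ⊗[k] H) →ₗ[k] H ⊗[k] H :=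
    (LinearMap.mul' k H ∘ₗ (antipode k).rTensor H).lTensor H
  have h2 := congrArg M h
  have e1 : M ((comul (R := k)).lTensor H (((rMatrix k H)⁻¹ : (H ⊗[k] H)ˣ) : H ⊗[k] H)) = 1 := by
    have : ∀ p : H ⊗[k] H, M ((comul (R := k)).lTensor H p) =
        TensorProduct.rid k H ((counit (R := k)).lTensor H p) ⊗ₜ 1 := by
      intro p
      induction p with
      | zero => simp
      | add p q hp hq => simp only [map_add, hp, hq, TensorProduct.add_tmul]
      | tmul x y =>
        simp [M, Algebra.algebraMap_eq_smul_one, TensorProduct.smul_tmul]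
    rw [this, counit_lTensor_R_inv]; rfl
  have e2 : ∀ p q : H ⊗[k] H,
      M ((Algebra.TensorProduct.includeLeft : H →ₐ[k] H ⊗[k] H).toLinearMap.lTensor H p *
        (Algebra.TensorProduct.includeRight : H →ₐ[k] H ⊗[k] H).toLinearMap.lTensor H q) =
      (antipode k).lTensor H p * q := by
    intro p q
    induction p with
    | zero => simp
    | add p p' hp hq => simp only [map_add, add_mul, hp, hq]
    | tmul a b =>
      induction q with
      | zero => simp
      | add p p' hp hq => simp only [map_add, mul_add, hp, hq]
      | tmul c d => simp [M]
  erw [e1, e2] at h2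
  have := congrArg (· * ((rMatrix k H : (H ⊗[k] H)ˣ) : H ⊗[k] H)) h2
  simpa [mul_assoc] using this.symm

/-- The antipode of a finite-dimensional quasitriangular Hopf algebra is invertible. -/
theorem antipode_bijective [QuasitriangularHopfAlgebra k H] [FiniteDimensional k H] :
    Function.Bijective (antipode k : H →ₗ[k] H) := by
  set G : H ⊗[k] H →ₗ[k] H := LinearMap.mul' k H ∘ₗ
      (TensorProduct.comm k H H).toLinearMap ∘ₗ (antipode k).lTensor H with hG
  have G_tmul : ∀ x y : H, G (x ⊗ₜ y) = antipode k y * x := by intro x y; simp [hG]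
  have comm_u : ∀ h : H, antipode k (antipode k h) * G (rMatrix k H : H ⊗[k] H) =
    G (rMatrix k H : H ⊗[k] H) * h := antipode_sq_mul_drinfeld
  set u := G (rMatrix k H : H ⊗[k] H) with hu
  -- the right inverse `∑ b S²(a)` of `u`
  let W : H ⊗[k] H →ₗ[k] H := LinearMap.mul' k H ∘ₗ (TensorProduct.comm k H H).toLinearMap ∘ₗ
    (antipode k ∘ₗ antipode k).rTensor H
  have W_tmul : ∀ x y : H, W (x ⊗ₜ y) = y * antipode k (antipode k x) := by intro x y; simp [W]
  have hW : ∀ p : H ⊗[k] H, u * W p =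
      G ((rMatrix k H : H ⊗[k] H) *
        TensorProduct.map (antipode k ∘ₗ antipode k) (antipode k) p) := by
    intro p
    induction p with
    | zero => simp
    | add p q hp hq => simp only [map_add, mul_add, hp, hq]
    | tmul a b =>
      rw [W_tmul, ← mul_assoc, ← comm_u, hu]
      generalize (rMatrix k H : H ⊗[k] H) = r
      induction r with
      | zero => simp
      | add p q hp hq => simp only [map_add, mul_add, add_mul, hp, hq]
      | tmul c d => simp [G_tmul, antipode_mul_antidistrib, mul_assoc]
  have hSS : TensorProduct.map (antipode k ∘ₗ antipode k) (antipode k)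
      (rMatrix k H : H ⊗[k] H) = (((rMatrix k H)⁻¹ : (H ⊗[k] H)ˣ) : H ⊗[k] H) := by
    have : ∀ p : H ⊗[k] H, TensorProduct.map (antipode k ∘ₗ antipode k) (antipode k) p =
        (antipode k).rTensor H ((antipode k).lTensor H ((antipode k).rTensor H p)) := by
      intro p
      induction p with
      | zero => simp
      | add p q hp hq => simp only [map_add, hp, hq]
      | tmul a b => simp
    rw [this, antipode_rTensor_R, antipode_lTensor_R_inv, antipode_rTensor_R]
  have hw : u * W (rMatrix k H : H ⊗[k] H) = 1 := by
    rw [hW, hSS, Units.mul_inv, Algebra.TensorProduct.one_def, G_tmul]; simp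
  have hsurj : Function.Surjective (LinearMap.mulLeft k u) := fun x =>
    ⟨W (rMatrix k H : H ⊗[k] H) * x, by simp [← mul_assoc, hw]⟩
  have hinj : Function.Injective (LinearMap.mulLeft k u) :=
    LinearMap.injective_iff_surjective.mpr hsurj
  have hS : Function.Injective (antipode k : H →ₗ[k] H) := by
    rw [injective_iff_map_eq_zero]
    intro h hh
    apply hinj
    have := comm_u h
    simp only [hh, map_zero, zero_mul] at this
    simp [← this]
  exact ⟨hS, LinearMap.injective_iff_surjective.mp hS⟩

variable (k H) in
/-- The inverse of the antipode. -/
def antipodeInv [QuasitriangularHopfAlgebra k H] [FiniteDimensional k H] : H →ₗ[k] H :=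
  (LinearEquiv.ofBijective (antipode k : H →ₗ[k] H) antipode_bijective).symm.toLinearMap

section
variable [QuasitriangularHopfAlgebra k H] [FiniteDimensional k H]

@[simp] theorem antipode_antipodeInv (h : H) : antipode k (antipodeInv k H h) = h :=
  (LinearEquiv.ofBijective (antipode k : H →ₗ[k] H) antipode_bijective).apply_symm_apply h

@[simp] theorem antipodeInv_antipode (h : H) : antipodeInv k H (antipode k h) = h :=
  (LinearEquiv.ofBijective (antipode k : H →ₗ[k] H) antipode_bijective).symm_apply_apply h

theorem antipodeInv_mul (a b : H) :
    antipodeInv k H (a * b) = antipodeInv k H b * antipodeInv k H a := by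
  apply (antipode_bijective (k := k) (H := H)).1
  simp [antipode_mul_antidistrib]

@[simp] theorem antipodeInv_one : antipodeInv k H 1 = 1 := by
  apply (antipode_bijective (k := k) (H := H)).1
  simp

/-- `∑ h₂ S⁻¹(h₁) = ε(h)` -/
theorem mul_antipodeInv_rev (h : H) :
    LinearMap.mul' k H (TensorProduct.comm k H H
      ((antipodeInv k H).rTensor H (comul (R := k) h))) = algebraMap k H (counit h) := by
  apply (antipode_bijective (k := k) (H := H)).1
  let 𝓡 := Coalgebra.Repr.arbitrary k h
  have e := sum_antipode_mul_eq_smul 𝓡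
  have e2 := sum_mul_antipode_eq_smul 𝓡
  rw [← 𝓡.eq]
  simp [map_sum, antipode_mul_antidistrib, e2, Algebra.algebraMap_eq_smul_one]

/-- `∑ S⁻¹(h₂) h₁ = ε(h)` -/
theorem antipodeInv_mul_rev (h : H) :
    LinearMap.mul' k H (TensorProduct.comm k H H
      ((antipodeInv k H).lTensor H (comul (R := k) h))) = algebraMap k H (counit h) := by
  apply (antipode_bijective (k := k) (H := H)).1
  let 𝓡 := Coalgebra.Repr.arbitrary k h
  have e := sum_antipode_mul_eq_smul 𝓡
  rw [← 𝓡.eq]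
  simp [map_sum, antipode_mul_antidistrib, e, Algebra.algebraMap_eq_smul_one]

end

end Antipode

/-! ### Bimodules over a Hopf algebra -/

/-- A finite-dimensional bimodule over `H`: a left action `act` and a right action `ract` that
commute with each other. -/
structure HBimod (k H : Type u) [Field k] [Ring H] [HopfAlgebra k H] where
  /-- The underlying vector space. -/
  V : Type u
  [addCommGroup : AddCommGroup V]
  [module : Module k V]
  [finiteDimensional : FiniteDimensional k V]
  /-- The left action. -/
  act : H →ₗ[k] (V →ₗ[k] V)
  act_one : act 1 = LinearMap.id
  act_mul : ∀ a b, act (a * b) = act a ∘ₗ act b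
  /-- The right action; `ract h x` is `x · h`. -/
  ract : H →ₗ[k] (V →ₗ[k] V)
  ract_one : ract 1 = LinearMap.id
  ract_mul : ∀ a b, ract (a * b) = ract b ∘ₗ ract a
  act_ract : ∀ a b, act a ∘ₗ ract b = ract b ∘ₗ act a

attribute [instance] HBimod.addCommGroup HBimod.module HBimod.finiteDimensional

namespace HBimod

variable {k H : Type u} [Field k] [Ring H] [HopfAlgebra k H]

/-- Morphisms of bimodules. -/
@[ext]
structure Hom (X Y : HBimod k H) where
  /-- The underlying linear map. -/
  lin : X.V →ₗ[k] Y.V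
  lin_act : ∀ h, lin ∘ₗ X.act h = Y.act h ∘ₗ lin
  lin_ract : ∀ h, lin ∘ₗ X.ract h = Y.ract h ∘ₗ lin

instance : Category (HBimod k H) where
  Hom := Hom
  id X := ⟨LinearMap.id, fun _ => rfl, fun _ => rfl⟩
  comp f g := ⟨g.lin ∘ₗ f.lin,
    fun h => by rw [LinearMap.comp_assoc, f.lin_act, ← LinearMap.comp_assoc, g.lin_act]; rfl,
    fun h => by rw [LinearMap.comp_assoc, f.lin_ract, ← LinearMap.comp_assoc, g.lin_ract]; rfl⟩

@[ext] theorem hom_ext {X Y : HBimod k H} {f g : X ⟶ Y} (h : Hom.lin f = Hom.lin g) : f = g :=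
  Hom.ext h

/-- The underlying linear map of a morphism of bimodules. -/
abbrev toLin {X Y : HBimod k H} (f : X ⟶ Y) : X.V →ₗ[k] Y.V := Hom.lin f

@[simp] theorem id_lin (X : HBimod k H) : Hom.lin (𝟙 X) = LinearMap.id := rfl

@[simp] theorem comp_lin {X Y Z : HBimod k H} (f : X ⟶ Y) (g : Y ⟶ Z) :
    Hom.lin (f ≫ g) = Hom.lin g ∘ₗ Hom.lin f := rfl

/-- An invertible linear map that intertwines the actions is an isomorphism of bimodules. -/
def isoOfEquiv {X Y : HBimod k H} (e : X.V ≃ₗ[k] Y.V)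
    (h₁ : ∀ h, e.toLinearMap ∘ₗ X.act h = Y.act h ∘ₗ e.toLinearMap)
    (h₂ : ∀ h, e.toLinearMap ∘ₗ X.ract h = Y.ract h ∘ₗ e.toLinearMap) : X ≅ Y where
  hom := ⟨e.toLinearMap, h₁, h₂⟩
  inv := ⟨e.symm.toLinearMap,
    fun h => by
      ext y
      apply e.injective
      have := LinearMap.congr_fun (h₁ h) (e.symm y)
      simpa using this.symm,
    fun h => by
      ext y
      apply e.injective
      have := LinearMap.congr_fun (h₂ h) (e.symm y)
      simpa using this.symm⟩
  hom_inv_id := by apply hom_ext; ext x; simp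
  inv_hom_id := by apply hom_ext; ext x; simp

@[simp] theorem isoOfEquiv_hom_lin {X Y : HBimod k H} (e : X.V ≃ₗ[k] Y.V) (h₁) (h₂) :
    Hom.lin (isoOfEquiv (X := X) (Y := Y) e h₁ h₂).hom = e.toLinearMap := rfl

@[simp] theorem isoOfEquiv_inv_lin {X Y : HBimod k H} (e : X.V ≃ₗ[k] Y.V) (h₁) (h₂) :
    Hom.lin (isoOfEquiv (X := X) (Y := Y) e h₁ h₂).inv = e.symm.toLinearMap := rfl

/-! The monoidal structure: both actions are pulled back along the coproduct. -/

theorem tensAct_one' {X Y : Type u} [AddCommGroup X] [Module k X] [AddCommGroup Y] [Module k Y]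
    {ρ : H →ₗ[k] (X →ₗ[k] X)} {σ : H →ₗ[k] (Y →ₗ[k] Y)}
    (hρ : ρ 1 = LinearMap.id) (hσ : σ 1 = LinearMap.id) : tensAct ρ σ 1 = LinearMap.id := by
  rw [tensAct_apply, Bialgebra.comul_one, act₂_one hρ hσ]

/-- The tensor product of bimodules. -/
@[simps V act ract]
def tensor (X Y : HBimod k H) : HBimod k H where
  V := X.V ⊗[k] Y.V
  act := tensAct X.act Y.act
  act_one := tensAct_one' X.act_one Y.act_one
  act_mul a b := by
    simp only [tensAct_apply, Bialgebra.comul_mul, act₂_mul X.act_mul Y.act_mul]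
  ract := tensAct X.ract Y.ract
  ract_one := tensAct_one' X.ract_one Y.ract_one
  ract_mul a b := by
    simp only [tensAct_apply, Bialgebra.comul_mul, act₂_mul_rev X.ract_mul Y.ract_mul]
  act_ract a b := act₂_commute X.act_ract Y.act_ract _ _

variable (k H) in
/-- The tensor unit: the ground field with both actions given by the counit. -/
@[simps V act ract]
def unit : HBimod k H where
  V := k
  act := trivAct
  act_one := by ext; simp [trivAct_apply]
  act_mul a b := by ext; simp [trivAct_apply]
  ract := trivAct
  ract_one := by ext; simp [trivAct_apply]
  ract_mul a b := by ext; simp [trivAct_apply, mul_comm]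
  act_ract a b := by ext; simp [trivAct_apply, mul_comm]

/-- The tensor product of morphisms. -/
def tensorMap {X Y X' Y' : HBimod k H} (f : X ⟶ X') (g : Y ⟶ Y') : tensor X Y ⟶ tensor X' Y' where
  lin := TensorProduct.map (Hom.lin f) (Hom.lin g)
  lin_act _ := act₂_intertwine f.lin_act g.lin_act _
  lin_ract _ := act₂_intertwine f.lin_ract g.lin_ract _

instance : MonoidalCategoryStruct (HBimod k H) where
  tensorObj := tensor
  tensorUnit := unit k H
  tensorHom := tensorMap
  whiskerLeft X _ _ f := tensorMap (𝟙 X) f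
  whiskerRight f Y := tensorMap f (𝟙 Y)
  associator X Y Z := isoOfEquiv (X := tensor (tensor X Y) Z) (Y := tensor X (tensor Y Z))
    (TensorProduct.assoc k X.V Y.V Z.V)
    (tensAct_assoc X.act Y.act Z.act) (tensAct_assoc X.ract Y.ract Z.ract)
  leftUnitor X := isoOfEquiv (X := tensor (unit k H) X) (Y := X) (TensorProduct.lid k X.V)
    (tensAct_lid X.act) (tensAct_lid X.ract)
  rightUnitor X := isoOfEquiv (X := tensor X (unit k H)) (Y := X) (TensorProduct.rid k X.V)
    (tensAct_rid X.act) (tensAct_rid X.ract)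

open MonoidalCategory

theorem tensorObj_def (X Y : HBimod k H) : X ⊗ Y = tensor X Y := rfl
theorem tensorUnit_def : 𝟙_ (HBimod k H) = unit k H := rfl

theorem tensorHom_lin {X Y X' Y' : HBimod k H} (f : X ⟶ X') (g : Y ⟶ Y') :
    Hom.lin (f ⊗ₘ g) = TensorProduct.map (Hom.lin f) (Hom.lin g) := rfl
theorem whiskerLeft_lin (X : HBimod k H) {Y Y' : HBimod k H} (g : Y ⟶ Y') :
    Hom.lin (X ◁ g) = TensorProduct.map LinearMap.id (Hom.lin g) := rfl
theorem whiskerRight_lin {X X' : HBimod k H} (f : X ⟶ X') (Y : HBimod k H) :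
    Hom.lin (f ▷ Y) = TensorProduct.map (Hom.lin f) LinearMap.id := rfl
theorem associator_hom_lin (X Y Z : HBimod k H) :
    Hom.lin (α_ X Y Z).hom = (TensorProduct.assoc k X.V Y.V Z.V).toLinearMap := rfl
theorem associator_inv_lin (X Y Z : HBimod k H) :
    Hom.lin (α_ X Y Z).inv = (TensorProduct.assoc k X.V Y.V Z.V).symm.toLinearMap := rfl
theorem leftUnitor_hom_lin (X : HBimod k H) :
    Hom.lin (λ_ X).hom = (TensorProduct.lid k X.V).toLinearMap := rfl
theorem leftUnitor_inv_lin (X : HBimod k H) :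
    Hom.lin (λ_ X).inv = (TensorProduct.lid k X.V).symm.toLinearMap := rfl
theorem rightUnitor_hom_lin (X : HBimod k H) :
    Hom.lin (ρ_ X).hom = (TensorProduct.rid k X.V).toLinearMap := rfl
theorem rightUnitor_inv_lin (X : HBimod k H) :
    Hom.lin (ρ_ X).inv = (TensorProduct.rid k X.V).symm.toLinearMap := rfl

instance : MonoidalCategory (HBimod k H) where
  tensorHom_def f g := hom_ext <| TensorProduct.ext' fun _ _ => rfl
  id_tensorHom_id X Y := hom_ext <| TensorProduct.ext' fun _ _ => rfl
  tensorHom_comp_tensorHom f₁ f₂ g₁ g₂ := hom_ext <| TensorProduct.ext' fun _ _ => rfl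
  whiskerLeft_id X Y := hom_ext <| TensorProduct.ext' fun _ _ => rfl
  id_whiskerRight X Y := hom_ext <| TensorProduct.ext' fun _ _ => rfl
  associator_naturality f g h := hom_ext <| TensorProduct.ext_threefold fun _ _ _ => rfl
  leftUnitor_naturality f := hom_ext <| TensorProduct.ext' fun c x =>
    ((Hom.lin f).map_smul c x).symm
  rightUnitor_naturality f := hom_ext <| TensorProduct.ext' fun x c =>
    ((Hom.lin f).map_smul c x).symm
  pentagon W X Y Z := hom_ext <| TensorProduct.ext_fourfold fun _ _ _ _ => rfl
  triangle X Y := hom_ext <| TensorProduct.ext_threefold fun (x : X.V) (c : k) (y : Y.V) =>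
    (TensorProduct.smul_tmul c x y).symm

/-! The braiding: `x ⊗ y ↦ R⁻¹ · (y ⊗ x) · R`. -/

section Braiding

section
variable {X Y Z : Type u} [AddCommGroup X] [Module k X] [AddCommGroup Y] [Module k Y]
  [AddCommGroup Z] [Module k Z] (ρ : H →ₗ[k] (X →ₗ[k] X)) (σ : H →ₗ[k] (Y →ₗ[k] Y))
  (τ : H →ₗ[k] (Z →ₗ[k] Z))

theorem act₂_includeRight_rTensor (hρ : ρ 1 = LinearMap.id) (p : H ⊗[k] H) :
    (TensorProduct.assoc k X Y Z).toLinearMap ∘ₗ act₂ (act₂ ρ σ) τ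
      ((Algebra.TensorProduct.includeRight : H →ₐ[k] H ⊗[k] H).toLinearMap.rTensor H p) =
    TensorProduct.map LinearMap.id (act₂ σ τ p) ∘ₗ (TensorProduct.assoc k X Y Z).toLinearMap := by
  induction p with
  | zero => simp
  | add p q hp hq =>
    simp only [map_add, LinearMap.comp_add, LinearMap.add_comp, hp, hq, TensorProduct.map_add_right]
  | tmul a b => apply TensorProduct.ext_threefold; intro x y z; simp [hρ]

theorem act₂_includeLeft_rTensor (hσ : σ 1 = LinearMap.id) (p : H ⊗[k] H) :
    act₂ (act₂ ρ σ) τ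
      ((Algebra.TensorProduct.includeLeft : H →ₐ[k] H ⊗[k] H).toLinearMap.rTensor H p) ∘ₗ
        (TensorProduct.rightComm k X Z Y).toLinearMap =
    (TensorProduct.rightComm k X Z Y).toLinearMap ∘ₗ
      TensorProduct.map (act₂ ρ τ p) LinearMap.id := by
  induction p with
  | zero => simp
  | add p q hp hq =>
    simp only [map_add, LinearMap.comp_add, LinearMap.add_comp, hp, hq, TensorProduct.map_add_left]
  | tmul a b => apply TensorProduct.ext_threefold; intro x y z; simp [hσ]

theorem act₂_includeLeft_lTensor (hτ : τ 1 = LinearMap.id) (p : H ⊗[k] H) :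
    (TensorProduct.assoc k X Y Z).symm.toLinearMap ∘ₗ act₂ ρ (act₂ σ τ)
      ((Algebra.TensorProduct.includeLeft : H →ₐ[k] H ⊗[k] H).toLinearMap.lTensor H p) =
    TensorProduct.map (act₂ ρ σ p) LinearMap.id ∘ₗ
      (TensorProduct.assoc k X Y Z).symm.toLinearMap := by
  induction p with
  | zero => simp
  | add p q hp hq =>
    simp only [map_add, LinearMap.comp_add, LinearMap.add_comp, hp, hq, TensorProduct.map_add_left]
  | tmul a b =>
    ext x y z; simp [hτ]

theorem act₂_includeRight_lTensor (hσ : σ 1 = LinearMap.id) (p : H ⊗[k] H) :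
    act₂ ρ (act₂ σ τ)
      ((Algebra.TensorProduct.includeRight : H →ₐ[k] H ⊗[k] H).toLinearMap.lTensor H p) ∘ₗ
        (TensorProduct.leftComm k Y X Z).toLinearMap =
    (TensorProduct.leftComm k Y X Z).toLinearMap ∘ₗ
      TensorProduct.map LinearMap.id (act₂ ρ τ p) := by
  induction p with
  | zero => simp
  | add p q hp hq =>
    simp only [map_add, LinearMap.comp_add, LinearMap.add_comp, hp, hq, TensorProduct.map_add_right]
  | tmul a b => ext x y z; simp [hσ]

end

variable [QuasitriangularHopfAlgebra k H]

/-- The operator `z ↦ R⁻¹ · z · R` on a tensor product of bimodules. -/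
def conjR (X Y : HBimod k H) : X.V ⊗[k] Y.V ≃ₗ[k] X.V ⊗[k] Y.V :=
  LinearEquiv.ofLinearMap
    (act₂ X.act Y.act (((rMatrix k H)⁻¹ : (H ⊗[k] H)ˣ) : H ⊗[k] H) ∘ₗ
      act₂ X.ract Y.ract (rMatrix k H : H ⊗[k] H))
    (act₂ X.ract Y.ract (((rMatrix k H)⁻¹ : (H ⊗[k] H)ˣ) : H ⊗[k] H) ∘ₗ
      act₂ X.act Y.act (rMatrix k H : H ⊗[k] H))
    (by
      rw [LinearMap.comp_assoc, ← LinearMap.comp_assoc _ _ (act₂ X.ract Y.ract _),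
        ← act₂_mul_rev X.ract_mul Y.ract_mul, Units.inv_mul, act₂_one X.ract_one Y.ract_one,
        LinearMap.id_comp, ← act₂_mul X.act_mul Y.act_mul, Units.inv_mul,
        act₂_one X.act_one Y.act_one])
    (by
      rw [LinearMap.comp_assoc, ← LinearMap.comp_assoc _ _ (act₂ X.act Y.act _),
        ← act₂_mul X.act_mul Y.act_mul, Units.mul_inv, act₂_one X.act_one Y.act_one,
        LinearMap.id_comp, ← act₂_mul_rev X.ract_mul Y.ract_mul, Units.mul_inv,
        act₂_one X.ract_one Y.ract_one])

/-- The braiding isomorphism `x ⊗ y ↦ R⁻¹ · (y ⊗ x) · R`. -/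
def braid (X Y : HBimod k H) : tensor X Y ≅ tensor Y X :=
  isoOfEquiv (X := tensor X Y) (Y := tensor Y X)
    (TensorProduct.comm k X.V Y.V ≪≫ₗ conjR Y X)
    (by
      intro h
      change (act₂ Y.act X.act _ ∘ₗ act₂ Y.ract X.ract _) ∘ₗ
          (TensorProduct.comm k X.V Y.V).toLinearMap ∘ₗ act₂ X.act Y.act _ =
        act₂ Y.act X.act _ ∘ₗ (act₂ Y.act X.act _ ∘ₗ act₂ Y.ract X.ract _) ∘ₗ
          (TensorProduct.comm k X.V Y.V).toLinearMap
      rw [act₂_flip, ← LinearMap.comp_assoc, LinearMap.comp_assoc _ _ (act₂ Y.act X.act _),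
        ← act₂_commute Y.act_ract X.act_ract, ← LinearMap.comp_assoc,
        ← act₂_mul Y.act_mul X.act_mul, ← r_inv_intertwine, act₂_mul Y.act_mul X.act_mul]
      rfl)
    (by
      intro h
      change (act₂ Y.act X.act _ ∘ₗ act₂ Y.ract X.ract _) ∘ₗ
          (TensorProduct.comm k X.V Y.V).toLinearMap ∘ₗ act₂ X.ract Y.ract _ =
        act₂ Y.ract X.ract _ ∘ₗ (act₂ Y.act X.act _ ∘ₗ act₂ Y.ract X.ract _) ∘ₗ
          (TensorProduct.comm k X.V Y.V).toLinearMap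
      rw [act₂_flip, ← LinearMap.comp_assoc, LinearMap.comp_assoc _ _ (act₂ Y.act X.act _),
        ← act₂_mul_rev Y.ract_mul X.ract_mul, ← r_intertwine, act₂_mul_rev Y.ract_mul X.ract_mul,
        ← LinearMap.comp_assoc, act₂_commute Y.act_ract X.act_ract]
      rfl)

theorem braid_hom_lin (X Y : HBimod k H) :
    Hom.lin (braid X Y).hom =
      (conjR Y X).toLinearMap ∘ₗ (TensorProduct.comm k X.V Y.V).toLinearMap := rfl

theorem conjR_naturality {X Y X' Y' : HBimod k H} (f : X ⟶ X') (g : Y ⟶ Y') :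
    TensorProduct.map (Hom.lin f) (Hom.lin g) ∘ₗ (conjR X Y).toLinearMap =
      (conjR X' Y').toLinearMap ∘ₗ TensorProduct.map (Hom.lin f) (Hom.lin g) := by
  change _ ∘ₗ act₂ _ _ _ ∘ₗ act₂ _ _ _ = (act₂ _ _ _ ∘ₗ act₂ _ _ _) ∘ₗ _
  rw [← LinearMap.comp_assoc, act₂_intertwine f.lin_act g.lin_act, LinearMap.comp_assoc,
    act₂_intertwine f.lin_ract g.lin_ract, LinearMap.comp_assoc]

/-- `conjR` on `(X ⊗ Y) ⊗ Z` factorizes. -/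
theorem conjR_tensor_left (X Y Z : HBimod k H) :
    (TensorProduct.assoc k X.V Y.V Z.V).toLinearMap ∘ₗ
        (conjR (tensor X Y) Z).toLinearMap ∘ₗ
        (TensorProduct.rightComm k X.V Z.V Y.V).toLinearMap =
      TensorProduct.map LinearMap.id (conjR Y Z).toLinearMap ∘ₗ
        (TensorProduct.assoc k X.V Y.V Z.V).toLinearMap ∘ₗ
        (TensorProduct.rightComm k X.V Z.V Y.V).toLinearMap ∘ₗ
        TensorProduct.map (conjR X Z).toLinearMap LinearMap.id := by
  have hL := fun p => act₂_includeRight_rTensor X.act Y.act Z.act X.act_one p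
  have hR := fun p => act₂_includeRight_rTensor X.ract Y.ract Z.ract X.ract_one p
  have hL' := fun p => act₂_includeLeft_rTensor X.act Y.act Z.act Y.act_one p
  have hR' := fun p => act₂_includeLeft_rTensor X.ract Y.ract Z.ract Y.ract_one p
  have e : (conjR (tensor X Y) Z).toLinearMap =
      (act₂ (act₂ X.act Y.act) Z.act
        ((Algebra.TensorProduct.includeRight : H →ₐ[k] H ⊗[k] H).toLinearMap.rTensor H
          (((rMatrix k H)⁻¹ : (H ⊗[k] H)ˣ) : H ⊗[k] H)) ∘ₗ
        act₂ (act₂ X.act Y.act) Z.act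
        ((Algebra.TensorProduct.includeLeft : H →ₐ[k] H ⊗[k] H).toLinearMap.rTensor H
          (((rMatrix k H)⁻¹ : (H ⊗[k] H)ˣ) : H ⊗[k] H))) ∘ₗ
      (act₂ (act₂ X.ract Y.ract) Z.ract
        ((Algebra.TensorProduct.includeRight : H →ₐ[k] H ⊗[k] H).toLinearMap.rTensor H
          (rMatrix k H : H ⊗[k] H)) ∘ₗ
        act₂ (act₂ X.ract Y.ract) Z.ract
        ((Algebra.TensorProduct.includeLeft : H →ₐ[k] H ⊗[k] H).toLinearMap.rTensor H
          (rMatrix k H : H ⊗[k] H))) := by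
    rw [← act₂_mul (act₂_mul X.act_mul Y.act_mul) Z.act_mul,
      ← act₂_mul_rev (act₂_mul_rev X.ract_mul Y.ract_mul) Z.ract_mul,
      ← comul_rTensor_R_inv, ← QuasitriangularHopfAlgebra.comul_rTensor_R,
      ← act₂_comp_left, ← act₂_comp_left]
    rfl
  have hc := fun p q => act₂_commute (act₂_commute X.act_ract Y.act_ract) Z.act_ract p q
  have c1 : (conjR Y Z).toLinearMap = act₂ Y.act Z.act _ ∘ₗ act₂ Y.ract Z.ract _ := rfl
  have c2 : (conjR X Z).toLinearMap = act₂ X.act Z.act _ ∘ₗ act₂ X.ract Z.ract _ := rfl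
  rw [e, c1, c2]
  have m1 : ∀ (f g : Y.V ⊗[k] Z.V →ₗ[k] Y.V ⊗[k] Z.V),
      TensorProduct.map (LinearMap.id : X.V →ₗ[k] X.V) (f ∘ₗ g) =
      TensorProduct.map LinearMap.id f ∘ₗ TensorProduct.map LinearMap.id g := fun f g =>
    (TensorProduct.map_comp LinearMap.id f LinearMap.id g)
  have m2 : ∀ (f g : X.V ⊗[k] Z.V →ₗ[k] X.V ⊗[k] Z.V),
      TensorProduct.map (f ∘ₗ g) (LinearMap.id : Y.V →ₗ[k] Y.V) =
      TensorProduct.map f LinearMap.id ∘ₗ TensorProduct.map g LinearMap.id := fun f g =>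
    (TensorProduct.map_comp f LinearMap.id g LinearMap.id)
  rw [m1, m2]
  apply LinearMap.ext
  intro t
  have hL := fun p w => LinearMap.congr_fun (hL p) w
  have hR := fun p w => LinearMap.congr_fun (hR p) w
  have hL' := fun p w => LinearMap.congr_fun (hL' p) w
  have hR' := fun p w => LinearMap.congr_fun (hR' p) w
  have hc := fun p q w => LinearMap.congr_fun (hc p q) w
  simp only [LinearMap.comp_apply] at hL hR hL' hR' hc
  change (TensorProduct.assoc k X.V Y.V Z.V).toLinearMap (act₂ (act₂ X.act Y.act) Z.act _ 
    (act₂ (act₂ X.act Y.act) Z.act _ 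
    (act₂ (act₂ X.ract Y.ract) Z.ract _ 
    (act₂ (act₂ X.ract Y.ract) Z.ract _ 
    ((TensorProduct.rightComm k X.V Z.V Y.V).toLinearMap t))))) = _
  rw [hc, hL, hR, hR', hL']
  rfl

/-- `conjR` on `X ⊗ (Y ⊗ Z)` factorizes. -/
theorem conjR_tensor_right (X Y Z : HBimod k H) :
    (TensorProduct.assoc k X.V Y.V Z.V).symm.toLinearMap ∘ₗ
        (conjR X (tensor Y Z)).toLinearMap ∘ₗ
        (TensorProduct.leftComm k Y.V X.V Z.V).toLinearMap =
      TensorProduct.map (conjR X Y).toLinearMap LinearMap.id ∘ₗ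
        (TensorProduct.assoc k X.V Y.V Z.V).symm.toLinearMap ∘ₗ
        (TensorProduct.leftComm k Y.V X.V Z.V).toLinearMap ∘ₗ
        TensorProduct.map LinearMap.id (conjR X Z).toLinearMap := by
  have hL := fun p => act₂_includeLeft_lTensor X.act Y.act Z.act Z.act_one p
  have hR := fun p => act₂_includeLeft_lTensor X.ract Y.ract Z.ract Z.ract_one p
  have hL' := fun p => act₂_includeRight_lTensor X.act Y.act Z.act Y.act_one p
  have hR' := fun p => act₂_includeRight_lTensor X.ract Y.ract Z.ract Y.ract_one p
  have e : (conjR X (tensor Y Z)).toLinearMap =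
      (act₂ X.act (act₂ Y.act Z.act)
        ((Algebra.TensorProduct.includeLeft : H →ₐ[k] H ⊗[k] H).toLinearMap.lTensor H
          (((rMatrix k H)⁻¹ : (H ⊗[k] H)ˣ) : H ⊗[k] H)) ∘ₗ
        act₂ X.act (act₂ Y.act Z.act)
        ((Algebra.TensorProduct.includeRight : H →ₐ[k] H ⊗[k] H).toLinearMap.lTensor H
          (((rMatrix k H)⁻¹ : (H ⊗[k] H)ˣ) : H ⊗[k] H))) ∘ₗ
      (act₂ X.ract (act₂ Y.ract Z.ract)
        ((Algebra.TensorProduct.includeLeft : H →ₐ[k] H ⊗[k] H).toLinearMap.lTensor H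
          (rMatrix k H : H ⊗[k] H)) ∘ₗ
        act₂ X.ract (act₂ Y.ract Z.ract)
        ((Algebra.TensorProduct.includeRight : H →ₐ[k] H ⊗[k] H).toLinearMap.lTensor H
          (rMatrix k H : H ⊗[k] H))) := by
    rw [← act₂_mul X.act_mul (act₂_mul Y.act_mul Z.act_mul),
      ← act₂_mul_rev X.ract_mul (act₂_mul_rev Y.ract_mul Z.ract_mul),
      ← comul_lTensor_R_inv, ← QuasitriangularHopfAlgebra.comul_lTensor_R,
      ← act₂_comp_right, ← act₂_comp_right]
    rfl
  have hc := fun p q => act₂_commute X.act_ract (act₂_commute Y.act_ract Z.act_ract) p q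
  have c1 : (conjR X Y).toLinearMap = act₂ X.act Y.act _ ∘ₗ act₂ X.ract Y.ract _ := rfl
  have c2 : (conjR X Z).toLinearMap = act₂ X.act Z.act _ ∘ₗ act₂ X.ract Z.ract _ := rfl
  rw [e, c1, c2]
  have m1 : ∀ (f g : X.V ⊗[k] Z.V →ₗ[k] X.V ⊗[k] Z.V),
      TensorProduct.map (LinearMap.id : Y.V →ₗ[k] Y.V) (f ∘ₗ g) =
      TensorProduct.map LinearMap.id f ∘ₗ TensorProduct.map LinearMap.id g := fun f g =>
    (TensorProduct.map_comp LinearMap.id f LinearMap.id g)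
  have m2 : ∀ (f g : X.V ⊗[k] Y.V →ₗ[k] X.V ⊗[k] Y.V),
      TensorProduct.map (f ∘ₗ g) (LinearMap.id : Z.V →ₗ[k] Z.V) =
      TensorProduct.map f LinearMap.id ∘ₗ TensorProduct.map g LinearMap.id := fun f g =>
    (TensorProduct.map_comp f LinearMap.id g LinearMap.id)
  rw [m1, m2]
  apply LinearMap.ext
  intro t
  have hL := fun p w => LinearMap.congr_fun (hL p) w
  have hR := fun p w => LinearMap.congr_fun (hR p) w
  have hL' := fun p w => LinearMap.congr_fun (hL' p) w
  have hR' := fun p w => LinearMap.congr_fun (hR' p) w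
  have hc := fun p q w => LinearMap.congr_fun (hc p q) w
  simp only [LinearMap.comp_apply] at hL hR hL' hR' hc
  change (TensorProduct.assoc k X.V Y.V Z.V).symm.toLinearMap (act₂ X.act (act₂ Y.act Z.act) _ 
    (act₂ X.act (act₂ Y.act Z.act) _ 
    (act₂ X.ract (act₂ Y.ract Z.ract) _ 
    (act₂ X.ract (act₂ Y.ract Z.ract) _ 
    ((TensorProduct.leftComm k Y.V X.V Z.V).toLinearMap t))))) = _
  rw [hc, hL, hR, hR', hL']
  rfl

instance : BraidedCategory (HBimod k H) where
  braiding := braid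
  braiding_naturality_right X Y Z f := by
    apply hom_ext
    change ((conjR Z X).toLinearMap ∘ₗ _) ∘ₗ TensorProduct.map LinearMap.id (Hom.lin f) =
      TensorProduct.map (Hom.lin f) (Hom.lin (𝟙 X)) ∘ₗ (conjR Y X).toLinearMap ∘ₗ _
    rw [← LinearMap.comp_assoc, conjR_naturality, LinearMap.comp_assoc, LinearMap.comp_assoc]
    congr 1
    exact TensorProduct.ext' fun _ _ => rfl
  braiding_naturality_left {X Y} f Z := by
    apply hom_ext
    change ((conjR Z Y).toLinearMap ∘ₗ _) ∘ₗ TensorProduct.map (Hom.lin f) LinearMap.id =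
      TensorProduct.map (Hom.lin (𝟙 Z)) (Hom.lin f) ∘ₗ (conjR Z X).toLinearMap ∘ₗ _
    rw [← LinearMap.comp_assoc, conjR_naturality, LinearMap.comp_assoc, LinearMap.comp_assoc]
    congr 1
    exact TensorProduct.ext' fun _ _ => rfl
  hexagon_forward X Y Z := by
    apply hom_ext
    apply TensorProduct.ext_threefold
    intro x y z
    have h := LinearMap.congr_fun (conjR_tensor_left Y Z X) ((y ⊗ₜ x) ⊗ₜ z)
    have h2 : ∀ t : Y.V ⊗[k] X.V,
        (TensorProduct.assoc k Y.V Z.V X.V) (TensorProduct.rightComm k Y.V X.V Z.V (t ⊗ₜ[k] z)) =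
        TensorProduct.map LinearMap.id (TensorProduct.comm k X.V Z.V).toLinearMap
          (TensorProduct.assoc k Y.V X.V Z.V (t ⊗ₜ z)) := by
      intro t
      induction t with
      | zero => simp
      | add p q hp hq => simp only [TensorProduct.add_tmul, map_add, hp, hq]
      | tmul a b => rfl
    refine Eq.trans h ?_
    change TensorProduct.map LinearMap.id (conjR Z X).toLinearMap
      ((TensorProduct.assoc k Y.V Z.V X.V) (TensorProduct.rightComm k Y.V X.V Z.V
        (conjR Y X (y ⊗ₜ[k] x) ⊗ₜ[k] z))) = TensorProduct.map LinearMap.id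
        ((conjR Z X).toLinearMap ∘ₗ (TensorProduct.comm k X.V Z.V).toLinearMap)
        (TensorProduct.assoc k Y.V X.V Z.V (conjR Y X (y ⊗ₜ x) ⊗ₜ z))
    rw [h2, ← LinearMap.comp_apply, ← TensorProduct.map_comp]
    rfl
  hexagon_reverse X Y Z := by
    apply hom_ext
    apply TensorProduct.ext_threefold'
    intro x y z
    have h := LinearMap.congr_fun (conjR_tensor_right Z X Y) (x ⊗ₜ (z ⊗ₜ y))
    have h2 : ∀ t : Z.V ⊗[k] Y.V,
        (TensorProduct.assoc k Z.V X.V Y.V).symm (TensorProduct.leftComm k X.V Z.V Y.V (x ⊗ₜ t)) =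
        TensorProduct.map (TensorProduct.comm k X.V Z.V).toLinearMap LinearMap.id
          ((TensorProduct.assoc k X.V Z.V Y.V).symm (x ⊗ₜ t)) := by
      intro t
      induction t with
      | zero => simp
      | add p q hp hq => simp only [TensorProduct.tmul_add, map_add, hp, hq]
      | tmul a b => rfl
    refine Eq.trans h ?_
    change TensorProduct.map (conjR Z X).toLinearMap LinearMap.id
      ((TensorProduct.assoc k Z.V X.V Y.V).symm (TensorProduct.leftComm k X.V Z.V Y.V
        (x ⊗ₜ conjR Z Y (z ⊗ₜ[k] y)))) = TensorProduct.map
        ((conjR Z X).toLinearMap ∘ₗ (TensorProduct.comm k X.V Z.V).toLinearMap) LinearMap.id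
        ((TensorProduct.assoc k X.V Z.V Y.V).symm (x ⊗ₜ conjR Z Y (z ⊗ₜ y)))
    rw [h2, ← LinearMap.comp_apply, ← TensorProduct.map_comp]
    rfl

theorem braiding_def (X Y : HBimod k H) : β_ X Y = braid X Y := rfl

end Braiding

/-! Duals: `(h · f)(x) = f(S(h) x)` and `(f · h)(x) = f(x S⁻¹(h))`. -/

section Dual

variable [QuasitriangularHopfAlgebra k H] [FiniteDimensional k H]

/-- The left action on the dual, `(h · f)(x) = f(S(h) x)`. -/
def dualAct (X : HBimod k H) : H →ₗ[k] (Module.Dual k X.V →ₗ[k] Module.Dual k X.V) :=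
  Module.Dual.transpose ∘ₗ X.act ∘ₗ HopfAlgebra.antipode k

/-- The right action on the dual, `(f · h)(x) = f(x S⁻¹(h))`. -/
def dualRact (X : HBimod k H) : H →ₗ[k] (Module.Dual k X.V →ₗ[k] Module.Dual k X.V) :=
  Module.Dual.transpose ∘ₗ X.ract ∘ₗ antipodeInv k H

/-- The dual bimodule. -/
@[simps V]
def dual (X : HBimod k H) : HBimod k H where
  V := Module.Dual k X.V
  act := dualAct X
  act_one := by ext f x; simp [dualAct, Module.Dual.transpose_apply, X.act_one]
  act_mul a b := by ext f x; simp [dualAct, Module.Dual.transpose_apply, X.act_mul, HopfAlgebra.antipode_mul_antidistrib]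
  ract := dualRact X
  ract_one := by ext f x; simp [dualRact, Module.Dual.transpose_apply, X.ract_one]
  ract_mul a b := by ext f x; simp [dualRact, Module.Dual.transpose_apply, X.ract_mul, antipodeInv_mul]
  act_ract a b := by
    ext f x
    have := LinearMap.congr_fun (X.act_ract (HopfAlgebra.antipode k a) (antipodeInv k H b)) x
    simp only [LinearMap.comp_apply] at this
    simp [dualAct, dualRact, Module.Dual.transpose_apply, this]

theorem dualAct_apply (X : HBimod k H) (h : H) (f : Module.Dual k X.V) (x : X.V) :
    dualAct X h f x = f (X.act (HopfAlgebra.antipode k h) x) := rfl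

theorem dualRact_apply (X : HBimod k H) (h : H) (f : Module.Dual k X.V) (x : X.V) :
    dualRact X h f x = f (X.ract (antipodeInv k H h) x) := rfl

end Dual

end HBimod

namespace HBimod

variable {k H : Type u} [Field k] [Ring H] [HopfAlgebra k H]

open MonoidalCategory

theorem act_algebraMap (X : HBimod k H) (c : k) : X.act (algebraMap k H c) = c • LinearMap.id := by
  rw [Algebra.algebraMap_eq_smul_one, map_smul, X.act_one]

theorem ract_algebraMap (X : HBimod k H) (c : k) :
    X.ract (algebraMap k H c) = c • LinearMap.id := by
  rw [Algebra.algebraMap_eq_smul_one, map_smul, X.ract_one]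

section Rigid

variable [QuasitriangularHopfAlgebra k H] [FiniteDimensional k H]

/-- `v ⊗ f ↦ (x ↦ f(x) v)` -/
def coevEquiv (V : Type u) [AddCommGroup V] [Module k V] [FiniteDimensional k V] :
    V ⊗[k] Module.Dual k V ≃ₗ[k] (V →ₗ[k] V) :=
  TensorProduct.comm k V (Module.Dual k V) ≪≫ₗ dualTensorHomEquiv k V V

theorem coevEquiv_tmul (V : Type u) [AddCommGroup V] [Module k V] [FiniteDimensional k V]
    (v : V) (f : Module.Dual k V) (x : V) : coevEquiv V (v ⊗ₜ f) x = f x • v := by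
  simp [coevEquiv]

theorem coevEquiv_coevaluation (V : Type u) [AddCommGroup V] [Module k V] [FiniteDimensional k V] :
    coevEquiv V (coevaluation k V 1) = LinearMap.id := by
  rw [coevaluation_apply_one]
  apply LinearMap.ext
  intro x
  simp only [map_sum, LinearMap.sum_apply, coevEquiv_tmul, Module.Basis.coord_apply,
    LinearMap.id_apply]
  exact (Module.Basis.ofVectorSpace k V).sum_repr x

theorem coevEquiv_map (V : Type u) [AddCommGroup V] [Module k V] [FiniteDimensional k V]
    (A B : V →ₗ[k] V) (t : V ⊗[k] Module.Dual k V) :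
    coevEquiv V (TensorProduct.map A (Module.Dual.transpose B) t) = A ∘ₗ coevEquiv V t ∘ₗ B := by
  induction t with
  | zero => simp
  | add p q hp hq => simp only [map_add, LinearMap.comp_add, LinearMap.add_comp, hp, hq]
  | tmul v f => ext x; simp [coevEquiv_tmul, Module.Dual.transpose_apply]

theorem coevEquiv_act (X : HBimod k H) (p : H ⊗[k] H) :
    coevEquiv X.V (act₂ X.act (dualAct X) p (coevaluation k X.V 1)) =
      X.act (LinearMap.mul' k H ((HopfAlgebra.antipode k).lTensor H p)) := by
  induction p with
  | zero => simp
  | add p q hp hq => simp only [map_add, LinearMap.add_apply, hp, hq]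
  | tmul a b =>
    change coevEquiv X.V (TensorProduct.map (X.act a) (Module.Dual.transpose
      (X.act (HopfAlgebra.antipode k b))) _) = _
    rw [coevEquiv_map, coevEquiv_coevaluation, LinearMap.id_comp, ← X.act_mul]
    rfl

theorem coevEquiv_ract (X : HBimod k H) (p : H ⊗[k] H) :
    coevEquiv X.V (act₂ X.ract (dualRact X) p (coevaluation k X.V 1)) =
      X.ract (LinearMap.mul' k H (TensorProduct.comm k H H ((antipodeInv k H).lTensor H p))) := by
  induction p with
  | zero => simp
  | add p q hp hq => simp only [map_add, LinearMap.add_apply, hp, hq]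
  | tmul a b =>
    change coevEquiv X.V (TensorProduct.map (X.ract a) (Module.Dual.transpose
      (X.ract (antipodeInv k H b))) _) = _
    rw [coevEquiv_map, coevEquiv_coevaluation, LinearMap.id_comp, ← X.ract_mul]
    rfl

theorem contract_act (X : HBimod k H) (p : H ⊗[k] H) (f : Module.Dual k X.V) (x : X.V) :
    contractLeft k X.V (act₂ (dualAct X) X.act p (f ⊗ₜ x)) =
      f (X.act (LinearMap.mul' k H ((HopfAlgebra.antipode k).rTensor H p)) x) := by
  induction p with
  | zero => simp
  | add p q hp hq => simp only [map_add, LinearMap.add_apply, hp, hq]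
  | tmul a b =>
    change f (X.act (HopfAlgebra.antipode k a) (X.act b x)) = _
    rw [LinearMap.rTensor_tmul, LinearMap.mul'_apply, X.act_mul]
    rfl

theorem contract_ract (X : HBimod k H) (p : H ⊗[k] H) (f : Module.Dual k X.V) (x : X.V) :
    contractLeft k X.V (act₂ (dualRact X) X.ract p (f ⊗ₜ x)) =
      f (X.ract (LinearMap.mul' k H (TensorProduct.comm k H H
        ((antipodeInv k H).rTensor H p))) x) := by
  induction p with
  | zero => simp
  | add p q hp hq => simp only [map_add, LinearMap.add_apply, hp, hq]
  | tmul a b =>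
    change f (X.ract (antipodeInv k H a) (X.ract b x)) = _
    rw [LinearMap.rTensor_tmul, TensorProduct.comm_tmul, LinearMap.mul'_apply, X.ract_mul]
    rfl

/-- The coevaluation `𝟙 ⟶ X ⊗ X^∨`. -/
def coev (X : HBimod k H) : unit k H ⟶ tensor X (dual X) where
  lin := coevaluation k X.V
  lin_act h := by
    apply LinearMap.ext_ring
    apply (coevEquiv X.V).injective
    refine Eq.trans ?_ (coevEquiv_act X (Coalgebra.comul h)).symm
    rw [HopfAlgebra.mul_antipode_lTensor_comul_apply, act_algebraMap]
    change coevEquiv X.V (coevaluation k X.V (Coalgebra.counit h * 1)) = _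
    rw [← smul_eq_mul, map_smul, map_smul, coevEquiv_coevaluation]
  lin_ract h := by
    apply LinearMap.ext_ring
    apply (coevEquiv X.V).injective
    refine Eq.trans ?_ (coevEquiv_ract X (Coalgebra.comul h)).symm
    rw [antipodeInv_mul_rev, ract_algebraMap]
    change coevEquiv X.V (coevaluation k X.V (Coalgebra.counit h * 1)) = _
    rw [← smul_eq_mul, map_smul, map_smul, coevEquiv_coevaluation]

/-- The evaluation `X^∨ ⊗ X ⟶ 𝟙`. -/
def evl (X : HBimod k H) : tensor (dual X) X ⟶ unit k H where
  lin := contractLeft k X.V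
  lin_act h := by
    apply TensorProduct.ext'
    intro (f : Module.Dual k X.V) x
    refine (contract_act X (Coalgebra.comul h) f x).trans ?_
    rw [HopfAlgebra.mul_antipode_rTensor_comul_apply, act_algebraMap]
    change f (Coalgebra.counit (R := k) h • x) =
      Coalgebra.counit (R := k) h * f x
    exact LinearMap.map_smul f _ _
  lin_ract h := by
    apply TensorProduct.ext'
    intro (f : Module.Dual k X.V) x
    refine (contract_ract X (Coalgebra.comul h) f x).trans ?_
    rw [mul_antipodeInv_rev, ract_algebraMap]
    change f (Coalgebra.counit (R := k) h • x) =
      Coalgebra.counit (R := k) h * f x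
    exact LinearMap.map_smul f _ _

instance (X : HBimod k H) : ExactPairing X (dual X) where
  coevaluation' := coev X
  evaluation' := evl X
  coevaluation_evaluation' := hom_ext (contractLeft_assoc_coevaluation k X.V)
  evaluation_coevaluation' := hom_ext (contractLeft_assoc_coevaluation' k X.V)

instance : RightRigidCategory (HBimod k H) where
  rightDual X := ⟨dual X⟩

theorem rightDual_def (X : HBimod k H) : Xᘁ = dual X := rfl
theorem coevaluation_lin (X : HBimod k H) :
    Hom.lin (η_ X Xᘁ) = coevaluation k X.V := rfl
theorem evaluation_lin (X : HBimod k H) :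
    Hom.lin (ε_ X Xᘁ) = contractLeft k X.V := rfl

end Rigid

end HBimod

/-! ### Ribbon categories and Frobenius algebras in them -/

section Ribbon

open MonoidalCategory

universe v₁ u₁

/-- A ribbon category: a braided category with duals (`𝟙 ⟶ X ⊗ Xᘁ`, `Xᘁ ⊗ X ⟶ 𝟙`) and a twist,
i.e. a natural automorphism of the identity functor that is compatible with the braiding and with
duality. -/
class RibbonCategory (C : Type u₁) [Category.{v₁} C] [MonoidalCategory C] [BraidedCategory C]
    [RightRigidCategory C] where
  /-- The twist. -/
  twist : ∀ X : C, X ≅ X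
  twist_naturality : ∀ {X Y : C} (f : X ⟶ Y), f ≫ (twist Y).hom = (twist X).hom ≫ f
  twist_tensor : ∀ X Y : C, (twist (X ⊗ Y)).hom =
    (β_ X Y).hom ≫ (β_ Y X).hom ≫ ((twist X).hom ⊗ₘ (twist Y).hom)
  twist_dual : ∀ X : C, η_ X Xᘁ ≫ (twist X).hom ▷ Xᘁ = η_ X Xᘁ ≫ X ◁ (twist Xᘁ).hom

/-- A Frobenius algebra in a monoidal category: an algebra and a coalgebra such that the coproduct
is a morphism of bimodules. -/
class FrobeniusObj {C : Type u₁} [Category.{v₁} C] [MonoidalCategory C] (A : C)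
    extends MonObj A, ComonObj A where
  comul_mul_left : comul ▷ A ≫ (α_ A A A).hom ≫ A ◁ mul = mul ≫ comul
  comul_mul_right : A ◁ comul ≫ (α_ A A A).inv ≫ mul ▷ A = mul ≫ comul

variable {C : Type u₁} [Category.{v₁} C] [MonoidalCategory C] [BraidedCategory C]
  [RightRigidCategory C] [RibbonCategory C]

/-- The right coevaluation `𝟙 ⟶ X^∨ ⊗ X` of a ribbon category,
`(id ⊗ θ_X) ∘ c_{X, X^∨} ∘ b_X`. -/
def coevRight (X : C) : 𝟙_ C ⟶ Xᘁ ⊗ X :=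
  η_ X Xᘁ ≫ (β_ X Xᘁ).hom ≫ Xᘁ ◁ (RibbonCategory.twist X).hom

/-- The pairing `ε ∘ m : A ⊗ A ⟶ 𝟙` of a Frobenius algebra. -/
def frobeniusPairing (A : C) [FrobeniusObj A] : A ⊗ A ⟶ 𝟙_ C :=
  (MonObj.mul : A ⊗ A ⟶ A) ≫ (ComonObj.counit : A ⟶ 𝟙_ C)

/-- A Frobenius algebra in a ribbon category is symmetric if the two isomorphisms `A ⟶ A^∨`
obtained from the pairing `ε ∘ m` with the left and with the right coevaluation agree:
`((ε ∘ m) ⊗ id) ∘ (id_A ⊗ b_A) = (id ⊗ (ε ∘ m)) ∘ (b'_A ⊗ id_A)`. -/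
def IsSymmetricFrobenius (A : C) [FrobeniusObj A] : Prop :=
  (ρ_ A).inv ≫ A ◁ η_ A (Aᘁ : C) ≫ (α_ A A (Aᘁ : C)).inv ≫
      frobeniusPairing A ▷ (Aᘁ : C) ≫ (λ_ (Aᘁ : C)).hom =
    (λ_ A).inv ≫ coevRight A ▷ A ≫ (α_ (Aᘁ : C) A A).hom ≫
      (Aᘁ : C) ◁ frobeniusPairing A ≫ (ρ_ (Aᘁ : C)).hom

/-- `A` has trivial twist. -/
def HasTrivialTwist (A : C) : Prop := (RibbonCategory.twist A).hom = 𝟙 A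

end Ribbon

namespace HBimod

variable {k H : Type u} [Field k] [Ring H] [HopfAlgebra k H]

open MonoidalCategory

section Twist

variable [RibbonHopfAlgebra k H]

theorem v_inv_central (h : H) :
    (((ribbonElt k H)⁻¹ : Hˣ) : H) * h = h * (((ribbonElt k H)⁻¹ : Hˣ) : H) :=
  (show Commute ((ribbonElt k H : Hˣ) : H) h from
    RibbonHopfAlgebra.v_central (k := k) h).units_inv_left

/-- The twist `x ↦ v · x · v⁻¹`. -/
def twistIso (X : HBimod k H) : X ≅ X :=
  isoOfEquiv
    (LinearEquiv.ofLinearMap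
      (X.act (ribbonElt k H : H) ∘ₗ X.ract (((ribbonElt k H)⁻¹ : Hˣ) : H))
      (X.ract (ribbonElt k H : H) ∘ₗ X.act (((ribbonElt k H)⁻¹ : Hˣ) : H))
      (by
        rw [LinearMap.comp_assoc, ← LinearMap.comp_assoc _ _ (X.ract _), ← X.ract_mul,
          Units.mul_inv, X.ract_one, LinearMap.id_comp, ← X.act_mul, Units.mul_inv, X.act_one])
      (by
        rw [LinearMap.comp_assoc, ← LinearMap.comp_assoc _ _ (X.act _), ← X.act_mul,
          Units.inv_mul, X.act_one, LinearMap.id_comp, ← X.ract_mul, Units.inv_mul, X.ract_one]))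
    (by
      intro h
      change (X.act _ ∘ₗ X.ract _) ∘ₗ X.act h = X.act h ∘ₗ X.act _ ∘ₗ X.ract _
      rw [LinearMap.comp_assoc, ← X.act_ract, ← LinearMap.comp_assoc, ← LinearMap.comp_assoc,
        ← X.act_mul, ← X.act_mul, RibbonHopfAlgebra.v_central])
    (by
      intro h
      change (X.act _ ∘ₗ X.ract _) ∘ₗ X.ract h = X.ract h ∘ₗ X.act _ ∘ₗ X.ract _
      rw [← LinearMap.comp_assoc _ _ (X.ract h), ← X.act_ract, LinearMap.comp_assoc,
        LinearMap.comp_assoc, ← X.ract_mul, ← X.ract_mul, v_inv_central])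

theorem twistIso_hom_lin (X : HBimod k H) : Hom.lin (twistIso X).hom =
    X.act (ribbonElt k H : H) ∘ₗ X.ract (((ribbonElt k H)⁻¹ : Hˣ) : H) := rfl

theorem comul_v_inv : Coalgebra.comul (R := k) (((ribbonElt k H)⁻¹ : Hˣ) : H) =
    (monodromy k H : H ⊗[k] H) * ((((ribbonElt k H)⁻¹ : Hˣ) : H) ⊗ₜ[k] (((ribbonElt k H)⁻¹ : Hˣ) : H)) := by
  have h := RibbonHopfAlgebra.comul_v (k := k) (H := H)
  have h1 : Coalgebra.comul (R := k) (((ribbonElt k H)⁻¹ : Hˣ) : H) *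
      Coalgebra.comul (R := k) ((ribbonElt k H : Hˣ) : H) = 1 := by
    rw [← Bialgebra.comul_mul, Units.inv_mul, Bialgebra.comul_one]
  have h2 : Coalgebra.comul (R := k) ((ribbonElt k H : Hˣ) : H) *
    ((monodromy k H : H ⊗[k] H) *
      ((((ribbonElt k H)⁻¹ : Hˣ) : H) ⊗ₜ[k] (((ribbonElt k H)⁻¹ : Hˣ) : H))) = 1 := by
    rw [show Coalgebra.comul (R := k) ((ribbonElt k H : Hˣ) : H) = _ from h, ← mul_assoc,
      mul_assoc (_ ⊗ₜ[k] _), Units.inv_mul, mul_one, Algebra.TensorProduct.tmul_mul_tmul]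
    simp [Algebra.TensorProduct.one_def]
  exact left_inv_eq_right_inv h1 h2

theorem antipode_v_inv : HopfAlgebra.antipode k (((ribbonElt k H)⁻¹ : Hˣ) : H) =
    (((ribbonElt k H)⁻¹ : Hˣ) : H) := by
  have h1 : HopfAlgebra.antipode k (((ribbonElt k H)⁻¹ : Hˣ) : H) * (ribbonElt k H : H) = 1 := by
    conv_lhs => rw [← RibbonHopfAlgebra.antipode_v (k := k) (H := H)]
    rw [← HopfAlgebra.antipode_mul_antidistrib]
    simp
  exact left_inv_eq_right_inv h1 (Units.mul_inv _)

/-- The double braiding is `z ↦ Q⁻¹ · z · Q`. -/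
theorem double_braid_lin (X Y : HBimod k H) : Hom.lin ((β_ X Y).hom ≫ (β_ Y X).hom) =
    act₂ X.act Y.act (((monodromy k H)⁻¹ : (H ⊗[k] H)ˣ) : H ⊗[k] H) ∘ₗ
      act₂ X.ract Y.ract (monodromy k H : H ⊗[k] H) := by
  change (((act₂ X.act Y.act _ ∘ₗ act₂ X.ract Y.ract _) ∘ₗ
    (TensorProduct.comm k Y.V X.V).toLinearMap) ∘ₗ
      ((act₂ Y.act X.act _ ∘ₗ act₂ Y.ract X.ract _) ∘ₗ
        (TensorProduct.comm k X.V Y.V).toLinearMap) :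
    X.V ⊗[k] Y.V →ₗ[k] X.V ⊗[k] Y.V) = _
  have hi : (((monodromy k H)⁻¹ : (H ⊗[k] H)ˣ) : H ⊗[k] H) =
      (((rMatrix k H)⁻¹ : (H ⊗[k] H)ˣ) : H ⊗[k] H) *
        TensorProduct.comm k H H (((rMatrix k H)⁻¹ : (H ⊗[k] H)ˣ) : H ⊗[k] H) := by
    rw [monodromy, mul_inv_rev, ← map_inv]; rfl
  have hq : (monodromy k H : H ⊗[k] H) =
      TensorProduct.comm k H H (rMatrix k H : H ⊗[k] H) * (rMatrix k H : H ⊗[k] H) := rfl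
  rw [hi, hq, act₂_mul X.act_mul Y.act_mul, act₂_mul_rev X.ract_mul Y.ract_mul]
  have f1 := fun p w => LinearMap.congr_fun (act₂_flip Y.act X.act p) w
  have f2 := fun p w => LinearMap.congr_fun (act₂_flip Y.ract X.ract p) w
  have hc := fun p q w => LinearMap.congr_fun (act₂_commute X.act_ract Y.act_ract p q) w
  apply LinearMap.ext
  intro t
  simp only [LinearMap.comp_apply] at f1 f2 hc ⊢
  have ht : (TensorProduct.comm k Y.V X.V).toLinearMap
      ((TensorProduct.comm k X.V Y.V).toLinearMap t) = t :=
    (TensorProduct.comm k X.V Y.V).symm_apply_apply t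
  rw [f1, f2, ht, ← hc]

instance [FiniteDimensional k H] : RibbonCategory (HBimod k H) where
  twist := twistIso
  twist_naturality {X Y} f := by
    apply hom_ext
    change (Y.act _ ∘ₗ Y.ract _) ∘ₗ Hom.lin f = Hom.lin f ∘ₗ X.act _ ∘ₗ X.ract _
    rw [LinearMap.comp_assoc, ← f.lin_ract, ← LinearMap.comp_assoc, ← f.lin_act,
      LinearMap.comp_assoc]
  twist_tensor X Y := by
    apply hom_ext
    rw [← Category.assoc, comp_lin, double_braid_lin]
    change act₂ X.act Y.act _ ∘ₗ act₂ X.ract Y.ract _ = TensorProduct.map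
      (X.act _ ∘ₗ X.ract _) (Y.act _ ∘ₗ Y.ract _) ∘ₗ act₂ X.act Y.act _ ∘ₗ act₂ X.ract Y.ract _
    rw [comul_v_inv, show Coalgebra.comul (R := k) ((ribbonElt k H : Hˣ) : H) = _ from
      RibbonHopfAlgebra.comul_v, act₂_mul X.act_mul Y.act_mul, act₂_mul_rev X.ract_mul Y.ract_mul,
      TensorProduct.map_comp]
    change (act₂ X.act Y.act _ ∘ₗ _) ∘ₗ _ = (act₂ X.act Y.act (_ ⊗ₜ _) ∘ₗ
      act₂ X.ract Y.ract (_ ⊗ₜ _)) ∘ₗ _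
    simp only [LinearMap.comp_assoc]
    congr 1
    simp only [← LinearMap.comp_assoc]
    congr 1
    exact act₂_commute X.act_ract Y.act_ract _ _
  twist_dual X := by
    apply hom_ext
    apply LinearMap.ext_ring
    apply (coevEquiv X.V).injective
    have e1 := coevEquiv_map X.V (X.act (ribbonElt k H : H) ∘ₗ
      X.ract (((ribbonElt k H)⁻¹ : Hˣ) : H)) LinearMap.id (coevaluation k X.V 1)
    have e2 := coevEquiv_map X.V LinearMap.id (X.ract (((ribbonElt k H)⁻¹ : Hˣ) : H) ∘ₗ
      X.act (ribbonElt k H : H)) (coevaluation k X.V 1)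
    have hv : antipodeInv k H (((ribbonElt k H)⁻¹ : Hˣ) : H) =
        (((ribbonElt k H)⁻¹ : Hˣ) : H) := by
      conv_lhs => rw [← antipode_v_inv (k := k) (H := H)]
      exact antipodeInv_antipode _
    have hd : Hom.lin (twistIso (dual X)).hom = Module.Dual.transpose
        (X.ract (((ribbonElt k H)⁻¹ : Hˣ) : H) ∘ₗ X.act (ribbonElt k H : H)) := by
      rw [twistIso_hom_lin]
      change Module.Dual.transpose (X.act (HopfAlgebra.antipode k (ribbonElt k H : H))) ∘ₗ
        Module.Dual.transpose (X.ract (antipodeInv k H (((ribbonElt k H)⁻¹ : Hˣ) : H))) = _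
      rw [hv, show HopfAlgebra.antipode k ((ribbonElt k H : Hˣ) : H) = _ from
        RibbonHopfAlgebra.antipode_v]
      rfl
    have e3 := congrArg (fun T : Module.Dual k X.V →ₗ[k] Module.Dual k X.V =>
      coevEquiv X.V (TensorProduct.map LinearMap.id T (coevaluation k X.V 1))) hd
    refine Eq.trans (Eq.trans e1 ?_) (Eq.trans e2.symm e3.symm)
    rw [← X.act_ract, coevEquiv_coevaluation]
    rfl

theorem twist_def [FiniteDimensional k H] (X : HBimod k H) :
    RibbonCategory.twist X = twistIso X := rfl

end Twist

end HBimod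

/-! ### The coregular bimodule -/

section Automorphism

variable {k H : Type u} [Field k] [Ring H] [HopfAlgebra k H]

open Coalgebra HopfAlgebra

/-- A Hopf algebra automorphism commutes with the antipode. -/
theorem map_antipode (ω : H ≃ₐc[k] H) (h : H) : ω (antipode k h) = antipode k (ω h) := by
  -- both sides are convolution inverse to `ω`
  have hω : ∀ x : H, comul (R := k) (ω x) = TensorProduct.map (ω : H →ₗ[k] H) (ω : H →ₗ[k] H)
      (comul x) := fun x => (CoalgHomClass.map_comp_comul_apply ω x).symm
  let f : WithConv (H →ₗ[k] H) := WithConv.toConv ((ω : H →ₗ[k] H) ∘ₗ antipode k)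
  let g : WithConv (H →ₗ[k] H) := WithConv.toConv (antipode k ∘ₗ (ω : H →ₗ[k] H))
  let w : WithConv (H →ₗ[k] H) := WithConv.toConv (ω : H →ₗ[k] H)
  have h1 : f * w = 1 := by
    apply WithConv.ofConv_injective
    apply LinearMap.ext
    intro x
    let 𝓡 := Coalgebra.Repr.arbitrary k x
    change (f * w) x = (1 : WithConv (H →ₗ[k] H)) x
    rw [𝓡.convMul_apply, LinearMap.convOne_apply]
    have e := congrArg ω (sum_antipode_mul_eq_algebraMap_counit 𝓡)
    simpa [map_sum, f, w, Algebra.algebraMap_eq_smul_one] using e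
  have h2 : w * g = 1 := by
    apply WithConv.ofConv_injective
    apply LinearMap.ext
    intro x
    let 𝓡 := Coalgebra.Repr.arbitrary k x
    change (w * g) x = (1 : WithConv (H →ₗ[k] H)) x
    rw [𝓡.convMul_apply, LinearMap.convOne_apply]
    have e := mul_antipode_lTensor_comul_apply (R := k) (ω x)
    rw [hω, ← 𝓡.eq, CoalgHomClass.counit_comp_apply] at e
    simpa [map_sum, g, w] using e
  have := left_inv_eq_right_inv h1 h2
  exact LinearMap.congr_fun (congrArg WithConv.ofConv this) h

theorem map_antipodeInv [QuasitriangularHopfAlgebra k H] [FiniteDimensional k H]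
    (ω : H ≃ₐc[k] H) (h : H) : ω (antipodeInv k H h) = antipodeInv k H (ω h) := by
  apply (antipode_bijective (k := k) (H := H)).1
  rw [← map_antipode, antipode_antipodeInv, antipode_antipodeInv]

/-- A ribbon Hopf algebra automorphism: a Hopf algebra automorphism `ω` with
`(ω ⊗ ω)(R) = R` and `ω(v) = v`. -/
def IsRibbonAut [RibbonHopfAlgebra k H] (ω : H ≃ₐc[k] H) : Prop :=
  TensorProduct.map (ω : H →ₗ[k] H) (ω : H →ₗ[k] H) (rMatrix k H : H ⊗[k] H) =
    (rMatrix k H : H ⊗[k] H) ∧ ω (ribbonElt k H : H) = (ribbonElt k H : H)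

end Automorphism

section Integrals

variable {k H : Type u} [Field k] [Ring H] [HopfAlgebra k H]

open Coalgebra HopfAlgebra

/-- A left integral: `h Λ = ε(h) Λ`. -/
def IsLeftIntegral (k : Type u) {H : Type u} [Field k] [Ring H] [HopfAlgebra k H] (Λ : H) : Prop :=
  ∀ h : H, h * Λ = counit (R := k) h • Λ

/-- A right cointegral: `(lam ⊗ id) ∘ Δ = η ∘ lam`. -/
def IsRightCointegral (lam : Module.Dual k H) : Prop :=
  ∀ h : H, TensorProduct.lid k H (lam.rTensor H (comul h)) = algebraMap k H (lam h)

/-- The Drinfeld map `f_Q : H* → H`, `f ↦ (f ⊗ id)(Q)`. -/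
def drinfeldMap (k H : Type u) [Field k] [Ring H] [HopfAlgebra k H]
    [QuasitriangularHopfAlgebra k H] (f : Module.Dual k H) : H :=
  TensorProduct.lid k H (f.rTensor H (monodromy k H : H ⊗[k] H))

/-- An integral `Λ` and a cointegral `lam`, normalized by `lam(Λ) = 1` and `f_Q(lam) = Λ`. -/
structure IsNormalizedPair [QuasitriangularHopfAlgebra k H] (Λ : H) (lam : Module.Dual k H) :
    Prop where
  isLeftIntegral : IsLeftIntegral k Λ
  isRightCointegral : IsRightCointegral lam
  lam_apply : lam Λ = 1
  drinfeldMap_lam : drinfeldMap k H lam = Λ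

end Integrals

section FrobeniusMaps

variable (k H : Type u) [Field k] [Ring H] [HopfAlgebra k H] [FiniteDimensional k H]

open Coalgebra HopfAlgebra

/-- The identification `H* ⊗ H* ≅ (H ⊗ H)*` by nested evaluation,
`f ⊗ g ↦ (x ⊗ y ↦ f(y) g(x))`; this is the duality of the rigid category of vector spaces, in
which `(X ⊗ Y)^∨ = Y^∨ ⊗ X^∨`. -/
def nestedDual : Module.Dual k H ⊗[k] Module.Dual k H ≃ₗ[k] Module.Dual k (H ⊗[k] H) :=
  TensorProduct.comm k (Module.Dual k H) (Module.Dual k H) ≪≫ₗ TensorProduct.dualDistribEquiv k H H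

/-- `m_F = Δ*`. -/
def mulF : Module.Dual k H ⊗[k] Module.Dual k H →ₗ[k] Module.Dual k H :=
  (comul (R := k) (A := H)).dualMap ∘ₗ (nestedDual k H).toLinearMap

/-- `η_F = ε*`. -/
def oneF : k →ₗ[k] Module.Dual k H :=
  LinearMap.toSpanSingleton k (Module.Dual k H) (counit (R := k) (A := H))

variable {k H} in
/-- `(id ⊗ (lam ∘ m)) ∘ (id ⊗ S ⊗ id) ∘ (Δ ⊗ id) : H ⊗ H → H`. -/
def comulFPredual (lam : Module.Dual k H) : H ⊗[k] H →ₗ[k] H :=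
  (TensorProduct.rid k H).toLinearMap ∘ₗ
    (lam ∘ₗ LinearMap.mul' k H).lTensor H ∘ₗ
    ((antipode k).rTensor H).lTensor H ∘ₗ
    (TensorProduct.assoc k H H H).toLinearMap ∘ₗ
    (comul (R := k) (A := H)).rTensor H

variable {k H} in
/-- `Δ_F = [(id ⊗ (lam ∘ m)) ∘ (id ⊗ S ⊗ id) ∘ (Δ ⊗ id)]*`. -/
def comulF (lam : Module.Dual k H) : Module.Dual k H →ₗ[k] Module.Dual k H ⊗[k] Module.Dual k H :=
  (nestedDual k H).symm.toLinearMap ∘ₗ (comulFPredual lam).dualMap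

variable {k H} in
/-- `ε_F = Λ*`, evaluation at `Λ`. -/
def counitF (Λ : H) : Module.Dual k H →ₗ[k] k := Module.Dual.eval k H Λ

end FrobeniusMaps

namespace HBimod

variable {k H : Type u} [Field k] [Ring H] [HopfAlgebra k H]

open HopfAlgebra MonoidalCategory

section Coregular

variable (k H) [QuasitriangularHopfAlgebra k H] [FiniteDimensional k H]

/-- The coregular bimodule: `H*` with `(h · f)(x) = f(S(h) x)` and `(f · h)(x) = f(x S⁻¹(h))`. -/
@[simps V]
def coregular : HBimod k H where
  V := Module.Dual k H
  act := Module.Dual.transpose ∘ₗ LinearMap.mul k H ∘ₗ antipode k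
  act_one := by ext f x; simp [Module.Dual.transpose_apply]
  act_mul a b := by
    ext f x; simp [Module.Dual.transpose_apply, antipode_mul_antidistrib, mul_assoc]
  ract := Module.Dual.transpose ∘ₗ (LinearMap.mul k H).flip ∘ₗ antipodeInv k H
  ract_one := by ext f x; simp [Module.Dual.transpose_apply]
  ract_mul a b := by
    ext f x; simp [Module.Dual.transpose_apply, antipodeInv_mul, mul_assoc]
  act_ract a b := by
    ext f x; simp [Module.Dual.transpose_apply, mul_assoc]

theorem coregular_act_apply (h : H) (f : Module.Dual k H) :
    (coregular k H).act h f = (f ∘ₗ LinearMap.mulLeft k (antipode k h) : Module.Dual k H) := rfl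

theorem coregular_ract_apply (h : H) (f : Module.Dual k H) :
    (coregular k H).ract h f =
      (f ∘ₗ LinearMap.mulRight k (antipodeInv k H h) : Module.Dual k H) := rfl

end Coregular

/-- The bimodule obtained by twisting the right action by `ω`. -/
@[simps V act ract]
def twistRight (ω : H ≃ₐc[k] H) (X : HBimod k H) : HBimod k H where
  V := X.V
  act := X.act
  act_one := X.act_one
  act_mul := X.act_mul
  ract := X.ract ∘ₗ (ω : H →ₗ[k] H)
  ract_one := by simp [X.ract_one]
  ract_mul a b := by simp [X.ract_mul]
  act_ract a b := X.act_ract _ _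

variable (k H) in
/-- The bimodule `F_ω`. -/
abbrev coregularTwisted [QuasitriangularHopfAlgebra k H] [FiniteDimensional k H]
    (ω : H ≃ₐc[k] H) : HBimod k H := twistRight ω (coregular k H)

/-- The given linear maps are morphisms of bimodules that make `A` a Frobenius algebra in the
monoidal category of bimodules. -/
def IsFrobenius (A : HBimod k H) (m : A.V ⊗[k] A.V →ₗ[k] A.V) (e : k →ₗ[k] A.V)
    (d : A.V →ₗ[k] A.V ⊗[k] A.V) (c : A.V →ₗ[k] k) : Prop :=
  ∃ frob : FrobeniusObj A, Hom.lin frob.mul = m ∧ Hom.lin frob.one = e ∧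
    Hom.lin frob.comul = d ∧ Hom.lin frob.counit = c

/-- The given linear maps are morphisms of bimodules that make `A` a commutative symmetric
Frobenius algebra in the ribbon category of bimodules. -/
def IsCommSymmFrobenius [RibbonHopfAlgebra k H] [FiniteDimensional k H]
    (A : HBimod k H) (m : A.V ⊗[k] A.V →ₗ[k] A.V) (e : k →ₗ[k] A.V)
    (d : A.V →ₗ[k] A.V ⊗[k] A.V) (c : A.V →ₗ[k] k) : Prop :=
  ∃ frob : FrobeniusObj A, (Hom.lin frob.mul = m ∧ Hom.lin frob.one = e ∧
    Hom.lin frob.comul = d ∧ Hom.lin frob.counit = c) ∧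
    IsCommMonObj A ∧ IsSymmetricFrobenius A

end HBimod

/-! ### The coend `∫^U U^∨ ⊠ ω(U)` in the category of bimodules -/

/-- A finite-dimensional left `H`-module. -/
structure HMod (k H : Type u) [Field k] [Ring H] [Algebra k H] where
  /-- The underlying vector space. -/
  V : Type u
  [addCommGroup : AddCommGroup V]
  [module : Module k V]
  [finiteDimensional : FiniteDimensional k V]
  /-- The action. -/
  act : H →ₗ[k] (V →ₗ[k] V)
  act_one : act 1 = LinearMap.id
  act_mul : ∀ a b, act (a * b) = act a ∘ₗ act b

attribute [instance] HMod.addCommGroup HMod.module HMod.finiteDimensional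

namespace HMod

variable {k H : Type u} [Field k] [Ring H]

/-- Morphisms of modules. -/
@[ext]
structure Hom [Algebra k H] (X Y : HMod k H) where
  /-- The underlying linear map. -/
  lin : X.V →ₗ[k] Y.V
  lin_act : ∀ h, lin ∘ₗ X.act h = Y.act h ∘ₗ lin

instance [Algebra k H] : Category (HMod k H) where
  Hom := Hom
  id X := ⟨LinearMap.id, fun _ => rfl⟩
  comp f g := ⟨g.lin ∘ₗ f.lin,
    fun h => by rw [LinearMap.comp_assoc, f.lin_act, ← LinearMap.comp_assoc, g.lin_act]; rfl⟩

variable [HopfAlgebra k H]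

@[ext] theorem hom_ext {X Y : HMod k H} {f g : X ⟶ Y} (h : Hom.lin f = Hom.lin g) : f = g :=
  Hom.ext h

/-- The module `ω(X)`: the action is pulled back along `ω`. -/
def pullbackObj (ω : H ≃ₐc[k] H) (X : HMod k H) : HMod k H where
  V := X.V
  act := X.act ∘ₗ (ω : H →ₗ[k] H)
  act_one := by simp [X.act_one]
  act_mul a b := by simp [X.act_mul]

/-- The autoequivalence `G_ω` of the category of modules given by pull-back along `ω`. -/
def pullback (ω : H ≃ₐc[k] H) : HMod k H ⥤ HMod k H where
  obj := pullbackObj ω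
  map {X Y} f := Hom.mk (X := pullbackObj ω X) (Y := pullbackObj ω Y)
    (Hom.lin (X := X) (Y := Y) f) (fun h => Hom.lin_act (X := X) (Y := Y) f (ω h))
  map_id X := rfl
  map_comp f g := rfl

variable [QuasitriangularHopfAlgebra k H] [FiniteDimensional k H]

/-- The left action on `U* ⊗ W` through `U*`, `h · (f ⊗ w) = f(S(h) -) ⊗ w`. -/
def boxAct (U W : HMod k H) :
    H →ₗ[k] (Module.Dual k U.V ⊗[k] W.V →ₗ[k] Module.Dual k U.V ⊗[k] W.V) :=
  LinearMap.rTensorHom W.V ∘ₗ Module.Dual.transpose ∘ₗ U.act ∘ₗ HopfAlgebra.antipode k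

/-- The right action on `U* ⊗ W` through `W`, `(f ⊗ w) · h = f ⊗ S⁻¹(h) w`. -/
def boxRact (U W : HMod k H) :
    H →ₗ[k] (Module.Dual k U.V ⊗[k] W.V →ₗ[k] Module.Dual k U.V ⊗[k] W.V) :=
  LinearMap.lTensorHom (Module.Dual k U.V) ∘ₗ W.act ∘ₗ antipodeInv k H

theorem boxAct_tmul (U W : HMod k H) (h : H) (f : Module.Dual k U.V) (w : W.V) :
    boxAct U W h (f ⊗ₜ w) = (f ∘ₗ U.act (HopfAlgebra.antipode k h) : Module.Dual k U.V) ⊗ₜ w := rfl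

theorem boxRact_tmul (U W : HMod k H) (h : H) (f : Module.Dual k U.V) (w : W.V) :
    boxRact U W h (f ⊗ₜ w) = f ⊗ₜ W.act (antipodeInv k H h) w := rfl

/-- The bimodule `U^∨ ⊠ W`: the vector space `U* ⊗ W` with left action on `U*`,
`(h · f)(u) = f(S(h) u)`, and right action on `W`, `w · h = S⁻¹(h) w`. -/
@[simps V]
def boxDual (U W : HMod k H) : HBimod k H where
  V := Module.Dual k U.V ⊗[k] W.V
  act := boxAct U W
  act_one := by
    apply TensorProduct.ext'; intro f w
    rw [boxAct_tmul, HopfAlgebra.antipode_one, U.act_one]; rfl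
  act_mul a b := by
    apply TensorProduct.ext'; intro f w
    rw [LinearMap.comp_apply, boxAct_tmul, boxAct_tmul, boxAct_tmul,
      HopfAlgebra.antipode_mul_antidistrib, U.act_mul]; rfl
  ract := boxRact U W
  ract_one := by
    apply TensorProduct.ext'; intro f w
    rw [boxRact_tmul, antipodeInv_one, W.act_one]; rfl
  ract_mul a b := by
    apply TensorProduct.ext'; intro f w
    rw [LinearMap.comp_apply, boxRact_tmul, boxRact_tmul, boxRact_tmul, antipodeInv_mul, W.act_mul]
    rfl
  act_ract a b := by
    apply TensorProduct.ext'; intro f w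
    rfl

/-- Functoriality of `U^∨ ⊠ W`. -/
def boxDualMap {U U' W W' : HMod k H} (φ : U' ⟶ U) (g : W ⟶ W') : boxDual U W ⟶ boxDual U' W' where
  lin := TensorProduct.map (Module.Dual.transpose (Hom.lin φ)) (Hom.lin g)
  lin_act h := by
    apply TensorProduct.ext'; intro f w
    have e := Hom.lin_act φ (HopfAlgebra.antipode k h)
    change ((f ∘ₗ U.act _) ∘ₗ Hom.lin φ) ⊗ₜ[k] Hom.lin g w =
      ((f ∘ₗ Hom.lin φ) ∘ₗ U'.act _) ⊗ₜ[k] Hom.lin g w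
    rw [LinearMap.comp_assoc, LinearMap.comp_assoc, e]
  lin_ract h := by
    apply TensorProduct.ext'; intro f w
    have e := LinearMap.congr_fun (Hom.lin_act g (antipodeInv k H h)) w
    exact congrArg (fun y => (f ∘ₗ Hom.lin φ : Module.Dual k U'.V) ⊗ₜ[k] y) e

variable (k H) in
/-- The functor `(U, W) ↦ U^∨ ⊠ W`. -/
def boxDualFunctor : (HMod k H)ᵒᵖ ⥤ HMod k H ⥤ HBimod k H where
  obj U :=
    { obj := fun W => boxDual U.unop W
      map := fun g => boxDualMap (𝟙 U.unop) g
      map_id := fun W => by apply HBimod.hom_ext; apply TensorProduct.ext'; intro f w; rfl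
      map_comp := fun f g => by apply HBimod.hom_ext; apply TensorProduct.ext'; intro f w; rfl }
  map {U U'} φ :=
    { app := fun W => boxDualMap φ.unop (𝟙 W)
      naturality := fun W W' g => by
        apply HBimod.hom_ext; apply TensorProduct.ext'; intro f w; rfl }
  map_id U := by
    apply NatTrans.ext; funext W
    apply HBimod.hom_ext; apply TensorProduct.ext'; intro f w; rfl
  map_comp φ ψ := by
    apply NatTrans.ext; funext W
    apply HBimod.hom_ext; apply TensorProduct.ext'; intro f w; rfl

variable (k H) in
/-- The functor `(U, W) ↦ U^∨ ⊠ ω(W)`. -/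
def boxDualTwisted (ω : H ≃ₐc[k] H) : (HMod k H)ᵒᵖ ⥤ HMod k H ⥤ HBimod k H :=
  boxDualFunctor k H ⋙ (Functor.whiskeringLeft _ _ _).obj (pullback ω)

/-- The linear map `U* ⊗ U → H*`, `f ⊗ u ↦ (x ↦ f(x u))`. -/
def iotaLin (U : HMod k H) : Module.Dual k U.V ⊗[k] U.V →ₗ[k] Module.Dual k H :=
  TensorProduct.lift ((LinearMap.llcomp k H U.V k).compl₂ U.act.flip)

theorem iotaLin_tmul (U : HMod k H) (f : Module.Dual k U.V) (u : U.V) (x : H) :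
    iotaLin U (f ⊗ₜ u) x = f (U.act x u) := rfl

/-- The dinatural morphism `U^∨ ⊠ U ⟶ F`. -/
def iota (U : HMod k H) : boxDual U U ⟶ HBimod.coregular k H where
  lin := iotaLin U
  lin_act h := by
    apply TensorProduct.ext'; intro f u
    apply LinearMap.ext; intro x
    change f (U.act _ (U.act x u)) = f (U.act (_ * x) u)
    rw [U.act_mul]; rfl
  lin_ract h := by
    apply TensorProduct.ext'; intro f u
    apply LinearMap.ext; intro x
    change f (U.act x (U.act _ u)) = f (U.act (x * _) u)
    rw [U.act_mul]; rfl

/-- The dinatural morphism `U^∨ ⊠ ω(U) ⟶ F_ω`. -/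
def iotaTwisted (ω : H ≃ₐc[k] H) (U : HMod k H) :
    boxDual U (pullbackObj ω U) ⟶ HBimod.coregularTwisted k H ω where
  lin := iotaLin U
  lin_act h := (iota U).lin_act h
  lin_ract h := by
    apply TensorProduct.ext'; intro f u
    apply LinearMap.ext; intro x
    change f (U.act x (U.act (ω (antipodeInv k H h)) u)) = f (U.act (x * antipodeInv k H (ω h)) u)
    rw [U.act_mul, map_antipodeInv]; rfl

theorem iotaLin_dinatural {U U' : HMod k H} (φ : U ⟶ U') (f : Module.Dual k U'.V) (u : U.V) :
    iotaLin U ((f ∘ₗ Hom.lin φ : Module.Dual k U.V) ⊗ₜ u) = iotaLin U' (f ⊗ₜ Hom.lin φ u) := by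
  apply LinearMap.ext; intro x
  exact congrArg f (LinearMap.congr_fun (Hom.lin_act φ x) u)

variable (k H) in
/-- `F` with the family `iota` as a cowedge. -/
def coregularCowedge : Limits.Cowedge (boxDualFunctor k H) :=
  Limits.Cowedge.mk (HBimod.coregular k H) iota (by
    intro U U' φ
    apply HBimod.hom_ext; apply TensorProduct.ext'; intro f u
    exact iotaLin_dinatural φ f u)

variable (k H) in
/-- `F_ω` with the family `iotaTwisted` as a cowedge. -/
def coregularTwistedCowedge (ω : H ≃ₐc[k] H) : Limits.Cowedge (boxDualTwisted k H ω) :=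
  Limits.Cowedge.mk (HBimod.coregularTwisted k H ω) (iotaTwisted ω) (by
    intro U U' φ
    apply HBimod.hom_ext; apply TensorProduct.ext'; intro f u
    exact iotaLin_dinatural φ f u)

end HMod

end FactorizableHopf

end

/-! The coend. For `u` in a module `U`, the map `x ↦ x u` is a morphism from the regular module to
`U`. A dinatural family `U* ⊗ U → Z` is therefore determined by its regular component on the vectors
`f ⊗ 1`, and these vectors recover all of `H*` (`HMod.descLin_comp_iotaLin`,
`HMod.iotaLin_regular_tmul_one`). Dinaturality along right multiplications of `H` makes the induced
map right linear. Nothing changes in the presence of `ω`.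

The Frobenius structure. All axioms are checked on `H` after dualizing. The coproduct `Δ_F` is the
transpose of the product `x • y = ∑ x₁ λ(S(x₂) y)` (`comulFPredual`). For a cointegral `λ` this
product has the second form `∑ λ(S(x) y₁) y₂` (`IsRightCointegral.comulFPredual_tmul`). The first
form gives `Δ(x • y) = ∑ x₁ ⊗ (x₂ • y)`, the second `Δ(x • y) = ∑ (x • y₁) ⊗ y₂`; transposed, these
are the two Frobenius relations, and together they make `•` associative, that is, `Δ_F`
coassociative. The integral is a two-sided unit for `•`, which gives the counit axioms.
Compatibility with the left actions is formal; compatibility of `Δ_F` and `ε_F` with the right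
actions uses that the left integral is also a right integral.

Unimodularity (`IsFactorizable.isRightIntegral`). A left integral satisfies `t h = α(h) t` for a
character `α`. Evaluating `r Δ(t) = Δ^op(t) r` for `r = R` and for `r = R₂₁⁻¹`, and comparing the
results by means of the central element `u S(u)` built from the Drinfeld element `u`, gives `(id ⊗
α)(R) = (id ⊗ α)(R₂₁⁻¹)`. Hence `(id ⊗ α)(Q) = 1 = (id ⊗ ε)(Q)`, and non-degeneracy of `Q` forces `α
= ε`.

The normalized pair. A nonzero cointegral is produced by a trace formula
(`exists_traceCointegral_ne_zero`, `isRightCointegral_traceCointegral`); it is a nondegenerate form,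
and representing `ε` by it gives an integral `t` with `λ(t) = 1`. The element `c = f_Q(λ)` is
central by unimodularity, and `(Δ ⊗ id)(Q) = R₃₂ Q₁₃ R₂₃` then gives `c f_Q(p) = p(1) c`, so `c` is
an integral because `f_Q` is onto. Rescaling by a square root of `λ(c)⁻¹` gives both normalizations
at once.

Braided properties. Commutativity of `m_F` is the transpose of `R Δ R⁻¹ = Δ^op`, using `(S ⊗ S)(R) =
R`. The twist is trivial because `v` is central and fixed by `S`. Symmetry then holds in any ribbon
category (`isSymmetricFrobenius_of_isCommMonObj`). Since `ω` is a coalgebra map, twisting right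
actions by it commutes with tensor products, so all morphisms for `F` remain morphisms for `F_ω`;
the braiding and the twist see `ω` only through `(ω ⊗ ω)(R)` and `ω(v)`. -/

namespace FactorizableHopf

open Coalgebra HopfAlgebra

/-! ### Coassociativity combined with the antipode axioms. -/

section HopfIdentities

variable {k H : Type u} [Field k] [Ring H] [HopfAlgebra k H]

/-- If `β` is a one-sided convolution inverse relation, then `∑ β(x₁ ⊗ x₂) ⊗ x₃ = 1 ⊗ x`. -/
theorem rTensor_assoc_symm_lTensor_comul (β : H ⊗[k] H →ₗ[k] H)
    (hβ : ∀ x : H, β (comul (R := k) x) = algebraMap k H (counit x)) (x : H) :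
    β.rTensor H ((TensorProduct.assoc k H H H).symm
      ((comul (R := k)).lTensor H (comul (R := k) x))) = 1 ⊗ₜ[k] x := by
  rw [← coassoc_apply, LinearEquiv.symm_apply_apply, ← LinearMap.comp_apply,
    ← LinearMap.rTensor_comp, show β ∘ₗ comul = Algebra.linearMap k H ∘ₗ counit from
      LinearMap.ext hβ, LinearMap.rTensor_comp, LinearMap.comp_apply, rTensor_counit_comul]
  simp

/-- If `β` is a one-sided convolution inverse relation, then `∑ x₁ ⊗ β(x₂ ⊗ x₃) = x ⊗ 1`. -/
theorem lTensor_assoc_rTensor_comul (β : H ⊗[k] H →ₗ[k] H)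
    (hβ : ∀ x : H, β (comul (R := k) x) = algebraMap k H (counit x)) (x : H) :
    β.lTensor H (TensorProduct.assoc k H H H
      ((comul (R := k)).rTensor H (comul (R := k) x))) = x ⊗ₜ[k] 1 := by
  rw [coassoc_apply, ← LinearMap.comp_apply,
    ← LinearMap.lTensor_comp, show β ∘ₗ comul = Algebra.linearMap k H ∘ₗ counit from
      LinearMap.ext hβ, LinearMap.lTensor_comp, LinearMap.comp_apply, lTensor_counit_comul]
  simp

/-- `∑ S(x₁) x₂ ⊗ x₃ = 1 ⊗ x` -/
theorem sum_antipode_tmul_one_mul_comul {x : H} {ι : Type*} (𝓡 : Repr k x ι) :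
    ∑ i ∈ 𝓡.index, (antipode k (𝓡.left i) ⊗ₜ[k] (1 : H)) * comul (R := k) (𝓡.right i) =
      1 ⊗ₜ[k] x := by
  rw [← rTensor_assoc_symm_lTensor_comul (LinearMap.mul' k H ∘ₗ (antipode k).rTensor H)
    (fun x => mul_antipode_rTensor_comul_apply x) x, ← 𝓡.eq]
  simp only [map_sum, LinearMap.lTensor_tmul]
  refine Finset.sum_congr rfl fun i _ => ?_
  generalize comul (R := k) (𝓡.right i) = p
  induction p with
  | zero => simp
  | add p q hp hq => simp only [mul_add, TensorProduct.tmul_add, map_add, hp, hq]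
  | tmul a b => simp

/-- `∑ x₁ ⊗ x₂ S(x₃) = x ⊗ 1` -/
theorem sum_comul_mul_one_tmul_antipode {x : H} {ι : Type*} (𝓡 : Repr k x ι) :
    ∑ i ∈ 𝓡.index, comul (R := k) (𝓡.left i) * ((1 : H) ⊗ₜ[k] antipode k (𝓡.right i)) =
      x ⊗ₜ[k] 1 := by
  rw [← lTensor_assoc_rTensor_comul (LinearMap.mul' k H ∘ₗ (antipode k).lTensor H)
    (fun x => mul_antipode_lTensor_comul_apply x) x, ← 𝓡.eq]
  simp only [map_sum, LinearMap.rTensor_tmul]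
  refine Finset.sum_congr rfl fun i _ => ?_
  generalize comul (R := k) (𝓡.left i) = p
  induction p with
  | zero => simp
  | add p q hp hq => simp only [add_mul, TensorProduct.add_tmul, map_add, hp, hq]
  | tmul a b => simp

/-- The antipode reverses the coproduct. -/
theorem comul_antipode (x : H) : comul (R := k) (antipode k x) =
    TensorProduct.comm k H H (TensorProduct.map (antipode k) (antipode k) (comul (R := k) x)) := by
  let G : WithConv (H →ₗ[k] H ⊗[k] H) := WithConv.toConv
    ((TensorProduct.comm k H H).toLinearMap ∘ₗ TensorProduct.map (antipode k) (antipode k) ∘ₗ comul)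
  let D : WithConv (H →ₗ[k] H ⊗[k] H) := WithConv.toConv comul
  have hG : G * D = 1 := by
    apply WithConv.ofConv_injective
    apply LinearMap.ext
    intro x
    change (G * D) x = (1 : WithConv (H →ₗ[k] H ⊗[k] H)) x
    rw [LinearMap.convMul_apply, LinearMap.convOne_apply]
    -- `Φ(a ⊗ b ⊗ c) = (1 ⊗ S(a)) (S(b) ⊗ 1) Δ(c)`. On the two bracketings of the iterated coproduct
    -- it gives `G * Δ` and the convolution unit.
    let Φ : H ⊗[k] (H ⊗[k] H) →ₗ[k] H ⊗[k] H :=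
      LinearMap.mul' k (H ⊗[k] H) ∘ₗ TensorProduct.map
        ((Algebra.TensorProduct.includeRight : H →ₐ[k] H ⊗[k] H).toLinearMap ∘ₗ antipode k)
        (LinearMap.mul' k (H ⊗[k] H) ∘ₗ TensorProduct.map
          ((Algebra.TensorProduct.includeLeft : H →ₐ[k] H ⊗[k] H).toLinearMap ∘ₗ antipode k) comul)
    have e := congrArg Φ (coassoc_apply (R := k) x)
    have e1 : ∀ p : H ⊗[k] H, Φ (TensorProduct.assoc k H H H (comul.rTensor H p)) =
        LinearMap.mul' k (H ⊗[k] H) (TensorProduct.map (WithConv.ofConv G) comul p) := by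
      intro p
      induction p with
      | zero => simp
      | add p q hp hq => simp only [map_add, hp, hq]
      | tmul a b =>
        simp only [LinearMap.rTensor_tmul, TensorProduct.map_tmul, LinearMap.mul'_apply, G,
          LinearMap.comp_apply]
        generalize comul (R := k) a = p
        induction p with
        | zero => simp
        | add p q hp hq => simp only [TensorProduct.add_tmul, map_add, hp, hq, add_mul]
        | tmul c d => simp [Φ, ← mul_assoc]
    have e2 : ∀ a b : H, Φ (comul.lTensor H (a ⊗ₜ b)) = 1 ⊗ₜ (antipode k a * b) := by
      intro a b
      let 𝓡 := Repr.arbitrary k b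
      have h := sum_antipode_tmul_one_mul_comul 𝓡
      rw [LinearMap.lTensor_tmul, ← 𝓡.eq]
      simp only [Φ, LinearMap.comp_apply, TensorProduct.map_tmul, map_sum, LinearMap.mul'_apply,
        AlgHom.toLinearMap_apply, Algebra.TensorProduct.includeLeft_apply,
        Algebra.TensorProduct.includeRight_apply]
      rw [h]; simp
    have e3 : ∀ p : H ⊗[k] H, Φ (comul.lTensor H p) =
        1 ⊗ₜ LinearMap.mul' k H ((antipode k).rTensor H p) := by
      intro p
      induction p with
      | zero => simp
      | add p q hp hq => simp only [map_add, hp, hq, TensorProduct.tmul_add]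
      | tmul a b => rw [e2]; simp
    rw [e1, e3, mul_antipode_rTensor_comul_apply] at e
    refine e.trans ?_
    rw [Algebra.algebraMap_eq_smul_one, Algebra.algebraMap_eq_smul_one, TensorProduct.tmul_smul]
    rfl
  -- In the convolution algebra `Hom(H, H ⊗ H)`, `G` is a left inverse of `Δ` and `Δ ∘ S` a right
  -- inverse, so they agree.
  have h := left_inv_eq_right_inv hG LinearMap.comul_right_inv
  exact (LinearMap.congr_fun (congrArg WithConv.ofConv h) x).symm

end HopfIdentities

/-! ### The same identities for the inverse antipode. -/

section InverseAntipode

variable {k H : Type u} [Field k] [Ring H] [HopfAlgebra k H] [QuasitriangularHopfAlgebra k H]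
  [FiniteDimensional k H]

/-- `∑ x₁ ⊗ S⁻¹(x₃) x₂ = x ⊗ 1` -/
theorem sum_one_tmul_antipodeInv_mul_comul {x : H} {ι : Type*} (𝓡 : Repr k x ι) :
    ∑ i ∈ 𝓡.index, ((1 : H) ⊗ₜ[k] antipodeInv k H (𝓡.right i)) * comul (R := k) (𝓡.left i) =
      x ⊗ₜ[k] 1 := by
  rw [← lTensor_assoc_rTensor_comul (LinearMap.mul' k H ∘ₗ
    (TensorProduct.comm k H H).toLinearMap ∘ₗ (antipodeInv k H).lTensor H)
    (fun x => antipodeInv_mul_rev x) x, ← 𝓡.eq]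
  simp only [map_sum, LinearMap.rTensor_tmul]
  refine Finset.sum_congr rfl fun i _ => ?_
  generalize comul (R := k) (𝓡.left i) = p
  induction p with
  | zero => simp
  | add p q hp hq => simp only [mul_add, TensorProduct.add_tmul, map_add, hp, hq]
  | tmul a b => simp

@[simp] theorem counit_antipodeInv (x : H) :
    counit (R := k) (antipodeInv k H x) = counit (R := k) x := by
  rw [← counit_antipode, antipode_antipodeInv]

theorem comul_antipodeInv (x : H) : comul (R := k) (antipodeInv k H x) =
    TensorProduct.comm k H H
      (TensorProduct.map (antipodeInv k H) (antipodeInv k H) (comul (R := k) x)) := by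
  have h := comul_antipode (k := k) (antipodeInv k H x)
  rw [antipode_antipodeInv] at h
  rw [h]
  generalize comul (R := k) (antipodeInv k H x) = p
  induction p with
  | zero => simp
  | add p q hp hq => simp only [map_add, ← hp, ← hq]
  | tmul a b => simp

end InverseAntipode

end FactorizableHopf

namespace FactorizableHopf

open Coalgebra HopfAlgebra

/-! ### Contracting one leg of a tensor with a linear form. -/

section Slices

variable {k H : Type u} [Field k] [Ring H] [HopfAlgebra k H]

/-- Contraction of the first tensor factor with a linear form. -/
noncomputable def sliceL (φ : Module.Dual k H) : H ⊗[k] H →ₗ[k] H :=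
  (TensorProduct.lid k H).toLinearMap ∘ₗ φ.rTensor H

/-- Contraction of the second tensor factor with a linear form. -/
noncomputable def sliceR (φ : Module.Dual k H) : H ⊗[k] H →ₗ[k] H :=
  (TensorProduct.rid k H).toLinearMap ∘ₗ φ.lTensor H

@[simp] theorem sliceL_tmul (φ : Module.Dual k H) (x y : H) :
    sliceL φ (x ⊗ₜ y) = φ x • y := by simp [sliceL]

@[simp] theorem sliceR_tmul (φ : Module.Dual k H) (x y : H) :
    sliceR φ (x ⊗ₜ y) = φ y • x := by simp [sliceR]

theorem sliceL_one_tmul_mul (φ : Module.Dual k H) (y : H) (p : H ⊗[k] H) :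
    sliceL φ ((1 ⊗ₜ y) * p) = y * sliceL φ p := by
  induction p with
  | zero => simp
  | add p q hp hq => simp only [mul_add, map_add, hp, hq]
  | tmul a b => simp

theorem sliceL_mul_one_tmul (φ : Module.Dual k H) (y : H) (p : H ⊗[k] H) :
    sliceL φ (p * (1 ⊗ₜ y)) = sliceL φ p * y := by
  induction p with
  | zero => simp
  | add p q hp hq => simp only [add_mul, map_add, hp, hq]
  | tmul a b => simp

theorem sliceR_mul_tmul_one (φ : Module.Dual k H) (y : H) (p : H ⊗[k] H) :
    sliceR φ (p * (y ⊗ₜ 1)) = sliceR φ p * y := by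
  induction p with
  | zero => simp
  | add p q hp hq => simp only [add_mul, map_add, hp, hq]
  | tmul a b => simp

theorem sliceL_tmul_one_mul (φ : Module.Dual k H) (x : H) (p : H ⊗[k] H) :
    sliceL φ ((x ⊗ₜ 1) * p) = sliceL (φ ∘ₗ LinearMap.mulLeft k x) p := by
  induction p with
  | zero => simp
  | add p q hp hq => simp only [mul_add, map_add, hp, hq]
  | tmul a b => simp

/-- Both sides are the value of `φ ⊗ ψ` on `p`. This exchange of legs is how identities between
slices are tested against arbitrary linear forms. -/
theorem apply_sliceR (φ ψ : Module.Dual k H) (p : H ⊗[k] H) :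
    φ (sliceR ψ p) = ψ (sliceL φ p) := by
  induction p with
  | zero => simp
  | add p q hp hq => simp only [map_add, hp, hq]
  | tmul a b => simp [mul_comm]

theorem sliceR_rTensor (φ : Module.Dual k H) (f : H →ₗ[k] H) (p : H ⊗[k] H) :
    sliceR φ (f.rTensor H p) = f (sliceR φ p) := by
  induction p with
  | zero => simp
  | add p q hp hq => simp only [map_add, hp, hq]
  | tmul a b => simp

/-- Coassociativity: the operator `x ↦ ∑ x₁ φ(x₂)` touches only the last leg of the coproduct, so it
is colinear for the first one. -/
theorem comul_sliceR_comul (φ : Module.Dual k H) (x : H) :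
    comul (R := k) (sliceR φ (comul (R := k) x)) =
      (sliceR φ ∘ₗ comul).lTensor H (comul (R := k) x) := by
  rw [LinearMap.lTensor_comp, LinearMap.comp_apply, ← coassoc_apply]
  generalize comul (R := k) x = p
  induction p with
  | zero => simp
  | add p q hp hq => simp only [map_add, hp, hq]
  | tmul a b =>
    simp only [sliceR_tmul, map_smul, LinearMap.rTensor_tmul]
    generalize comul (R := k) a = p
    induction p with
    | zero => simp
    | add p q hp hq => simp only [map_add, hp, hq, smul_add, TensorProduct.add_tmul]
    | tmul c d => simp

theorem comul_sliceL_comul (φ : Module.Dual k H) (x : H) :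
    comul (R := k) (sliceL φ (comul (R := k) x)) =
      (sliceL φ ∘ₗ comul).rTensor H (comul (R := k) x) := by
  rw [LinearMap.rTensor_comp, LinearMap.comp_apply, ← coassoc_symm_apply]
  generalize comul (R := k) x = p
  induction p with
  | zero => simp
  | add p q hp hq => simp only [map_add, hp, hq]
  | tmul a b =>
    simp only [sliceL_tmul, map_smul, LinearMap.lTensor_tmul]
    generalize comul (R := k) b = p
    induction p with
    | zero => simp
    | add p q hp hq => simp only [map_add, hp, hq, smul_add, TensorProduct.tmul_add]
    | tmul c d => simp [TensorProduct.smul_tmul']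

theorem sum_left_smul_counit {x : H} {ι : Type*} (𝓡 : Repr k x ι) :
    ∑ i ∈ 𝓡.index, counit (R := k) (𝓡.right i) • 𝓡.left i = x := by
  simpa only [map_sum, TensorProduct.rid_tmul, one_smul] using
    congrArg (TensorProduct.rid k H) (sum_tmul_counit_eq 𝓡)

/-- If `γ(x₁ ⊗ x₂) = c ε(x)`, then `∑ γ(x₁ ⊗ x₂) x₃ = c x`. -/
theorem sum_sliceL_comul {γ : H →ₗ[k] H →ₗ[k] k} {c : k}
    (hγ : ∀ x : H, TensorProduct.lift γ (comul (R := k) x) = c * counit (R := k) x)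
    {x : H} {ι : Type*} (𝓡 : Repr k x ι) :
    ∑ i ∈ 𝓡.index, sliceL (γ (𝓡.left i)) (comul (R := k) (𝓡.right i)) = c • x := by
  let Φ : H ⊗[k] (H ⊗[k] H) →ₗ[k] H := (TensorProduct.lid k H).toLinearMap ∘ₗ
    (TensorProduct.lift γ).rTensor H ∘ₗ (TensorProduct.assoc k H H H).symm.toLinearMap
  have e := congrArg Φ (coassoc_apply (R := k) x)
  have e1 : ∀ p : H ⊗[k] H, Φ (TensorProduct.assoc k H H H (comul.rTensor H p)) =
      c • TensorProduct.lid k H (counit.rTensor H p) := by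
    intro p
    induction p with
    | zero => simp
    | add p q hp hq => simp only [map_add, hp, hq, smul_add]
    | tmul a b => simp [Φ, hγ, mul_smul]
  have e2 : ∀ a b : H, Φ (comul.lTensor H (a ⊗ₜ b)) = sliceL (γ a) (comul (R := k) b) := by
    intro a b
    rw [LinearMap.lTensor_tmul]
    generalize comul (R := k) b = p
    induction p with
    | zero => simp
    | add p q hp hq => simp only [map_add, hp, hq, TensorProduct.tmul_add]
    | tmul c d => simp [Φ]
  rw [e1, rTensor_counit_comul] at e
  simp only [TensorProduct.lid_tmul, one_smul] at e
  rw [e, ← 𝓡.eq]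
  simp only [map_sum, e2]

theorem drinfeldMap_eq_sliceL [QuasitriangularHopfAlgebra k H] (φ : Module.Dual k H) :
    drinfeldMap k H φ = sliceL φ (monodromy k H : H ⊗[k] H) := rfl

theorem IsRightCointegral.sliceL_comul {lam : Module.Dual k H} (h : IsRightCointegral lam)
    (x : H) : sliceL lam (comul (R := k) x) = lam x • 1 := by
  rw [← Algebra.algebraMap_eq_smul_one]; exact h x

end Slices

/-! ### Integrals, cointegrals and the product on `H` dual to `Δ_F`. -/

section Integrals

variable {k H : Type u} [Field k] [Ring H] [HopfAlgebra k H]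

/-- A right integral: `Λ h = ε(h) Λ`. -/
def IsRightIntegral (k : Type u) {H : Type u} [Field k] [Ring H] [HopfAlgebra k H] (t : H) : Prop :=
  ∀ h : H, t * h = counit (R := k) h • t

/-- Write `1 ⊗ x = ∑ (S(x₁) ⊗ 1) Δ(x₂)` and use `Δ(x₂) Δ(t) = Δ(x₂ t) = ε(x₂) Δ(t)`. -/
theorem IsLeftIntegral.one_tmul_mul_comul {t : H} (ht : IsLeftIntegral k t) (x : H) :
    (1 ⊗ₜ x) * comul (R := k) t = (antipode k x ⊗ₜ 1) * comul (R := k) t := by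
  let 𝓡 := Repr.arbitrary k x
  rw [← sum_antipode_tmul_one_mul_comul 𝓡, Finset.sum_mul]
  conv_rhs => rw [← sum_left_smul_counit 𝓡]
  simp only [mul_assoc, ← Bialgebra.comul_mul, ht _, map_sum, map_smul, TensorProduct.sum_tmul,
    Finset.sum_mul, mul_smul_comm, ← TensorProduct.smul_tmul', smul_mul_assoc]

/-- The mirror argument: `x ⊗ 1 = ∑ Δ(x₁) (1 ⊗ S(x₂))`, and the integral absorbs `x₁`. -/
theorem IsRightIntegral.comul_mul_tmul_one {t : H} (ht : IsRightIntegral k t) (x : H) :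
    comul (R := k) t * (x ⊗ₜ 1) = comul (R := k) t * (1 ⊗ₜ antipode k x) := by
  let 𝓡 := Repr.arbitrary k x
  rw [← sum_comul_mul_one_tmul_antipode 𝓡, Finset.mul_sum]
  conv_rhs => rw [← sum_counit_smul 𝓡]
  simp only [← mul_assoc, ← Bialgebra.comul_mul, ht _, map_sum, map_smul, TensorProduct.tmul_sum,
    Finset.mul_sum, mul_smul_comm, TensorProduct.tmul_smul, smul_mul_assoc]

theorem comulFPredual_tmul (lam : Module.Dual k H) (x y : H) : comulFPredual lam (x ⊗ₜ y) =
    sliceR (lam ∘ₗ LinearMap.mulRight k y ∘ₗ antipode k) (comul (R := k) x) := by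
  simp only [comulFPredual, LinearMap.comp_apply, LinearMap.rTensor_tmul]
  generalize comul (R := k) x = p
  induction p with
  | zero => simp
  | add p q hp hq => simp only [map_add, hp, hq, TensorProduct.add_tmul]
  | tmul a b => simp

/-- In `∑ x₁ λ(S(x₂) y)` the second leg of `x` is contracted, so the coproduct only splits the
first. Transposed, this is one of the two Frobenius relations. -/
theorem comul_comulFPredual_left (lam : Module.Dual k H) (x y : H) :
    comul (R := k) (comulFPredual lam (x ⊗ₜ y)) =
      (comulFPredual lam ∘ₗ (TensorProduct.mk k H H).flip y).lTensor H (comul (R := k) x) := by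
  rw [comulFPredual_tmul, comul_sliceR_comul]
  congr 2
  ext z
  simp [comulFPredual_tmul]

/-- The integral moves `S(x)` from the first leg of `Δ(t)` to `x` on the second, and the cointegral
turns what is left into `λ(t) = 1`. Thus `∑ λ(S(x) t₁) t₂ = x`: the legs of `Δ(t)` are dual bases
for the form defined by `λ`. -/
theorem sliceL_antipode_tmul_one_mul_comul_integral {t : H} {lam : Module.Dual k H} (ht : IsLeftIntegral k t)
    (hl : IsRightCointegral lam) (hlt : lam t = 1) (x : H) :
    sliceL lam ((antipode k x ⊗ₜ 1) * comul (R := k) t) = x := by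
  rw [← ht.one_tmul_mul_comul, sliceL_one_tmul_mul, hl.sliceL_comul, hlt, one_smul, mul_one]

/-- Apply `f` to the dual basis identity `∑ λ(S(x) t₁) t₂ = x`. -/
theorem sliceR_comul_integral_leftInverse {t : H} {lam : Module.Dual k H} (ht : IsLeftIntegral k t)
    (hl : IsRightCointegral lam) (hlt : lam t = 1) (f : Module.Dual k H) :
    lam ∘ₗ LinearMap.mulRight k (sliceR f (comul (R := k) t)) ∘ₗ antipode k = f := by
  ext x
  simp only [LinearMap.comp_apply, LinearMap.mulRight_apply]
  have := apply_sliceR (lam ∘ₗ LinearMap.mulLeft k (antipode k x)) f (comul (R := k) t)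
  rw [← sliceL_tmul_one_mul, sliceL_antipode_tmul_one_mul_comul_integral ht hl hlt] at this
  exact this

/-- The maps `f ↦ ∑ t₁ f(t₂)` and `y ↦ λ(S(·) y)` compose to the identity of `H*`. As `H` and `H*`
have the same finite dimension, they also compose to the identity of `H`, which says that `t` is a
left unit for the predual product. -/
theorem comulFPredual_integral_tmul [FiniteDimensional k H] {t : H} {lam : Module.Dual k H} (ht : IsLeftIntegral k t)
    (hl : IsRightCointegral lam) (hlt : lam t = 1) (y : H) : comulFPredual lam (t ⊗ₜ y) = y := by
  let θ : H →ₗ[k] Module.Dual k H :=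
    { toFun := fun y => lam ∘ₗ LinearMap.mulRight k y ∘ₗ antipode k
      map_add' := fun a b => by ext; simp [mul_add]
      map_smul' := fun c a => by ext; simp }
  let ψ : Module.Dual k H →ₗ[k] H :=
    { toFun := fun f => sliceR f (comul (R := k) t)
      map_add' := fun a b => by simp [sliceR, LinearMap.lTensor_add]
      map_smul' := fun c a => by simp [sliceR, LinearMap.lTensor_smul] }
  have h1 : θ ∘ₗ ψ = LinearMap.id :=
    LinearMap.ext fun f => sliceR_comul_integral_leftInverse ht hl hlt f
  have hinj : Function.Injective ψ := LinearMap.injective_of_comp_eq_id _ _ h1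
  have hsurj : Function.Surjective ψ :=
    (LinearMap.injective_iff_surjective_of_finrank_eq_finrank
      (Subspace.dual_finrank_eq (K := k) (V := H))).mp hinj
  rw [comulFPredual_tmul]
  obtain ⟨f, hf⟩ := hsurj y
  have h2 : θ y = f := by rw [← hf]; exact LinearMap.congr_fun h1 f
  change ψ (θ y) = y
  rw [h2, hf]

/-- Every element is a slice of the coproduct of the integral. -/
theorem exists_sliceR_comul_integral [FiniteDimensional k H] {t : H} {lam : Module.Dual k H} (ht : IsLeftIntegral k t)
    (hl : IsRightCointegral lam) (hlt : lam t = 1) (y : H) :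
    ∃ f : Module.Dual k H, sliceR f (comul (R := k) t) = y :=
  ⟨_, (comulFPredual_tmul lam t y).symm.trans (comulFPredual_integral_tmul ht hl hlt y)⟩

/-- Left integrals are unique up to scalars. -/
theorem IsLeftIntegral.eq_smul [FiniteDimensional k H] {t : H} {lam : Module.Dual k H} (ht : IsLeftIntegral k t)
    (hl : IsRightCointegral lam) (hlt : lam t = 1) {s : H} (hs : IsLeftIntegral k s) : s = lam s • t := by
  have h := comulFPredual_integral_tmul ht hl hlt s
  -- For an integral `s` the form `x ↦ λ(S(x) s)` is `λ(s) ε`, so the unit identity `t • s = s`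
  -- collapses to `λ(s) t = s`.
  rw [comulFPredual_tmul, show lam ∘ₗ LinearMap.mulRight k s ∘ₗ antipode k =
    lam s • counit (R := k) (A := H) by ext x; simp [hs _, mul_comm]] at h
  let 𝓡 := Repr.arbitrary k t
  have e := sum_left_smul_counit 𝓡
  rw [← 𝓡.eq] at h
  simp only [map_sum, sliceR_tmul, LinearMap.smul_apply, smul_eq_mul, mul_smul,
    ← Finset.smul_sum, e] at h
  exact h.symm

/-- Invariance of the cointegral of a unimodular Hopf algebra under the adjoint action. -/
theorem sum_cointegral_antipode_mul [FiniteDimensional k H] {t : H} {lam : Module.Dual k H} (ht : IsLeftIntegral k t)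
    (hl : IsRightCointegral lam) (hlt : lam t = 1) (hr : IsRightIntegral k t) (z h : H) :
    TensorProduct.lift (((LinearMap.mul k H ∘ₗ LinearMap.mulRight k z ∘ₗ antipode k)).compr₂ lam)
      (comul (R := k) h) = lam z * counit (R := k) h := by
  obtain ⟨f, rfl⟩ := exists_sliceR_comul_integral ht hl hlt z
  let 𝓡 := Repr.arbitrary k h
  -- With `z = ∑ t₁ f(t₂)`, unimodularity moves `b` to `S(b)` on the second leg and the dual basis
  -- identity evaluates the first. The claim then reduces to `f(∑ h₁ S(h₂)) = ε(h) f(1)`, where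
  -- `f(1) = λ(z)`.
  have e : ∀ a b : H, lam (antipode k a * sliceR f (comul (R := k) t) * b) =
      f (a * antipode k b) := by
    intro a b
    have h1 := apply_sliceR (lam ∘ₗ LinearMap.mulLeft k (antipode k a)) f
      (comul (R := k) t * (b ⊗ₜ 1))
    rw [← sliceL_tmul_one_mul, hr.comul_mul_tmul_one, ← mul_assoc, sliceL_mul_one_tmul,
      sliceL_antipode_tmul_one_mul_comul_integral ht hl hlt, ← hr.comul_mul_tmul_one,
      sliceR_mul_tmul_one] at h1
    rw [← h1, mul_assoc]; rfl
  rw [apply_sliceR, hl.sliceL_comul, hlt, ← 𝓡.eq]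
  simp only [map_sum, TensorProduct.lift.tmul, LinearMap.compr₂_apply, LinearMap.comp_apply,
    LinearMap.mul_apply', LinearMap.mulRight_apply, e]
  rw [← map_sum, sum_mul_antipode_eq_smul 𝓡, map_smul, smul_eq_mul, one_smul, mul_comm]

/-- For `p = z ⊗ w` the sum is `∑ λ(S(h₁) z h₂) w h₃`, and adjoint invariance of `λ` removes the
first two legs of `h`. It serves both the right linearity of the predual product and the centrality
of `f_Q(λ)`. -/
theorem sum_sliceL_antipode_mul_mul_comul [FiniteDimensional k H] {t : H} {lam : Module.Dual k H} (ht : IsLeftIntegral k t)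
    (hl : IsRightCointegral lam) (hlt : lam t = 1) (hr : IsRightIntegral k t) (p : H ⊗[k] H) {h : H}
    {ι : Type*} (𝓡 : Repr k h ι) :
    ∑ i ∈ 𝓡.index, sliceL lam ((antipode k (𝓡.left i) ⊗ₜ 1) * p * comul (R := k) (𝓡.right i)) =
      sliceL lam p * h := by
  induction p with
  | zero => simp
  | add p q hp hq => simp only [mul_add, add_mul, map_add, Finset.sum_add_distrib, hp, hq]
  | tmul z w =>
    have e := congrArg (w * ·) (sum_sliceL_comul
      (sum_cointegral_antipode_mul ht hl hlt hr z) 𝓡)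
    simp only [Finset.mul_sum, mul_smul_comm] at e
    rw [sliceL_tmul, smul_mul_assoc, ← e]
    refine Finset.sum_congr rfl fun i _ => ?_
    generalize comul (R := k) (𝓡.right i) = q
    induction q with
    | zero => simp
    | add p q hp hq => simp only [mul_add, map_add, hp, hq]
    | tmul c d => simp

section
variable [QuasitriangularHopfAlgebra k H] [FiniteDimensional k H]

/-- This is the identity `∑ x₁ ⊗ S⁻¹(x₃) x₂ = x ⊗ 1` at `S(x)`, whose coproduct is `∑ S(x₂) ⊗
S(x₁)`. -/
theorem sum_one_tmul_mul_comul_antipode {x : H} {ι : Type*} (𝓡 : Repr k x ι) :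
    ∑ i ∈ 𝓡.index, ((1 : H) ⊗ₜ[k] 𝓡.left i) * comul (R := k) (antipode k (𝓡.right i)) =
      antipode k x ⊗ₜ[k] 1 := by
  have h := sum_one_tmul_antipodeInv_mul_comul (k := k) (x := antipode k x)
    ⟨𝓡.index, fun i => antipode k (𝓡.right i), fun i => antipode k (𝓡.left i), by
      rw [comul_antipode, ← 𝓡.eq]; simp⟩
  simpa using h

/-- The cointegral property expands `x₁ λ(S(x₂) y)` to `x₁ · (λ ⊗ id)(Δ(S(x₂)) Δ(y))`, and `∑ (1 ⊗
x₁) Δ(S(x₂)) = S(x) ⊗ 1`. This second form of the product, `∑ λ(S(x) y₁) y₂`, makes the dependence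
on `y` transparent. -/
theorem IsRightCointegral.comulFPredual_tmul {lam : Module.Dual k H} (hl : IsRightCointegral lam)
    (x y : H) : comulFPredual lam (x ⊗ₜ y) =
      sliceL lam ((antipode k x ⊗ₜ 1) * comul (R := k) y) := by
  let 𝓡 := Repr.arbitrary k x
  rw [FactorizableHopf.comulFPredual_tmul, ← sum_one_tmul_mul_comul_antipode 𝓡, ← 𝓡.eq]
  simp only [Finset.sum_mul, map_sum, mul_assoc, ← Bialgebra.comul_mul, sliceL_one_tmul_mul,
    hl.sliceL_comul]
  simp

/-- Read off the second form, where only the first leg of `y` is contracted. Transposed, this is the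
other Frobenius relation. -/
theorem IsRightCointegral.comul_comulFPredual_right {lam : Module.Dual k H}
    (hl : IsRightCointegral lam) (x y : H) :
    comul (R := k) (comulFPredual lam (x ⊗ₜ y)) =
      (comulFPredual lam ∘ₗ TensorProduct.mk k H H x).rTensor H (comul (R := k) y) := by
  rw [hl.comulFPredual_tmul, sliceL_tmul_one_mul, comul_sliceL_comul]
  congr 2
  ext z
  simp [hl.comulFPredual_tmul, sliceL_tmul_one_mul]

/-- Writing the outer product in its first form and using colinearity of the inner one in `y`, both
sides become `x • ∑ y₁ λ(S(y₂) z)`. -/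
theorem IsRightCointegral.comulFPredual_assoc {lam : Module.Dual k H}
    (hl : IsRightCointegral lam) (x y z : H) :
    comulFPredual lam (comulFPredual lam (x ⊗ₜ y) ⊗ₜ z) =
      comulFPredual lam (x ⊗ₜ comulFPredual lam (y ⊗ₜ z)) := by
  rw [FactorizableHopf.comulFPredual_tmul lam (comulFPredual lam (x ⊗ₜ y)) z,
    hl.comul_comulFPredual_right, sliceR_rTensor, ← FactorizableHopf.comulFPredual_tmul]
  rfl

/-- In the second form the factor `h` produces `(S(x) S(h₁) ⊗ 1) Δ(h₂) Δ(y)`, and `∑ (S(h₁) ⊗ 1)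
Δ(h₂) = 1 ⊗ h`. No unimodularity is involved. -/
theorem IsRightCointegral.comulFPredual_comul_mul {lam : Module.Dual k H}
    (hl : IsRightCointegral lam) (h : H) (p : H ⊗[k] H) :
    comulFPredual lam (comul (R := k) h * p) = h * comulFPredual lam p := by
  induction p with
  | zero => simp
  | add p q hp hq => simp only [mul_add, map_add, hp, hq]
  | tmul x y =>
    let 𝓡 := Repr.arbitrary k h
    rw [hl.comulFPredual_tmul, ← sliceL_one_tmul_mul, ← mul_assoc,
      show ((1 : H) ⊗ₜ[k] h) * (antipode k x ⊗ₜ[k] (1 : H)) =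
        (antipode k x ⊗ₜ[k] (1 : H)) * ((1 : H) ⊗ₜ[k] h) by simp,
      ← sum_antipode_tmul_one_mul_comul 𝓡, ← 𝓡.eq]
    simp only [Finset.sum_mul, Finset.mul_sum, map_sum, Algebra.TensorProduct.tmul_mul_tmul,
      hl.comulFPredual_tmul, antipode_mul_antidistrib, Bialgebra.comul_mul]
    refine Finset.sum_congr rfl fun i _ => ?_
    simp only [← mul_assoc, Algebra.TensorProduct.tmul_mul_tmul, mul_one]

theorem comulFPredual_tmul_integral {t : H} {lam : Module.Dual k H} (ht : IsLeftIntegral k t)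
    (hl : IsRightCointegral lam) (hlt : lam t = 1) (x : H) : comulFPredual lam (x ⊗ₜ t) = x := by
  rw [hl.comulFPredual_tmul, sliceL_antipode_tmul_one_mul_comul_integral ht hl hlt]

/-- In the second form the factor `h` enters as `(S(h₁) ⊗ 1) (…) Δ(h₂)`, so this is adjoint
invariance of `λ`. Here, in contrast to left linearity, `t` must be a two-sided integral. -/
theorem comulFPredual_mul_comul {t : H} {lam : Module.Dual k H} (ht : IsLeftIntegral k t)
    (hl : IsRightCointegral lam) (hlt : lam t = 1) (hr : IsRightIntegral k t) (h : H) (p : H ⊗[k] H) :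
    comulFPredual lam (p * comul (R := k) h) = comulFPredual lam p * h := by
  induction p with
  | zero => simp
  | add p q hp hq => simp only [add_mul, map_add, hp, hq]
  | tmul x y =>
    let 𝓡 := Repr.arbitrary k h
    rw [hl.comulFPredual_tmul, ← sum_sliceL_antipode_mul_mul_comul ht hl hlt hr _ 𝓡, ← 𝓡.eq]
    simp only [Finset.mul_sum, map_sum, Algebra.TensorProduct.tmul_mul_tmul,
      hl.comulFPredual_tmul, antipode_mul_antidistrib, Bialgebra.comul_mul]
    refine Finset.sum_congr rfl fun i _ => ?_
    simp only [← mul_assoc, Algebra.TensorProduct.tmul_mul_tmul, mul_one]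

end

end Integrals

end FactorizableHopf

namespace FactorizableHopf

open Coalgebra HopfAlgebra

/-! ### Existence of integrals and cointegrals by a trace formula. -/

section Existence

variable {k H : Type u} [Field k] [Ring H] [HopfAlgebra k H]

/-- Coassociativity: contractions of the first and of the last leg commute. -/
theorem sliceR_comul_sliceL_comul (φ ψ : Module.Dual k H) (x : H) :
    sliceR φ (comul (R := k) (sliceL ψ (comul (R := k) x))) =
      sliceL ψ (comul (R := k) (sliceR φ (comul (R := k) x))) := by
  rw [comul_sliceL_comul, sliceR_rTensor]; rfl

theorem sliceR_one_tmul_mul (φ : Module.Dual k H) (x : H) (p : H ⊗[k] H) :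
    sliceR φ ((1 ⊗ₜ x) * p) = sliceR (φ ∘ₗ LinearMap.mulLeft k x) p := by
  induction p with
  | zero => simp
  | add p q hp hq => simp only [mul_add, map_add, hp, hq]
  | tmul a b => simp

theorem sliceR_tmul_one_mul (φ : Module.Dual k H) (x : H) (p : H ⊗[k] H) :
    sliceR φ ((x ⊗ₜ 1) * p) = x * sliceR φ p := by
  induction p with
  | zero => simp
  | add p q hp hq => simp only [mul_add, map_add, hp, hq]
  | tmul a b => simp

/-- The operators `h ↦ S²(h) y`. -/
noncomputable def antipodeSqMulRight (k : Type u) {H : Type u} [Field k] [Ring H] [HopfAlgebra k H] :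
    H →ₗ[k] H →ₗ[k] H :=
  (LinearMap.mul k H).flip.compl₂ (antipode k ∘ₗ antipode k)

@[simp] theorem antipodeSqMulRight_apply (y h : H) :
    antipodeSqMulRight k y h = antipode k (antipode k h) * y := rfl

/-- The cointegral `y ↦ tr(h ↦ (φ ⊗ id)(Δ(S²(h) y)))`. -/
noncomputable def traceCointegral (φ : Module.Dual k H) : Module.Dual k H :=
  LinearMap.trace k H ∘ₗ (LinearMap.llcomp k H H H (sliceL φ ∘ₗ comul)) ∘ₗ antipodeSqMulRight k

theorem traceCointegral_apply (φ : Module.Dual k H) (y : H) : traceCointegral φ y =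
    LinearMap.trace k H ((sliceL φ ∘ₗ comul) ∘ₗ antipodeSqMulRight k y) := rfl

/-- A partial trace: trace out the second factor, then sum the diagonal entries over a basis of the
first. -/
theorem trace_tensor_eq_sum {ι : Type*} [Fintype ι] [DecidableEq ι] (b : Module.Basis ι k H)
    (T : H ⊗[k] H →ₗ[k] H ⊗[k] H) : LinearMap.trace k _ T =
      ∑ j, LinearMap.trace k H (sliceL (b.coord j) ∘ₗ T ∘ₗ TensorProduct.mk k H H (b j)) := by
  have e : ∀ (p : H ⊗[k] H) (j i : ι), (b.tensorProduct b).repr p (j, i) =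
      b.repr (sliceL (b.coord j) p) i := by
    intro p j i
    induction p with
    | zero => simp
    | add p q hp hq => simp only [map_add, Finsupp.add_apply, hp, hq]
    | tmul x y => simp [mul_comm]
  rw [LinearMap.trace_eq_matrix_trace k (b.tensorProduct b)]
  simp only [LinearMap.trace_eq_matrix_trace k b, Matrix.trace, Matrix.diag_apply,
    LinearMap.toMatrix_apply, Fintype.sum_prod_type, Module.Basis.tensorProduct_apply, e,
    LinearMap.comp_apply, TensorProduct.mk_apply]

/-- Summing over the dual basis inserts one leg of the coproduct in place of `b j`; the left side
becomes `∑ x₁ f(S(x₂) x₃)`. -/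
theorem sum_sliceR_comul_sliceR_comul (f : Module.Dual k H) (x : H) {ι : Type*} [Fintype ι]
    (b : Module.Basis ι k H) :
    ∑ j, sliceR (b.coord j) (comul (R := k) (sliceR (f ∘ₗ LinearMap.mulLeft k (antipode k (b j)))
      (comul (R := k) x))) = f 1 • x := by
  let 𝓡 := Repr.arbitrary k x
  have hΔ := 𝓡.eq
  have e2 : ∀ x : H, ∑ j, b.coord j x • b j = x := fun x => b.sum_repr x
  have e3 : ∀ (p : H ⊗[k] H) (z : H), ∑ j, f (antipode k (b j) * z) • sliceR (b.coord j) p =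
      sliceR (f ∘ₗ LinearMap.mulRight k z ∘ₗ antipode k) p := by
    intro p z
    induction p with
    | zero => simp
    | add p q hp hq => simp only [map_add, smul_add, Finset.sum_add_distrib, hp, hq]
    | tmul c d =>
      conv_rhs => rw [sliceR_tmul, LinearMap.comp_apply, LinearMap.comp_apply, ← e2 d]
      simp only [map_sum, map_smul, sliceR_tmul, Finset.sum_smul, smul_smul, smul_eq_mul,
        LinearMap.mulRight_apply]
      exact Finset.sum_congr rfl fun j _ => by rw [mul_comm]
  have e4 := congrArg (sliceR f) (lTensor_assoc_rTensor_comul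
    (LinearMap.mul' k H ∘ₗ (antipode k).rTensor H)
    (fun x => mul_antipode_rTensor_comul_apply x) x)
  rw [sliceR_tmul] at e4
  rw [← e4, ← hΔ]
  simp only [map_sum, sliceR_tmul, map_smul, LinearMap.comp_apply, LinearMap.mulLeft_apply,
    LinearMap.rTensor_tmul]
  rw [Finset.sum_comm]
  refine Finset.sum_congr rfl fun i _ => ?_
  rw [e3]
  generalize comul (R := k) (𝓡.left i) = p
  induction p with
  | zero => simp
  | add p q hp hq => simp only [map_add, hp, hq, TensorProduct.add_tmul]
  | tmul c d => simp

variable [FiniteDimensional k H]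

/-- Let `M(a ⊗ b) = S²(b) S(a)`. By the partial trace, `tr(Δ ∘ M)` is a sum of values of the forms
`traceCointegral φ`. By cyclicity it equals `tr(M ∘ Δ)`, and `M(Δ(h)) = S(∑ h₁ S(h₂)) = ε(h) 1` has
trace `ε(1) = 1`. Hence the forms cannot all vanish. -/
theorem exists_traceCointegral_ne_zero : ∃ φ : Module.Dual k H, traceCointegral φ ≠ 0 := by
  by_contra! h0
  let b := Module.finBasis k H
  let M : H ⊗[k] H →ₗ[k] H := LinearMap.mul' k H ∘ₗ (TensorProduct.comm k H H).toLinearMap ∘ₗ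
    TensorProduct.map (antipode k) (antipode k ∘ₗ antipode k)
  have h1 : LinearMap.trace k _ (comul (R := k) ∘ₗ M) = 0 := by
    rw [trace_tensor_eq_sum b]
    refine Finset.sum_eq_zero fun j _ => ?_
    have := LinearMap.congr_fun (h0 (b.coord j)) (antipode k (b j))
    rw [traceCointegral_apply] at this
    refine Eq.trans (congrArg _ ?_) this
    ext h
    simp [M]
  have h2 : M ∘ₗ comul = LinearMap.smulRight (counit (R := k)) (1 : H) := by
    ext h
    let 𝓡 := Repr.arbitrary k h
    have e := congrArg (antipode k) (sum_mul_antipode_eq_smul 𝓡)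
    rw [LinearMap.comp_apply, ← 𝓡.eq]
    simpa [M, map_sum, antipode_mul_antidistrib] using e
  have h3 : LinearMap.trace k H (LinearMap.smulRight (counit (R := k)) (1 : H)) = 1 := by
    simp
  rw [← LinearMap.trace_comp_comm', h2, h3] at h1
  exact one_ne_zero h1

variable [QuasitriangularHopfAlgebra k H]

/-- Substitute `S²(h) ⊗ 1 = ∑ (1 ⊗ S(h₂)) Δ(S²(h₁))` and expand `h₂` in the basis. The result writes
the operator `h ↦ S²(h) · ∑ y₁ f(y₂)` as a sum of composites of slice operators with `h ↦ S²(h) y`,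
the shape to which cyclicity of the trace applies. -/
theorem mul_sliceR_comul (f : Module.Dual k H) (h y : H) {ι : Type*} [Fintype ι]
    (b : Module.Basis ι k H) :
    antipode k (antipode k h) * sliceR f (comul (R := k) y) =
      ∑ j, sliceR (f ∘ₗ LinearMap.mulLeft k (antipode k (b j))) (comul (R := k)
        (antipode k (antipode k (sliceR (b.coord j) (comul (R := k) h))) * y)) := by
  let 𝓡 := Repr.arbitrary k h
  have e := sum_one_tmul_mul_comul_antipode (k := k) (x := antipode k h)
    ⟨𝓡.index, fun i => antipode k (𝓡.right i), fun i => antipode k (𝓡.left i), by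
      rw [comul_antipode, ← 𝓡.eq]; simp⟩
  dsimp only at e
  have e2 : ∀ x : H, ∑ j, b.coord j x • b j = x := fun x => b.sum_repr x
  rw [← sliceR_tmul_one_mul, ← e, ← 𝓡.eq]
  simp only [Finset.sum_mul, map_sum, mul_assoc, ← Bialgebra.comul_mul, sliceR_tmul, map_smul,
    smul_mul_assoc]
  rw [Finset.sum_comm]
  refine Finset.sum_congr rfl fun i _ => ?_
  conv_lhs => rw [← e2 (𝓡.right i)]
  simp only [map_sum, map_smul, sliceR_one_tmul_mul, TensorProduct.tmul_sum, Finset.sum_mul,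
    TensorProduct.tmul_smul, smul_mul_assoc]

/-- Tested against `f`, the claim concerns traces of composites of slice operators. Cyclicity brings
the two right slices together, since right slices commute with the left slice by `φ`, and their sum
over the basis is the scalar `f(1)`. -/
theorem isRightCointegral_traceCointegral (φ : Module.Dual k H) :
    IsRightCointegral (traceCointegral φ) := by
  intro y
  change sliceL _ _ = _
  rw [Algebra.algebraMap_eq_smul_one, ← sub_eq_zero, ← Module.forall_dual_apply_eq_zero_iff k]
  intro f
  rw [map_sub, sub_eq_zero, ← apply_sliceR, traceCointegral_apply, map_smul, traceCointegral_apply]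
  let b := Module.finBasis k H
  let A : Module.Dual k H → H →ₗ[k] H := fun f => sliceR f ∘ₗ comul
  let B : H →ₗ[k] H := sliceL φ ∘ₗ comul
  let C := antipodeSqMulRight k y
  let f' := fun j => f ∘ₗ LinearMap.mulLeft k (antipode k (b j))
  have h1 : antipodeSqMulRight k (sliceR f (comul (R := k) y)) =
      ∑ j, A (f' j) ∘ₗ C ∘ₗ A (b.coord j) := by
    ext h
    simpa [A, C, f', LinearMap.sum_apply] using mul_sliceR_comul f h y b
  have h2 : ∑ j, A (b.coord j) ∘ₗ A (f' j) = f 1 • LinearMap.id := by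
    ext x
    simpa [A, f', LinearMap.sum_apply] using sum_sliceR_comul_sliceR_comul f x b
  have h3 : ∀ g, A g ∘ₗ B = B ∘ₗ A g := fun g => LinearMap.ext (sliceR_comul_sliceL_comul g φ)
  have h4 : ∀ j, LinearMap.trace k H (B ∘ₗ A (f' j) ∘ₗ C ∘ₗ A (b.coord j)) =
      LinearMap.trace k H (B ∘ₗ (A (b.coord j) ∘ₗ A (f' j)) ∘ₗ C) := by
    intro j
    rw [← LinearMap.comp_assoc, ← LinearMap.comp_assoc, LinearMap.trace_comp_comm',
      ← LinearMap.comp_assoc, ← LinearMap.comp_assoc, h3]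
    simp only [LinearMap.comp_assoc]
  calc LinearMap.trace k H (B ∘ₗ antipodeSqMulRight k (sliceR f (comul (R := k) y)))
      = ∑ j, LinearMap.trace k H (B ∘ₗ A (f' j) ∘ₗ C ∘ₗ A (b.coord j)) := by
        rw [h1]
        simp only [← Module.End.mul_eq_comp, Finset.mul_sum, map_sum]
    _ = LinearMap.trace k H (B ∘ₗ (∑ j, A (b.coord j) ∘ₗ A (f' j)) ∘ₗ C) := by
        simp only [h4]
        simp only [← Module.End.mul_eq_comp, Finset.sum_mul, Finset.mul_sum, map_sum]
    _ = LinearMap.trace k H (B ∘ₗ C) • f 1 := by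
        rw [h2, LinearMap.smul_comp, LinearMap.comp_smul, map_smul, LinearMap.id_comp,
          smul_eq_mul, smul_eq_mul, mul_comm]

/-- A nonzero cointegral is a nondegenerate form. -/
theorem IsRightCointegral.eq_zero_of_forall_mul {lam : Module.Dual k H}
    (hl : IsRightCointegral lam) (h0 : lam ≠ 0) {y : H} (hy : ∀ x, lam (x * y) = 0) : y = 0 := by
  -- Expanding `x ⊗ 1 = ∑ (1 ⊗ S⁻¹(x₂)) Δ(x₁)` and using the cointegral property leaves only factors
  -- `λ(x₁ z)`. So slices `∑ z₁ f(z₂)` of a null vector `z` are again null vectors.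
  have h1 : ∀ x z : H, (∀ x, lam (x * z) = 0) →
      sliceL lam ((x ⊗ₜ 1) * comul (R := k) z) = 0 := by
    intro x z hz
    rw [← sum_one_tmul_antipodeInv_mul_comul (Repr.arbitrary k x)]
    simp only [Finset.sum_mul, map_sum, mul_assoc, ← Bialgebra.comul_mul, sliceL_one_tmul_mul,
      hl.sliceL_comul, hz]
    simp
  let b := Module.finBasis k H
  have e2 : ∀ x : H, ∑ j, b.coord j x • b j = x := fun x => b.sum_repr x
  have h2 : ∀ (x : H) (p : H ⊗[k] H), lam (x * LinearMap.mul' k H (TensorProduct.comm k H H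
      ((antipodeInv k H).lTensor H p))) =
      ∑ j, b.coord j (antipodeInv k H (sliceL lam (((x * b j) ⊗ₜ 1) * p))) := by
    intro x p
    induction p with
    | zero => simp
    | add p q hp hq => simp only [map_add, mul_add, Finset.sum_add_distrib, hp, hq]
    | tmul c d =>
      rw [LinearMap.lTensor_tmul, TensorProduct.comm_tmul, LinearMap.mul'_apply]
      conv_lhs => rw [← e2 (antipodeInv k H d)]
      simp only [Finset.sum_mul, Finset.mul_sum, map_sum, smul_mul_assoc, mul_smul_comm, map_smul,
        Algebra.TensorProduct.tmul_mul_tmul, one_mul, sliceL_tmul, smul_eq_mul, mul_assoc]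
      exact Finset.sum_congr rfl fun j _ => mul_comm _ _
  -- Since `∑ S⁻¹(z₂) z₁ = ε(z)`, the number `λ(x) ε(z)` is a sum of terms that vanish for a null
  -- vector. Applied below to the slices of `y`, this gives `f(y) = 0` for every `f`.
  have h3 : ∀ z : H, (∀ x, lam (x * z) = 0) → counit (R := k) z = 0 := by
    intro z hz
    obtain ⟨x, hx⟩ : ∃ x, lam x ≠ 0 := by
      by_contra! h
      exact h0 (LinearMap.ext h)
    have := h2 x (comul (R := k) z)
    rw [antipodeInv_mul_rev] at this
    simp only [h1 _ z hz, map_zero, Finset.sum_const_zero, Algebra.algebraMap_eq_smul_one,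
      mul_smul_comm, mul_one, map_smul, smul_eq_mul] at this
    exact (mul_eq_zero.mp this).resolve_right hx
  rw [← Module.forall_dual_apply_eq_zero_iff k]
  intro f
  have h4 := h3 (sliceR f (comul (R := k) y)) (fun x => by
    have := apply_sliceR (lam ∘ₗ LinearMap.mulLeft k x) f (comul (R := k) y)
    rw [← sliceL_tmul_one_mul, h1 x y hy, map_zero] at this
    exact this)
  let 𝓡 := Repr.arbitrary k y
  have e := sum_counit_smul 𝓡
  rw [apply_sliceR, ← 𝓡.eq] at h4
  simpa only [map_sum, sliceL_tmul, e] using h4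

variable (k H) in
/-- A finite-dimensional Hopf algebra has a left integral and a right cointegral that pair
to `1`. -/
theorem exists_integral_cointegral : ∃ (t : H) (lam : Module.Dual k H),
    IsLeftIntegral k t ∧ IsRightCointegral lam ∧ lam t = 1 := by
  obtain ⟨φ, h0⟩ := exists_traceCointegral_ne_zero (k := k) (H := H)
  have hl := isRightCointegral_traceCointegral φ
  set lam := traceCointegral φ
  have hinj : Function.Injective ((LinearMap.mul k H).flip.compr₂ lam) := by
    rw [injective_iff_map_eq_zero]
    intro y hy
    exact hl.eq_zero_of_forall_mul h0 fun x => LinearMap.congr_fun hy x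
  have hsurj := (LinearMap.injective_iff_surjective_of_finrank_eq_finrank
      (Subspace.dual_finrank_eq (K := k) (V := H)).symm).mp hinj
  -- The integral is the element representing `ε` through the nondegenerate form `λ`; nondegeneracy
  -- then yields `h t = ε(h) t`.
  obtain ⟨t, ht⟩ := hsurj (counit (R := k))
  have ht' : ∀ x, lam (x * t) = counit (R := k) x := fun x => LinearMap.congr_fun ht x
  refine ⟨t, lam, fun h => ?_, hl, by simpa using ht' 1⟩
  rw [← sub_eq_zero]
  refine hl.eq_zero_of_forall_mul h0 fun x => ?_
  rw [mul_sub, map_sub, ← mul_assoc, ht', mul_smul_comm, map_smul, ht', Bialgebra.counit_mul,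
    smul_eq_mul, mul_comm, sub_self]

end Existence

end FactorizableHopf

namespace FactorizableHopf

open Coalgebra HopfAlgebra

/-! ### The Drinfeld element and unimodularity. -/

section Unimodular

variable {k H : Type u} [Field k] [Ring H] [HopfAlgebra k H]

theorem sliceR_mul (α : H →ₐ[k] k) (p q : H ⊗[k] H) :
    sliceR α.toLinearMap (p * q) = sliceR α.toLinearMap p * sliceR α.toLinearMap q := by
  induction p with
  | zero => simp
  | add p q hp hq => simp only [add_mul, map_add, hp, hq]
  | tmul a b =>
    induction q with
    | zero => simp
    | add p q hp hq => simp only [mul_add, map_add, hp, hq]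
    | tmul c d => simp [smul_smul, mul_comm]

theorem sliceR_one (α : H →ₐ[k] k) : sliceR α.toLinearMap (1 : H ⊗[k] H) = 1 := by
  rw [Algebra.TensorProduct.one_def, sliceR_tmul]; simp

/-- The integral moves every second leg of `r` to the first one through the antipode. -/
theorem IsLeftIntegral.tmul_mul_comul {t : H} (ht : IsLeftIntegral k t) (r : H ⊗[k] H) :
    r * comul (R := k) t =
      (LinearMap.mul' k H ((antipode k).lTensor H r) ⊗ₜ 1) * comul (R := k) t := by
  induction r with
  | zero => simp
  | add p q hp hq => simp only [add_mul, map_add, TensorProduct.add_tmul, hp, hq]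
  | tmul a b =>
    rw [show a ⊗ₜ[k] b = (a ⊗ₜ[k] (1 : H)) * ((1 : H) ⊗ₜ[k] b) by simp, mul_assoc,
      ht.one_tmul_mul_comul, ← mul_assoc]
    simp

/-- Right multiplication of the coproduct of an element on which `H` acts from the right through
the character `α`. -/
theorem comul_mul_tmul_one_of_character {t : H} {α : H →ₐ[k] k} (hα : ∀ h, t * h = α h • t)
    (x : H) {ι : Type*} (𝓡 : Repr k x ι) : comul (R := k) t * (x ⊗ₜ 1) =
      comul (R := k) t * (1 ⊗ₜ antipode k (∑ i ∈ 𝓡.index, α (𝓡.left i) • 𝓡.right i)) := by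
  rw [← sum_comul_mul_one_tmul_antipode 𝓡, Finset.mul_sum]
  simp only [← mul_assoc, ← Bialgebra.comul_mul, hα, map_sum, map_smul, TensorProduct.tmul_sum,
    Finset.mul_sum, mul_smul_comm, TensorProduct.tmul_smul, smul_mul_assoc]

/-- For an R-matrix `r`, `∑ α(b₁) S(b₂) a = (∑ S(b) a) (∑ α(b) a)`, where `r = ∑ a ⊗ b`. -/
theorem comul_mul_comm_of_character {t : H} {α : H →ₐ[k] k} (hα : ∀ h, t * h = α h • t)
    {r : H ⊗[k] H} (hr : (comul (R := k) (A := H)).lTensor H r =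
      (Algebra.TensorProduct.includeRight : H →ₐ[k] H ⊗[k] H).toLinearMap.lTensor H r *
      (Algebra.TensorProduct.includeLeft : H →ₐ[k] H ⊗[k] H).toLinearMap.lTensor H r) :
    comul (R := k) t * TensorProduct.comm k H H r = comul (R := k) t * (1 ⊗ₜ
      ((LinearMap.mul' k H ∘ₗ (TensorProduct.comm k H H).toLinearMap ∘ₗ (antipode k).lTensor H) r *
        sliceR α.toLinearMap r)) := by
  let Φ : H ⊗[k] (H ⊗[k] H) →ₗ[k] H :=
    LinearMap.mul' k H ∘ₗ (TensorProduct.comm k H H).toLinearMap ∘ₗ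
      (antipode k ∘ₗ sliceL α.toLinearMap).lTensor H
  have e1 : ∀ p : H ⊗[k] H, comul (R := k) t * TensorProduct.comm k H H p =
      comul (R := k) t * (1 ⊗ₜ Φ ((comul (R := k)).lTensor H p)) := by
    intro p
    induction p with
    | zero => simp
    | add p q hp hq => simp only [mul_add, map_add, TensorProduct.tmul_add, hp, hq]
    | tmul a b =>
      let 𝓡 := Repr.arbitrary k b
      have hΔ := 𝓡.eq
      have e := comul_mul_tmul_one_of_character hα b 𝓡
      rw [TensorProduct.comm_tmul, show b ⊗ₜ[k] a = (b ⊗ₜ[k] (1 : H)) * ((1 : H) ⊗ₜ[k] a) by simp,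
        ← mul_assoc, e, mul_assoc]
      simp [Φ, ← hΔ]
  have e2 : ∀ p q : H ⊗[k] H, Φ
      ((Algebra.TensorProduct.includeRight : H →ₐ[k] H ⊗[k] H).toLinearMap.lTensor H p *
      (Algebra.TensorProduct.includeLeft : H →ₐ[k] H ⊗[k] H).toLinearMap.lTensor H q) =
      (LinearMap.mul' k H ∘ₗ (TensorProduct.comm k H H).toLinearMap ∘ₗ (antipode k).lTensor H) p *
        sliceR α.toLinearMap q := by
    intro p q
    induction p with
    | zero => simp
    | add p p' hp hq => simp only [map_add, add_mul, hp, hq]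
    | tmul a b =>
      induction q with
      | zero => simp
      | add p p' hp hq => simp only [map_add, mul_add, hp, hq]
      | tmul c d => simp [Φ, mul_assoc]
  rw [e1, hr, e2]

/-- Both sides are `r Δ(t) = Δ^op(t) r`. On the left, `t` being a left integral collects `r` into
one leg; on the right, the character `α` does so, at the price of the factor `(id ⊗ α)(r)`. Only the
intertwining and one hexagon identity of `r` enter, so the result applies to `R` and to `R₂₁⁻¹`. -/
theorem mul_tmul_one_of_rMatrix {t : H} (ht : IsLeftIntegral k t) {α : H →ₐ[k] k}
    (hα : ∀ h, t * h = α h • t) {r : H ⊗[k] H}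
    (h1 : r * comul (R := k) t = TensorProduct.comm k H H (comul (R := k) t) * r)
    (hr : (comul (R := k) (A := H)).lTensor H r =
      (Algebra.TensorProduct.includeRight : H →ₐ[k] H ⊗[k] H).toLinearMap.lTensor H r *
      (Algebra.TensorProduct.includeLeft : H →ₐ[k] H ⊗[k] H).toLinearMap.lTensor H r) :
    (LinearMap.mul' k H ((antipode k).lTensor H r) ⊗ₜ 1) * comul (R := k) t =
      flipAlg k H (comul (R := k) t) *
      (((LinearMap.mul' k H ∘ₗ (TensorProduct.comm k H H).toLinearMap ∘ₗ (antipode k).lTensor H) r *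
        sliceR α.toLinearMap r) ⊗ₜ 1) := by
  have e := congrArg (flipAlg k H) (comul_mul_comm_of_character hα hr)
  rw [map_mul, map_mul] at e
  rw [← ht.tmul_mul_comul, h1]
  refine Eq.trans ?_ (e.trans ?_)
  · congr 1
    exact ((TensorProduct.comm k H H).symm_apply_apply r).symm
  · congr 1

variable [QuasitriangularHopfAlgebra k H]

variable (k H) in
/-- The Drinfeld element `u = ∑ S(b) a`, where `R = ∑ a ⊗ b`. -/
noncomputable def drinfeldElt : H := (LinearMap.mul' k H ∘ₗ
  (TensorProduct.comm k H H).toLinearMap ∘ₗ (antipode k).lTensor H) (rMatrix k H : H ⊗[k] H)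

variable (k H) in
/-- The inverse `∑ b S²(a)` of the Drinfeld element. -/
noncomputable def drinfeldEltInv : H := (LinearMap.mul' k H ∘ₗ
  (TensorProduct.comm k H H).toLinearMap ∘ₗ (antipode k ∘ₗ antipode k).rTensor H)
    (rMatrix k H : H ⊗[k] H)

theorem map_antipode_antipode_rMatrix :
    TensorProduct.map (antipode k) (antipode k) (rMatrix k H : H ⊗[k] H) = rMatrix k H := by
  have h := antipode_lTensor_R_inv (k := k) (H := H)
  rw [← antipode_rTensor_R] at h
  conv_rhs => rw [← h]
  rw [← LinearMap.comp_apply, LinearMap.lTensor_comp_rTensor]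

theorem antipode_sq_mul_drinfeldElt (h : H) :
    antipode k (antipode k h) * drinfeldElt k H = drinfeldElt k H * h :=
  antipode_sq_mul_drinfeld h

/-- Moving `b` past `u` as `S²(b)` turns `u ∑ b S²(a)` into the image of `R · (S² ⊗ S)(R)` under `x
⊗ y ↦ S(y) x`, and `(S² ⊗ S)(R) = R⁻¹`. -/
theorem drinfeldElt_mul_inv : drinfeldElt k H * drinfeldEltInv k H = 1 := by
  have hW : ∀ p : H ⊗[k] H, drinfeldElt k H * (LinearMap.mul' k H ∘ₗ
      (TensorProduct.comm k H H).toLinearMap ∘ₗ (antipode k ∘ₗ antipode k).rTensor H) p =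
      (LinearMap.mul' k H ∘ₗ (TensorProduct.comm k H H).toLinearMap ∘ₗ (antipode k).lTensor H)
        ((rMatrix k H : H ⊗[k] H) *
        TensorProduct.map (antipode k ∘ₗ antipode k) (antipode k) p) := by
    intro p
    induction p with
    | zero => simp
    | add p q hp hq => simp only [map_add, mul_add, hp, hq]
    | tmul a b =>
      have e : (LinearMap.mul' k H ∘ₗ (TensorProduct.comm k H H).toLinearMap ∘ₗ
          (antipode k ∘ₗ antipode k).rTensor H) (a ⊗ₜ[k] b) =
          b * antipode k (antipode k a) := by simp
      rw [e, ← mul_assoc, ← antipode_sq_mul_drinfeldElt, drinfeldElt]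
      generalize (rMatrix k H : H ⊗[k] H) = r
      induction r with
      | zero => simp
      | add p q hp hq => simp only [map_add, mul_add, add_mul, hp, hq]
      | tmul c d => simp [antipode_mul_antidistrib, mul_assoc]
  have hSS : TensorProduct.map (antipode k ∘ₗ antipode k) (antipode k)
      (rMatrix k H : H ⊗[k] H) = (((rMatrix k H)⁻¹ : (H ⊗[k] H)ˣ) : H ⊗[k] H) := by
    rw [← antipode_rTensor_R]
    conv_rhs => rw [← map_antipode_antipode_rMatrix]
    rw [← LinearMap.comp_apply, LinearMap.rTensor_comp_map]
  rw [drinfeldEltInv, hW, hSS, Units.mul_inv, Algebra.TensorProduct.one_def]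
  simp

/-- For the right inverse `w` of `u`, `S²(w) u = u w = 1`, so `S²(w)` is a left inverse and must
equal `w`. -/
theorem drinfeldEltInv_mul : drinfeldEltInv k H * drinfeldElt k H = 1 := by
  have h := antipode_sq_mul_drinfeldElt (k := k) (drinfeldEltInv k H)
  rw [drinfeldElt_mul_inv] at h
  rwa [← left_inv_eq_right_inv h drinfeldElt_mul_inv]

theorem antipode_drinfeldElt : antipode k (drinfeldElt k H) =
    LinearMap.mul' k H ((antipode k).lTensor H (rMatrix k H : H ⊗[k] H)) := by
  conv_rhs => rw [← map_antipode_antipode_rMatrix]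
  rw [drinfeldElt]
  generalize (rMatrix k H : H ⊗[k] H) = r
  induction r with
  | zero => simp
  | add p q hp hq => simp only [map_add, hp, hq]
  | tmul c d => simp [antipode_mul_antidistrib]

theorem mul_lTensor_comm_rMatrix_inv : LinearMap.mul' k H ((antipode k).lTensor H
    (flipAlg k H (((rMatrix k H)⁻¹ : (H ⊗[k] H)ˣ) : H ⊗[k] H))) = drinfeldEltInv k H := by
  rw [← antipode_rTensor_R, drinfeldEltInv]
  generalize (rMatrix k H : H ⊗[k] H) = r
  induction r with
  | zero => simp
  | add p q hp hq => simp only [map_add, hp, hq]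
  | tmul c d => simp

theorem mul_comm_lTensor_comm_rMatrix_inv :
    (LinearMap.mul' k H ∘ₗ (TensorProduct.comm k H H).toLinearMap ∘ₗ (antipode k).lTensor H)
      (flipAlg k H (((rMatrix k H)⁻¹ : (H ⊗[k] H)ˣ) : H ⊗[k] H)) =
      antipode k (drinfeldEltInv k H) := by
  rw [← antipode_rTensor_R, drinfeldEltInv]
  conv_lhs => rw [← map_antipode_antipode_rMatrix]
  generalize (rMatrix k H : H ⊗[k] H) = r
  induction r with
  | zero => simp
  | add p q hp hq => simp only [map_add, hp, hq]
  | tmul c d => simp [antipode_mul_antidistrib]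

/-- `R₂₁⁻¹` obeys the same hexagon identity as `R`, so it can serve as a second R-matrix in the
unimodularity argument. -/
theorem comul_lTensor_comm_rMatrix_inv : (comul (R := k) (A := H)).lTensor H
      (flipAlg k H (((rMatrix k H)⁻¹ : (H ⊗[k] H)ˣ) : H ⊗[k] H)) =
    (Algebra.TensorProduct.includeRight : H →ₐ[k] H ⊗[k] H).toLinearMap.lTensor H
      (flipAlg k H (((rMatrix k H)⁻¹ : (H ⊗[k] H)ˣ) : H ⊗[k] H)) *
    (Algebra.TensorProduct.includeLeft : H →ₐ[k] H ⊗[k] H).toLinearMap.lTensor H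
      (flipAlg k H (((rMatrix k H)⁻¹ : (H ⊗[k] H)ˣ) : H ⊗[k] H)) := by
  have h := congrArg (Algebra.TensorProduct.comm k (H ⊗[k] H) H)
    (comul_rTensor_R_inv (k := k) (H := H))
  rw [map_mul] at h
  have e : ∀ (f : H →ₗ[k] H ⊗[k] H) (p : H ⊗[k] H),
      Algebra.TensorProduct.comm k (H ⊗[k] H) H (f.rTensor H p) = f.lTensor H (flipAlg k H p) := by
    intro f p
    induction p with
    | zero => simp
    | add p q hp hq => simp only [map_add, hp, hq]
    | tmul c d => simp
  simpa only [e] using h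

theorem IsFactorizable.sliceR_injective (hf : IsFactorizable k H) {f g : Module.Dual k H}
    (h : sliceR f (monodromy k H : H ⊗[k] H) = sliceR g (monodromy k H : H ⊗[k] H)) : f = g := by
  obtain ⟨n, b, c, hQ⟩ := hf
  rw [hQ] at h
  simp only [map_sum, sliceR_tmul] at h
  refine c.ext fun i => ?_
  simpa [Finsupp.single_apply] using congrArg (fun x => b.repr x i) h

theorem IsFactorizable.sliceL_injective (hf : IsFactorizable k H) {f g : Module.Dual k H}
    (h : sliceL f (monodromy k H : H ⊗[k] H) = sliceL g (monodromy k H : H ⊗[k] H)) : f = g := by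
  obtain ⟨n, b, c, hQ⟩ := hf
  rw [hQ] at h
  simp only [map_sum, sliceL_tmul] at h
  refine b.ext fun i => ?_
  simpa [Finsupp.single_apply] using congrArg (fun x => c.repr x i) h

theorem IsFactorizable.sliceL_surjective (hf : IsFactorizable k H) (x : H) :
    ∃ f, sliceL f (monodromy k H : H ⊗[k] H) = x := by
  obtain ⟨n, b, c, hQ⟩ := hf
  refine ⟨b.constr k (fun i => c.repr x i), ?_⟩
  rw [hQ]
  simp only [map_sum, sliceL_tmul, Module.Basis.constr_basis]
  exact c.sum_repr x

theorem monodromy_eq : (monodromy k H : H ⊗[k] H) =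
    flipAlg k H (rMatrix k H : H ⊗[k] H) * (rMatrix k H : H ⊗[k] H) := rfl

theorem flip_rMatrix_mul_inv : flipAlg k H (rMatrix k H : H ⊗[k] H) *
    flipAlg k H (((rMatrix k H)⁻¹ : (H ⊗[k] H)ˣ) : H ⊗[k] H) = 1 := by
  rw [← map_mul, Units.mul_inv, map_one]

theorem sliceR_counit_monodromy : sliceR (counit (R := k)) (monodromy k H : H ⊗[k] H) = 1 := by
  change sliceR (Bialgebra.counitAlgHom k H).toLinearMap _ = 1
  have h1 : sliceR (Bialgebra.counitAlgHom k H).toLinearMap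
      (((rMatrix k H)⁻¹ : (H ⊗[k] H)ˣ) : H ⊗[k] H) = 1 := counit_lTensor_R_inv
  have h2 : sliceR (Bialgebra.counitAlgHom k H).toLinearMap (rMatrix k H : H ⊗[k] H) = 1 := by
    have := sliceR_mul (Bialgebra.counitAlgHom k H) (rMatrix k H : H ⊗[k] H)
      (((rMatrix k H)⁻¹ : (H ⊗[k] H)ˣ) : H ⊗[k] H)
    rw [Units.mul_inv, sliceR_one, h1, mul_one] at this
    exact this.symm
  have h3 : ∀ p : H ⊗[k] H, sliceR (Bialgebra.counitAlgHom k H).toLinearMap (flipAlg k H p) =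
      TensorProduct.lid k H ((counit (R := k)).rTensor H p) := by
    intro p
    induction p with
    | zero => simp
    | add p q hp hq => simp only [map_add, hp, hq]
    | tmul a b => simp
  rw [monodromy_eq, sliceR_mul, h2, h3, counit_rTensor_R, mul_one]

variable [FiniteDimensional k H]

/-- `u S(u)` is central. -/
theorem drinfeldElt_mul_antipode_central (h : H) :
    drinfeldElt k H * antipode k (drinfeldElt k H) * h =
      h * (drinfeldElt k H * antipode k (drinfeldElt k H)) := by
  -- Write `h = S³(z)`: applying `S` to `S²(z) u = u z` moves `S³(z)` past `S(u)` as `S(z)`, and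
  -- conjugation by `u` turns this back into `S³(z)`.
  obtain ⟨y, rfl⟩ := (antipode_bijective (k := k) (H := H)).2 h
  obtain ⟨x, rfl⟩ := (antipode_bijective (k := k) (H := H)).2 y
  obtain ⟨z, rfl⟩ := (antipode_bijective (k := k) (H := H)).2 x
  have e := congrArg (antipode k) (antipode_sq_mul_drinfeldElt (k := k) z)
  rw [antipode_mul_antidistrib, antipode_mul_antidistrib] at e
  rw [mul_assoc, e, ← mul_assoc, ← antipode_sq_mul_drinfeldElt, mul_assoc]

/-- A factorizable Hopf algebra is unimodular. -/
theorem IsFactorizable.isRightIntegral (hf : IsFactorizable k H) {t : H} {lam : Module.Dual k H}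
    (ht : IsLeftIntegral k t) (hl : IsRightCointegral lam) (hlt : lam t = 1) :
    IsRightIntegral k t := by
  have hth : ∀ h : H, t * h = lam (t * h) • t := fun h =>
    IsLeftIntegral.eq_smul ht hl hlt fun x => by rw [← mul_assoc, ht, smul_mul_assoc]
  -- `t h` is a left integral, hence `t h = α(h) t` with `α(h) = λ(t h)`; associativity makes `α` a
  -- character.
  let α : H →ₐ[k] k := AlgHom.ofLinearMap (lam ∘ₗ LinearMap.mulLeft k t) (by simp [hlt]) (by
    intro x y
    simp only [LinearMap.comp_apply, LinearMap.mulLeft_apply]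
    conv_lhs => rw [← mul_assoc, hth x, smul_mul_assoc, hth y]
    simp [hlt])
  have hα : ∀ h, t * h = α h • t := hth
  have E := mul_tmul_one_of_rMatrix ht hα (r_intertwine t)
    QuasitriangularHopfAlgebra.comul_lTensor_R
  have E' := mul_tmul_one_of_rMatrix ht hα (r := flipAlg k H
    (((rMatrix k H)⁻¹ : (H ⊗[k] H)ˣ) : H ⊗[k] H)) (by
      have := congrArg (flipAlg k H) (r_inv_intertwine (k := k) t)
      rw [map_mul, map_mul] at this
      refine Eq.trans ?_ this.symm
      congr 1
      exact ((TensorProduct.comm k H H).symm_apply_apply _).symm)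
    comul_lTensor_comm_rMatrix_inv
  rw [mul_lTensor_comm_rMatrix_inv, mul_comm_lTensor_comm_rMatrix_inv] at E'
  rw [← antipode_drinfeldElt] at E
  change _ = _ * ((drinfeldElt k H * _) ⊗ₜ[k] 1) at E
  set g := sliceR α.toLinearMap (rMatrix k H : H ⊗[k] H)
  set g' := sliceR α.toLinearMap (flipAlg k H (((rMatrix k H)⁻¹ : (H ⊗[k] H)ˣ) : H ⊗[k] H))
    with hg'
  set c := drinfeldElt k H * antipode k (drinfeldElt k H) with hc
  have hcc : ∀ p : H ⊗[k] H, (c ⊗ₜ 1) * p = p * (c ⊗ₜ 1) := by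
    intro p
    induction p with
    | zero => simp
    | add p q hp hq => simp only [mul_add, add_mul, hp, hq]
    | tmul a b => simp [hc, drinfeldElt_mul_antipode_central a]
  have c1 : c * drinfeldEltInv k H = antipode k (drinfeldElt k H) := by
    rw [hc, drinfeldElt_mul_antipode_central, ← mul_assoc, drinfeldEltInv_mul, one_mul]
  have c2 : c * antipode k (drinfeldEltInv k H) = drinfeldElt k H := by
    rw [hc, mul_assoc, ← antipode_mul_antidistrib, drinfeldEltInv_mul, antipode_one, mul_one]
  -- Multiplication by the central `c = u S(u)` turns the factor `u⁻¹` into `S(u)` and `S(u⁻¹)` into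
  -- `u`, so that the relation for `R₂₁⁻¹` has the same left side as the one for `R`.
  have E2 := congrArg ((c ⊗ₜ[k] (1 : H)) * ·) E'
  simp only [← mul_assoc] at E2
  rw [hcc (flipAlg k H _), mul_assoc _ (c ⊗ₜ[k] (1 : H))] at E2
  simp only [Algebra.TensorProduct.tmul_mul_tmul, mul_one, ← mul_assoc, c1, c2] at E2
  -- Contracting with `λ` cancels `Δ(t)`, because `(λ ⊗ id)(Δ(t)) = 1`; what remains is `u g = u
  -- g'`.
  have E3 := congrArg (fun p => sliceL lam (flipAlg k H p)) (E.symm.trans E2)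
  have e0 : flipAlg k H (flipAlg k H (comul (R := k) t)) = comul (R := k) t :=
    (TensorProduct.comm k H H).symm_apply_apply _
  simp only [map_mul, e0, Algebra.TensorProduct.comm_tmul, sliceL_mul_one_tmul, hl.sliceL_comul,
    hlt, one_smul, one_mul] at E3
  have E4 : g = g' := by
    have := congrArg (drinfeldEltInv k H * ·) E3
    simpa only [← mul_assoc, drinfeldEltInv_mul, one_mul] using this
  have E5 : sliceR α.toLinearMap (monodromy k H : H ⊗[k] H) =
      sliceR (counit (R := k)) (monodromy k H : H ⊗[k] H) := by
    rw [sliceR_counit_monodromy, monodromy_eq, sliceR_mul]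
    change _ * g = 1
    rw [E4, hg', ← sliceR_mul, flip_rMatrix_mul_inv, sliceR_one]
  have E6 := hf.sliceR_injective E5
  intro h
  rw [hα h]
  exact congrArg (· • t) (LinearMap.congr_fun E6 h)

end Unimodular

end FactorizableHopf

namespace FactorizableHopf

open Coalgebra HopfAlgebra

/-! ### The Drinfeld image of the cointegral and the normalized pair. -/

section NormalizedPair

variable {k H : Type u} [Field k] [Ring H] [HopfAlgebra k H] [QuasitriangularHopfAlgebra k H]

/-- `R` carries `Δ` to `Δ^op` and `R₂₁` carries it back. -/
theorem monodromy_comm (h : H) : (monodromy k H : H ⊗[k] H) * comul (R := k) h =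
    comul (R := k) h * (monodromy k H : H ⊗[k] H) := by
  have h1 : flipAlg k H (rMatrix k H : H ⊗[k] H) * flipAlg k H (comul (R := k) h) =
      comul (R := k) h * flipAlg k H (rMatrix k H : H ⊗[k] H) := by
    have := congrArg (flipAlg k H) (r_intertwine (k := k) h)
    rw [map_mul, map_mul] at this
    refine this.trans ?_
    congr 1
    exact (TensorProduct.comm k H H).symm_apply_apply _
  rw [monodromy_eq, mul_assoc, r_intertwine, ← mul_assoc, ← mul_assoc]
  exact congrArg (· * (rMatrix k H : H ⊗[k] H)) h1

/-- `(Δ ⊗ id)(Q) = R₃₂ Q₁₃ R₂₃` -/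
theorem comul_rTensor_monodromy : (comul (R := k) (A := H)).rTensor H
      (monodromy k H : H ⊗[k] H) =
    (Algebra.TensorProduct.includeRight : H →ₐ[k] H ⊗[k] H).toLinearMap.rTensor H
      (flipAlg k H (rMatrix k H : H ⊗[k] H)) *
    (Algebra.TensorProduct.includeLeft : H →ₐ[k] H ⊗[k] H).toLinearMap.rTensor H
      (monodromy k H : H ⊗[k] H) *
    (Algebra.TensorProduct.includeRight : H →ₐ[k] H ⊗[k] H).toLinearMap.rTensor H
      (rMatrix k H : H ⊗[k] H) := by
  have h := congrArg (Algebra.TensorProduct.comm k H (H ⊗[k] H))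
    (QuasitriangularHopfAlgebra.comul_lTensor_R (k := k) (H := H))
  rw [map_mul] at h
  have e : ∀ (f : H →ₗ[k] H ⊗[k] H) (p : H ⊗[k] H),
      Algebra.TensorProduct.comm k H (H ⊗[k] H) (f.lTensor H p) = f.rTensor H (flipAlg k H p) := by
    intro f p
    induction p with
    | zero => simp
    | add p q hp hq => simp only [map_add, hp, hq]
    | tmul c d => simp
  simp only [e] at h
  have hm : ∀ (f : H →ₐ[k] H ⊗[k] H) (p q : H ⊗[k] H), f.toLinearMap.rTensor H (p * q) =
      f.toLinearMap.rTensor H p * f.toLinearMap.rTensor H q := fun f p q =>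
    map_mul (Algebra.TensorProduct.map f (AlgHom.id k H)) p q
  have hc : (comul (R := k) (A := H)) = (Bialgebra.comulAlgHom k H).toLinearMap := rfl
  rw [monodromy_eq, hc, hm, hm, ← hc, h, QuasitriangularHopfAlgebra.comul_rTensor_R]
  simp only [mul_assoc]

/-- Apply `λ ⊗ p ⊗ id` to `(Δ ⊗ id)(Q) = R₃₂ Q₁₃ R₂₃`, with `c = f_Q(λ)`. The left side is `p(1) c`
by the cointegral property. On the right, `Q₁₃` contracts to the central element `c`, which leaves
`c (p ⊗ id)(R₂₁ R) = c f_Q(p)`. -/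
theorem IsRightCointegral.sliceL_monodromy_mul {lam : Module.Dual k H}
    (hl : IsRightCointegral lam) (hc : ∀ h : H, sliceL lam (monodromy k H : H ⊗[k] H) * h =
      h * sliceL lam (monodromy k H : H ⊗[k] H)) (p : Module.Dual k H) :
    sliceL lam (monodromy k H : H ⊗[k] H) * sliceL p (monodromy k H : H ⊗[k] H) =
      p 1 • sliceL lam (monodromy k H : H ⊗[k] H) := by
  let E : (H ⊗[k] H) ⊗[k] H →ₗ[k] H := (TensorProduct.lid k H).toLinearMap ∘ₗ
    (p ∘ₗ sliceL lam).rTensor H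
  have e := congrArg E (comul_rTensor_monodromy (k := k) (H := H))
  have e1 : ∀ q : H ⊗[k] H, E ((comul (R := k)).rTensor H q) = p 1 • sliceL lam q := by
    intro q
    induction q with
    | zero => simp
    | add p q hp hq => simp only [map_add, smul_add, hp, hq]
    | tmul a b => simp [E, hl.sliceL_comul, smul_smul, mul_comm]
  have e2 : ∀ x y z : H ⊗[k] H, E (
      (Algebra.TensorProduct.includeRight : H →ₐ[k] H ⊗[k] H).toLinearMap.rTensor H x *
      (Algebra.TensorProduct.includeLeft : H →ₐ[k] H ⊗[k] H).toLinearMap.rTensor H y *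
      (Algebra.TensorProduct.includeRight : H →ₐ[k] H ⊗[k] H).toLinearMap.rTensor H z) =
      sliceL p (x * (1 ⊗ₜ sliceL lam y) * z) := by
    intro x y z
    induction x with
    | zero => simp
    | add p q hp hq => simp only [map_add, add_mul, hp, hq]
    | tmul a a' =>
      induction y with
      | zero => simp
      | add p q hp hq =>
        simp only [map_add, TensorProduct.tmul_add, add_mul, mul_add, hp, hq]
      | tmul b b' =>
        induction z with
        | zero => simp
        | add p q hp hq => simp only [map_add, mul_add, hp, hq]
        | tmul c c' => simp [E, smul_smul]
  have e3 : ∀ x : H ⊗[k] H, x * (1 ⊗ₜ sliceL lam (monodromy k H : H ⊗[k] H)) =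
      (1 ⊗ₜ sliceL lam (monodromy k H : H ⊗[k] H)) * x := by
    intro x
    induction x with
    | zero => simp
    | add p q hp hq => simp only [mul_add, add_mul, hp, hq]
    | tmul a b => simp [hc]
  rw [e1, e2, e3, mul_assoc, ← monodromy_eq, sliceL_one_tmul_mul] at e
  exact e.symm

theorem counit_sliceL_monodromy (p : Module.Dual k H) :
    counit (R := k) (sliceL p (monodromy k H : H ⊗[k] H)) = p 1 := by
  rw [← apply_sliceR, sliceR_counit_monodromy]

variable [FiniteDimensional k H]

/-- The image of the cointegral under the Drinfeld map is central. -/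
theorem IsFactorizable.sliceL_monodromy_central (hf : IsFactorizable k H) {t : H}
    {lam : Module.Dual k H} (ht : IsLeftIntegral k t) (hl : IsRightCointegral lam)
    (hlt : lam t = 1) (h : H) : sliceL lam (monodromy k H : H ⊗[k] H) * h =
      h * sliceL lam (monodromy k H : H ⊗[k] H) := by
  let 𝓡 := Repr.arbitrary k h
  -- With `c = f_Q(λ)`, invariance gives `c h = ∑ (λ ⊗ id)((S(h₁) ⊗ 1) Q Δ(h₂))`; once `Q` commutes
  -- past `Δ(h₂)`, the antipode identity produces `h c`.
  rw [← sum_sliceL_antipode_mul_mul_comul ht hl hlt (hf.isRightIntegral ht hl hlt) _ 𝓡,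
    ← sliceL_one_tmul_mul, ← sum_antipode_tmul_one_mul_comul 𝓡, Finset.sum_mul, map_sum]
  simp only [mul_assoc, monodromy_comm]

/-- The image of the cointegral under the Drinfeld map is an integral. -/
theorem IsFactorizable.isLeftIntegral_sliceL_monodromy (hf : IsFactorizable k H) {t : H}
    {lam : Module.Dual k H} (ht : IsLeftIntegral k t) (hl : IsRightCointegral lam)
    (hlt : lam t = 1) : IsLeftIntegral k (sliceL lam (monodromy k H : H ⊗[k] H)) := by
  intro h
  have hc := hf.sliceL_monodromy_central ht hl hlt
  -- Every `h` is `f_Q(p)` for some `p`, and then `ε(h) = p(1)`.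
  obtain ⟨p, rfl⟩ := hf.sliceL_surjective h
  rw [← hc, hl.sliceL_monodromy_mul hc, counit_sliceL_monodromy]

/-- `c = f_Q(λ)` is a left integral, so `c = λ(c) t`; the scalar is nonzero since otherwise `f_Q(λ)
= 0`, contradicting injectivity of `f_Q`. It remains to rescale. -/
theorem IsFactorizable.exists_isNormalizedPair [IsAlgClosed k] (hf : IsFactorizable k H) :
    ∃ (Λ : H) (lam : Module.Dual k H), IsNormalizedPair Λ lam := by
  obtain ⟨t, lam, ht, hl, hlt⟩ := exists_integral_cointegral k H
  have hc := hf.isLeftIntegral_sliceL_monodromy ht hl hlt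
  set c := sliceL lam (monodromy k H : H ⊗[k] H) with hcdef
  have hct := IsLeftIntegral.eq_smul ht hl hlt hc
  have h0 : lam c ≠ 0 := by
    intro h
    rw [h, zero_smul] at hct
    have : lam = 0 := hf.sliceL_injective (by rw [← hcdef, hct]; simp [sliceL])
    simp [this] at hlt
  -- Scaling both members by `s` preserves `f_Q(λ) = Λ` and multiplies `λ(Λ)` by `s²`, so a square
  -- root of `λ(c)⁻¹` is needed.
  obtain ⟨s, hs⟩ := IsAlgClosed.exists_pow_nat_eq (lam c)⁻¹ (n := 2) (by norm_num)
  refine ⟨s • c, s • lam, fun h => ?_, fun h => ?_, ?_, ?_⟩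
  · rw [mul_smul_comm, hc, smul_comm]
  · have := hl h
    rw [LinearMap.rTensor_smul, LinearMap.smul_apply, map_smul, this, LinearMap.smul_apply,
      smul_eq_mul, map_mul, Algebra.smul_def]
  · rw [map_smul, LinearMap.smul_apply, smul_smul, ← sq, hs, smul_eq_mul, inv_mul_cancel₀ h0]
  · rw [drinfeldMap_eq_sliceL, hcdef]
    simp [sliceL, LinearMap.rTensor_smul]

end NormalizedPair

end FactorizableHopf

namespace FactorizableHopf

open HopfAlgebra

/-! ### The universal property of the coend. -/

namespace HMod

variable {k H : Type u} [Field k] [Ring H] [HopfAlgebra k H]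

variable (k H) in
/-- The left regular module. -/
noncomputable def regular [FiniteDimensional k H] : HMod k H where
  V := H
  act := LinearMap.mul k H
  act_one := by ext; simp
  act_mul a b := by ext; simp [mul_assoc]

/-- The morphism `x ↦ x u` from the regular module. -/
noncomputable def orbit [FiniteDimensional k H] (U : HMod k H) (u : U.V) : regular k H ⟶ U where
  lin := U.act.flip u
  lin_act h := LinearMap.ext fun x => LinearMap.congr_fun (U.act_mul h x) u

/-- The linear map `H* → Z` induced by a dinatural family `U* ⊗ U → Z`. -/
noncomputable def descLin {Z : Type u} [AddCommGroup Z] [Module k Z]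
    (z : Module.Dual k H ⊗[k] H →ₗ[k] Z) : Module.Dual k H →ₗ[k] Z :=
  z ∘ₗ (TensorProduct.mk k (Module.Dual k H) H).flip 1

/-- Dinaturality along `x ↦ x u`, evaluated at `1`, expresses the component at `U` on `f ⊗ u`
through the regular component on `f(· u) ⊗ 1`. -/
theorem descLin_comp_iotaLin [FiniteDimensional k H] {Z : Type u} [AddCommGroup Z] [Module k Z]
    (z : ∀ U : HMod k H, Module.Dual k U.V ⊗[k] U.V →ₗ[k] Z)
    (hz : ∀ {U U' : HMod k H} (φ : U ⟶ U') (f : Module.Dual k U'.V) (u : U.V),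
      z U ((f ∘ₗ Hom.lin φ : Module.Dual k U.V) ⊗ₜ u) = z U' (f ⊗ₜ Hom.lin φ u)) (U : HMod k H) :
    descLin (H := H) (z (regular k H)) ∘ₗ iotaLin U = z U := by
  apply TensorProduct.ext'
  intro f u
  refine (hz (orbit U u) f (1 : H)).trans ?_
  change z U (f ⊗ₜ U.act 1 u) = _
  rw [U.act_one]; rfl

/-- The regular component of the cowedge already reaches all of `H*`, which gives uniqueness of the
induced morphism. -/
theorem iotaLin_regular_tmul_one [FiniteDimensional k H] (f : Module.Dual k H) :
    iotaLin (regular k H) (f ⊗ₜ (1 : H)) = f := by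
  apply LinearMap.ext
  intro x
  exact congrArg f (mul_one x)

variable [QuasitriangularHopfAlgebra k H] [FiniteDimensional k H]

theorem twistedCowedge_dinatural (ω : H ≃ₐc[k] H) (E : Limits.Cowedge (boxDualTwisted k H ω))
    {U U' : HMod k H} (φ : U ⟶ U') (f : Module.Dual k U'.V) (u : U.V) :
    HBimod.Hom.lin (E.π U) ((f ∘ₗ Hom.lin φ : Module.Dual k U.V) ⊗ₜ[k] u) =
      HBimod.Hom.lin (E.π U') (f ⊗ₜ[k] Hom.lin φ u) :=
  LinearMap.congr_fun (congrArg HBimod.Hom.lin (Limits.Cowedge.condition E φ)) (f ⊗ₜ[k] u)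

/-- The morphism out of `F_ω` induced by a cowedge. -/
noncomputable def twistedDesc (ω : H ≃ₐc[k] H) (E : Limits.Cowedge (boxDualTwisted k H ω)) :
    HBimod.coregularTwisted k H ω ⟶ E.pt where
  lin := descLin (H := H) (HBimod.Hom.lin (E.π (regular k H)))
  lin_act h := by
    apply LinearMap.ext
    intro f
    exact LinearMap.congr_fun (HBimod.Hom.lin_act (E.π (regular k H)) h) (f ⊗ₜ (1 : H))
  lin_ract h := by
    apply LinearMap.ext
    intro f
    refine Eq.trans ?_ (LinearMap.congr_fun (HBimod.Hom.lin_ract (E.π (regular k H)) h)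
      (f ⊗ₜ (1 : H)))
    -- The right action on `F_ω` precomposes with right multiplication by `S⁻¹(ω(h))`, an
    -- endomorphism of the left regular module. Dinaturality moves it to the vector `1`, where it
    -- agrees with the action of `ω(S⁻¹(h))`.
    refine (twistedCowedge_dinatural ω E (orbit (regular k H) (antipodeInv k H (ω h))) f (1 : H)).trans ?_
    change HBimod.Hom.lin (E.π (regular k H)) (f ⊗ₜ[k] ((1 : H) * antipodeInv k H (ω h))) =
      HBimod.Hom.lin (E.π (regular k H)) (f ⊗ₜ[k] (ω (antipodeInv k H h) * (1 : H)))
    rw [map_antipodeInv, one_mul, mul_one]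

variable (k H) in
/-- `F_ω` is the coend of `U^∨ ⊠ ω(U)`. -/
noncomputable def coregularTwistedIsColimit (ω : H ≃ₐc[k] H) :
    Limits.IsColimit (coregularTwistedCowedge k H ω) :=
  Limits.Multicofork.IsColimit.mk _ (twistedDesc ω)
    (fun E U => HBimod.hom_ext (descLin_comp_iotaLin (fun U => HBimod.Hom.lin (E.π U))
      (twistedCowedge_dinatural ω E) U))
    (fun E m hm => HBimod.hom_ext (LinearMap.ext fun f => by
      have h := LinearMap.congr_fun (congrArg HBimod.Hom.lin (hm (regular k H))) (f ⊗ₜ (1 : H))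
      refine Eq.trans ?_ h
      exact congrArg (HBimod.Hom.lin m) (iotaLin_regular_tmul_one f).symm))

theorem cowedge_dinatural (E : Limits.Cowedge (boxDualFunctor k H))
    {U U' : HMod k H} (φ : U ⟶ U') (f : Module.Dual k U'.V) (u : U.V) :
    HBimod.Hom.lin (E.π U) ((f ∘ₗ Hom.lin φ : Module.Dual k U.V) ⊗ₜ[k] u) =
      HBimod.Hom.lin (E.π U') (f ⊗ₜ[k] Hom.lin φ u) :=
  LinearMap.congr_fun (congrArg HBimod.Hom.lin (Limits.Cowedge.condition E φ)) (f ⊗ₜ[k] u)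

/-- The morphism out of `F` induced by a cowedge. -/
noncomputable def desc (E : Limits.Cowedge (boxDualFunctor k H)) :
    HBimod.coregular k H ⟶ E.pt where
  lin := descLin (H := H) (HBimod.Hom.lin (E.π (regular k H)))
  lin_act h := by
    apply LinearMap.ext
    intro f
    exact LinearMap.congr_fun (HBimod.Hom.lin_act (E.π (regular k H)) h) (f ⊗ₜ (1 : H))
  lin_ract h := by
    apply LinearMap.ext
    intro f
    refine Eq.trans ?_ (LinearMap.congr_fun (HBimod.Hom.lin_ract (E.π (regular k H)) h)
      (f ⊗ₜ (1 : H)))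
    refine (cowedge_dinatural E (orbit (regular k H) (antipodeInv k H h)) f (1 : H)).trans ?_
    change HBimod.Hom.lin (E.π (regular k H)) (f ⊗ₜ[k] ((1 : H) * antipodeInv k H h)) =
      HBimod.Hom.lin (E.π (regular k H)) (f ⊗ₜ[k] (antipodeInv k H h * (1 : H)))
    rw [one_mul, mul_one]

variable (k H) in
/-- `F` is the coend of `U^∨ ⊠ U`. -/
noncomputable def coregularIsColimit :
    Limits.IsColimit (coregularCowedge k H) :=
  Limits.Multicofork.IsColimit.mk _ desc
    (fun E U => HBimod.hom_ext (descLin_comp_iotaLin (fun U => HBimod.Hom.lin (E.π U))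
      (cowedge_dinatural E) U))
    (fun E m hm => HBimod.hom_ext (LinearMap.ext fun f => by
      have h := LinearMap.congr_fun (congrArg HBimod.Hom.lin (hm (regular k H))) (f ⊗ₜ (1 : H))
      refine Eq.trans ?_ h
      exact congrArg (HBimod.Hom.lin m) (iotaLin_regular_tmul_one f).symm))

end HMod

end FactorizableHopf

namespace FactorizableHopf

open Coalgebra HopfAlgebra

/-! ### The Frobenius axioms as linear identities on `H*`. -/

section FrobeniusMaps

variable {k H : Type u} [Field k] [Ring H] [HopfAlgebra k H]

theorem sliceL_counit_comul (x : H) : sliceL (counit (R := k)) (comul (R := k) x) = x := by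
  rw [sliceL, LinearMap.comp_apply, rTensor_counit_comul]; simp

theorem sliceR_counit_comul (x : H) : sliceR (counit (R := k)) (comul (R := k) x) = x := by
  rw [sliceR, LinearMap.comp_apply, lTensor_counit_comul]; simp

theorem sliceL_lTensor (φ : Module.Dual k H) (f : H →ₗ[k] H) (p : H ⊗[k] H) :
    sliceL φ (f.lTensor H p) = f (sliceL φ p) := by
  induction p with
  | zero => simp
  | add p q hp hq => simp only [map_add, hp, hq]
  | tmul a b => simp

theorem sliceR_smul (c : k) (φ : Module.Dual k H) (p : H ⊗[k] H) :
    sliceR (c • φ) p = c • sliceR φ p := by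
  simp [sliceR, LinearMap.lTensor_smul]

variable [FiniteDimensional k H]

@[simp] theorem nestedDual_tmul (f g : Module.Dual k H) (x y : H) :
    nestedDual k H (f ⊗ₜ g) (x ⊗ₜ y) = f y * g x := by
  simp [nestedDual, mul_comm, TensorProduct.dualDistribEquiv, TensorProduct.dualDistribEquivOfBasis]

theorem nestedDual_ext {s t : Module.Dual k H ⊗[k] Module.Dual k H}
    (h : ∀ x y, nestedDual k H s (x ⊗ₜ y) = nestedDual k H t (x ⊗ₜ y)) : s = t :=
  (nestedDual k H).injective (TensorProduct.ext' h)

theorem mulF_apply (t : Module.Dual k H ⊗[k] Module.Dual k H) (x : H) :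
    mulF k H t x = nestedDual k H t (comul (R := k) x) := rfl

theorem nestedDual_comulF (lam f : Module.Dual k H) (p : H ⊗[k] H) :
    nestedDual k H (comulF lam f) p = f (comulFPredual lam p) := by
  simp [comulF]

theorem nestedDual_tmul_left (f g : Module.Dual k H) (p : H ⊗[k] H) :
    nestedDual k H (f ⊗ₜ g) p = f (sliceL g p) := by
  induction p with
  | zero => simp
  | add p q hp hq => simp only [map_add, hp, hq]
  | tmul x y => simp [mul_comm]

theorem nestedDual_tmul_right (f g : Module.Dual k H) (p : H ⊗[k] H) :
    nestedDual k H (f ⊗ₜ g) p = g (sliceR f p) := by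
  rw [nestedDual_tmul_left, apply_sliceR]

theorem mulF_one_left : mulF k H ∘ₗ TensorProduct.map (oneF k H) LinearMap.id =
    (TensorProduct.lid k (Module.Dual k H)).toLinearMap := by
  apply TensorProduct.ext'
  intro c g
  ext x
  simp [mulF_apply, oneF, nestedDual_tmul_right, sliceR_counit_comul, sliceR_smul]

theorem mulF_one_right : mulF k H ∘ₗ TensorProduct.map LinearMap.id (oneF k H) =
    (TensorProduct.rid k (Module.Dual k H)).toLinearMap := by
  apply TensorProduct.ext'
  intro g c
  ext x
  simp [mulF_apply, oneF, nestedDual_tmul_left, sliceL_counit_comul]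

/-- The transpose of coassociativity, in the form that contraction with `h` is colinear. -/
theorem mulF_assoc : mulF k H ∘ₗ TensorProduct.map (mulF k H) LinearMap.id =
    mulF k H ∘ₗ TensorProduct.map LinearMap.id (mulF k H) ∘ₗ
      (TensorProduct.assoc k (Module.Dual k H) (Module.Dual k H) (Module.Dual k H)).toLinearMap := by
  apply TensorProduct.ext_threefold
  intro f g h
  ext x
  have e : mulF k H (g ⊗ₜ h) = g ∘ₗ sliceL h ∘ₗ comul :=
    LinearMap.ext fun y => nestedDual_tmul_left g h _
  have e2 : ∀ p : H ⊗[k] H, sliceL (g ∘ₗ sliceL h ∘ₗ comul) p =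
      sliceL g ((sliceL h ∘ₗ comul).rTensor H p) := by
    intro p
    induction p with
    | zero => simp
    | add p q hp hq => simp only [map_add, hp, hq]
    | tmul x y => simp
  simp only [LinearMap.comp_apply, TensorProduct.map_tmul, LinearMap.id_apply,
    LinearEquiv.coe_coe, TensorProduct.assoc_tmul]
  rw [mulF_apply, mulF_apply, nestedDual_tmul_left, nestedDual_tmul_left, mulF_apply,
    nestedDual_tmul_left, e, e2, comul_sliceL_comul]

theorem counitF_rTensor_apply (Λ x : H) (t : Module.Dual k H ⊗[k] Module.Dual k H) :
    TensorProduct.lid k (Module.Dual k H)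
      (TensorProduct.map (counitF (k := k) Λ) LinearMap.id t) x =
      nestedDual k H t (x ⊗ₜ Λ) := by
  induction t with
  | zero => simp
  | add p q hp hq => simp only [map_add, LinearMap.add_apply, hp, hq]
  | tmul f g => simp [counitF]

theorem counitF_lTensor_apply (Λ x : H) (t : Module.Dual k H ⊗[k] Module.Dual k H) :
    TensorProduct.rid k (Module.Dual k H)
      (TensorProduct.map LinearMap.id (counitF (k := k) Λ) t) x =
      nestedDual k H t (Λ ⊗ₜ x) := by
  induction t with
  | zero => simp
  | add p q hp hq => simp only [map_add, LinearMap.add_apply, hp, hq]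
  | tmul f g => simp [counitF, mul_comm]

theorem nestedDual_map_mulF_assoc (g : Module.Dual k H) (x y : H)
    (s : Module.Dual k H ⊗[k] Module.Dual k H) :
    nestedDual k H (TensorProduct.map LinearMap.id (mulF k H)
      (TensorProduct.assoc k _ _ _ (s ⊗ₜ g))) (x ⊗ₜ y) =
    nestedDual k H s (sliceL g (comul (R := k) x) ⊗ₜ y) := by
  induction s with
  | zero => simp
  | add p q hp hq => simp only [map_add, TensorProduct.add_tmul, LinearMap.add_apply, hp, hq]
  | tmul a b => simp [mulF_apply, nestedDual_tmul_left b g]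

theorem nestedDual_map_mulF_assoc_symm (f : Module.Dual k H) (x y : H)
    (s : Module.Dual k H ⊗[k] Module.Dual k H) :
    nestedDual k H (TensorProduct.map (mulF k H) LinearMap.id
      ((TensorProduct.assoc k _ _ _).symm (f ⊗ₜ s))) (x ⊗ₜ y) =
    nestedDual k H s (x ⊗ₜ sliceR f (comul (R := k) y)) := by
  induction s with
  | zero => simp
  | add p q hp hq => simp only [map_add, TensorProduct.tmul_add, LinearMap.add_apply, hp, hq]
  | tmul a b => simp [mulF_apply, nestedDual_tmul_right f a]

/-- Evaluated on `x ⊗ y`, both sides are `f` at the predual product of `∑ g(x₁) x₂` and `y`, by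
colinearity of that product in `x`. -/
theorem comulF_mulF_left (lam : Module.Dual k H) : TensorProduct.map LinearMap.id (mulF k H) ∘ₗ
      (TensorProduct.assoc k (Module.Dual k H) (Module.Dual k H) (Module.Dual k H)).toLinearMap ∘ₗ
        TensorProduct.map (comulF lam) LinearMap.id = comulF lam ∘ₗ mulF k H := by
  apply TensorProduct.ext'
  intro f g
  refine nestedDual_ext fun x y => ?_
  refine (nestedDual_map_mulF_assoc g x y (comulF lam f)).trans ?_
  rw [nestedDual_comulF, LinearMap.comp_apply, nestedDual_comulF, mulF_apply,
    nestedDual_tmul_left, comul_comulFPredual_left, sliceL_lTensor]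
  rfl

/-- Threefold nested evaluation `f ⊗ (g ⊗ h) ↦ ((x ⊗ y) ⊗ z ↦ f(z) g(y) h(x))`. -/
noncomputable def nestedDual₃ : Module.Dual k H ⊗[k] (Module.Dual k H ⊗[k] Module.Dual k H) ≃ₗ[k]
    Module.Dual k ((H ⊗[k] H) ⊗[k] H) :=
  TensorProduct.congr (LinearEquiv.refl k _) (nestedDual k H) ≪≫ₗ TensorProduct.comm k _ _ ≪≫ₗ
    TensorProduct.dualDistribEquiv k (H ⊗[k] H) H

theorem nestedDual₃_tmul (f : Module.Dual k H) (s : Module.Dual k H ⊗[k] Module.Dual k H)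
    (p : H ⊗[k] H) (z : H) : nestedDual₃ (f ⊗ₜ s) (p ⊗ₜ z) = nestedDual k H s p * f z := by
  simp [nestedDual₃, TensorProduct.dualDistribEquiv, TensorProduct.dualDistribEquivOfBasis]

section
variable [QuasitriangularHopfAlgebra k H]

/-- The same argument with colinearity in `y`, which depends on the cointegral property. -/
theorem IsRightCointegral.comulF_mulF_right {lam : Module.Dual k H} (hl : IsRightCointegral lam) :
    TensorProduct.map (mulF k H) LinearMap.id ∘ₗ
      (TensorProduct.assoc k (Module.Dual k H) (Module.Dual k H)
        (Module.Dual k H)).symm.toLinearMap ∘ₗ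
        TensorProduct.map LinearMap.id (comulF lam) = comulF lam ∘ₗ mulF k H := by
  apply TensorProduct.ext'
  intro f g
  refine nestedDual_ext fun x y => ?_
  refine (nestedDual_map_mulF_assoc_symm f x y (comulF lam g)).trans ?_
  rw [nestedDual_comulF, LinearMap.comp_apply, nestedDual_comulF, mulF_apply,
    nestedDual_tmul_right, hl.comul_comulFPredual_right, sliceR_rTensor]
  rfl

/-- The transpose of associativity of the predual product; threefold nested evaluation separates the
tensors. -/
theorem IsRightCointegral.comulF_assoc {lam : Module.Dual k H} (hl : IsRightCointegral lam) :
    TensorProduct.map LinearMap.id (comulF lam) ∘ₗ comulF lam =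
      (TensorProduct.assoc k (Module.Dual k H) (Module.Dual k H) (Module.Dual k H)).toLinearMap ∘ₗ
        TensorProduct.map (comulF lam) LinearMap.id ∘ₗ comulF lam := by
  have e1 : ∀ (t : Module.Dual k H ⊗[k] Module.Dual k H) (x y z : H),
      nestedDual₃ (TensorProduct.map LinearMap.id (comulF lam) t) ((x ⊗ₜ y) ⊗ₜ z) =
        nestedDual k H t (comulFPredual lam (x ⊗ₜ y) ⊗ₜ z) := by
    intro t x y z
    induction t with
    | zero => simp
    | add p q hp hq => simp only [map_add, LinearMap.add_apply, hp, hq]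
    | tmul f g => simp [nestedDual₃_tmul, nestedDual_comulF, mul_comm]
  have e2 : ∀ (s : Module.Dual k H ⊗[k] Module.Dual k H) (g : Module.Dual k H) (x y z : H),
      nestedDual₃ (TensorProduct.assoc k _ _ _ (s ⊗ₜ g)) ((x ⊗ₜ y) ⊗ₜ z) =
        nestedDual k H s (y ⊗ₜ z) * g x := by
    intro s g x y z
    induction s with
    | zero => simp
    | add p q hp hq =>
      simp only [map_add, TensorProduct.add_tmul, LinearMap.add_apply, hp, hq, add_mul]
    | tmul a b => simp [nestedDual₃_tmul]; ring
  have e3 : ∀ (t : Module.Dual k H ⊗[k] Module.Dual k H) (x y z : H),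
      nestedDual₃ (TensorProduct.assoc k _ _ _
        (TensorProduct.map (comulF lam) LinearMap.id t)) ((x ⊗ₜ y) ⊗ₜ z) =
        nestedDual k H t (x ⊗ₜ comulFPredual lam (y ⊗ₜ z)) := by
    intro t x y z
    induction t with
    | zero => simp
    | add p q hp hq => simp only [map_add, LinearMap.add_apply, hp, hq]
    | tmul f g => simp [e2, nestedDual_comulF]
  apply LinearMap.ext
  intro f
  apply (nestedDual₃ (k := k) (H := H)).injective
  apply TensorProduct.ext_threefold
  intro x y z
  refine (e1 _ x y z).trans (Eq.trans ?_ (e3 _ x y z).symm)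
  rw [nestedDual_comulF, nestedDual_comulF, hl.comulFPredual_assoc]

end

section
variable {t : H} {lam : Module.Dual k H}

/-- The nested duality reverses the order of the factors, so the left counit axiom says that `t` is
a right unit of the predual product. -/
theorem counitF_comulF_left (ht : IsLeftIntegral k t) (hl : IsRightCointegral lam)
    (hlt : lam t = 1) [QuasitriangularHopfAlgebra k H] :
    TensorProduct.map (counitF t) LinearMap.id ∘ₗ comulF lam =
      (TensorProduct.lid k (Module.Dual k H)).symm.toLinearMap := by
  apply LinearMap.ext
  intro f
  apply (TensorProduct.lid k (Module.Dual k H)).injective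
  ext x
  refine (counitF_rTensor_apply t x _).trans ?_
  rw [nestedDual_comulF, comulFPredual_tmul_integral ht hl hlt]
  simp

theorem counitF_comulF_right (ht : IsLeftIntegral k t) (hl : IsRightCointegral lam)
    (hlt : lam t = 1) : TensorProduct.map LinearMap.id (counitF t) ∘ₗ comulF lam =
      (TensorProduct.rid k (Module.Dual k H)).symm.toLinearMap := by
  apply LinearMap.ext
  intro f
  apply (TensorProduct.rid k (Module.Dual k H)).injective
  ext x
  refine (counitF_lTensor_apply t x _).trans ?_
  rw [nestedDual_comulF, comulFPredual_integral_tmul ht hl hlt]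
  simp

end

end FrobeniusMaps

end FactorizableHopf

namespace FactorizableHopf

open Coalgebra HopfAlgebra

/-! ### Symmetry from commutativity and trivial twist. -/

section SymmetricFrobenius

open MonoidalCategory

universe v₁ u₁

variable {C : Type u₁} [Category.{v₁} C] [MonoidalCategory C] [BraidedCategory C]
  [RightRigidCategory C] [RibbonCategory C]

/-- A commutative Frobenius algebra with trivial twist is symmetric. -/
theorem isSymmetricFrobenius_of_isCommMonObj (A : C) [FrobeniusObj A] [IsCommMonObj A]
    (h : HasTrivialTwist A) : IsSymmetricFrobenius A := by
  have hβ : (β_ A A).hom ≫ frobeniusPairing A = frobeniusPairing A := by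
    rw [frobeniusPairing, ← Category.assoc, IsCommMonObj.mul_comm]
  -- The pairing lands in the unit object, so by naturality the dual strand can be braided past both
  -- inputs; commutativity supplies the additional crossing of the inputs.
  have hκ : frobeniusPairing A ▷ (Aᘁ : C) ≫ (λ_ (Aᘁ : C)).hom =
      (β_ A A).hom ▷ (Aᘁ : C) ≫ (β_ (A ⊗ A) (Aᘁ : C)).hom ≫
        (Aᘁ : C) ◁ frobeniusPairing A ≫ (ρ_ (Aᘁ : C)).hom := by
    rw [← BraidedCategory.braiding_naturality_left_assoc, braiding_rightUnitor,
      ← comp_whiskerRight_assoc, hβ]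
  -- Naturality again: the coevaluation starts at the unit object and can be slid across `A`. With
  -- trivial twist, the hexagons then expand both sides to the same three crossings.
  have hη : (λ_ A).inv ≫ η_ A (Aᘁ : C) ▷ A =
      (ρ_ A).inv ≫ A ◁ η_ A (Aᘁ : C) ≫ (β_ A (A ⊗ (Aᘁ : C))).hom := by
    rw [BraidedCategory.braiding_naturality_right, braiding_tensorUnit_right]
    simp
  have ht : (RibbonCategory.twist A).hom = 𝟙 A := h
  rw [IsSymmetricFrobenius, hκ, coevRight, ht, whiskerLeft_id, Category.comp_id,
    comp_whiskerRight, Category.assoc, reassoc_of% hη, BraidedCategory.braiding_tensor_left_hom,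
    BraidedCategory.braiding_tensor_right_hom]
  simp

end SymmetricFrobenius

/-! ### Bimodule linearity and commutativity on `F`. -/

section CoregularAction

variable {k H : Type u} [Field k] [Ring H] [HopfAlgebra k H]

theorem nestedDual_comm [FiniteDimensional k H] (t : Module.Dual k H ⊗[k] Module.Dual k H) (p : H ⊗[k] H) :
    nestedDual k H (TensorProduct.comm k _ _ t) p =
      nestedDual k H t (TensorProduct.comm k H H p) := by
  induction t with
  | zero => simp
  | add s t hs ht => simp only [map_add, LinearMap.add_apply, hs, ht]
  | tmul f g =>
    induction p with
    | zero => simp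
    | add p q hp hq => simp only [map_add, hp, hq]
    | tmul x y => simp [mul_comm]

theorem map_antipode_antipode_rMatrix_inv [QuasitriangularHopfAlgebra k H] : TensorProduct.map (antipode k) (antipode k)
    (((rMatrix k H)⁻¹ : (H ⊗[k] H)ˣ) : H ⊗[k] H) = (((rMatrix k H)⁻¹ : (H ⊗[k] H)ˣ) : H ⊗[k] H) := by
  rw [← LinearMap.rTensor_comp_lTensor, LinearMap.comp_apply, antipode_lTensor_R_inv,
    antipode_rTensor_R]

variable (k H) in
/-- The left coregular action on `H*`, `(h · f)(x) = f(S(h) x)`. -/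
noncomputable def leftAct : H →ₗ[k] (Module.Dual k H →ₗ[k] Module.Dual k H) :=
  Module.Dual.transpose ∘ₗ LinearMap.mul k H ∘ₗ antipode k

theorem leftAct_apply (h : H) (f : Module.Dual k H) :
    leftAct k H h f = f ∘ₗ LinearMap.mulLeft k (antipode k h) := rfl

/-- Nested evaluation reverses the factors, hence the flip on the acting element. This flip is the
one in `Δ ∘ S = (S ⊗ S) ∘ Δ^op`, so the action on `F ⊗ F` is dual to multiplication by `Δ(S(h))`. -/
theorem nestedDual_act₂_act [FiniteDimensional k H] (p q : H ⊗[k] H) (t : Module.Dual k H ⊗[k] Module.Dual k H) :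
    nestedDual k H (act₂ (leftAct k H) (leftAct k H) p t) q =
      nestedDual k H t
        (TensorProduct.comm k H H (TensorProduct.map (antipode k) (antipode k) p) * q) := by
  induction p with
  | zero => simp
  | add a b ha hb => simp only [map_add, LinearMap.add_apply, add_mul, ha, hb]
  | tmul a b =>
    induction t with
    | zero => simp
    | add s t hs ht => simp only [map_add, LinearMap.add_apply, hs, ht]
    | tmul f g =>
      induction q with
      | zero => simp
      | add p q hp hq => simp only [map_add, mul_add, hp, hq]
      | tmul x y =>
        rw [act₂_tmul, TensorProduct.map_tmul, leftAct_apply,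
          leftAct_apply]
        simp

theorem nestedDual_tensAct_act [FiniteDimensional k H] (h : H) (q : H ⊗[k] H)
    (t : Module.Dual k H ⊗[k] Module.Dual k H) :
    nestedDual k H (tensAct (leftAct k H) (leftAct k H) h t) q =
      nestedDual k H t (comul (R := k) (antipode k h) * q) := by
  rw [tensAct_apply, nestedDual_act₂_act, comul_antipode]

theorem mulF_act [FiniteDimensional k H] (h : H) :
    mulF k H ∘ₗ tensAct (leftAct k H) (leftAct k H) h =
      leftAct k H h ∘ₗ mulF k H := by
  refine LinearMap.ext fun t => LinearMap.ext fun x => ?_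
  rw [LinearMap.comp_apply, mulF_apply, nestedDual_tensAct_act, ← Bialgebra.comul_mul]
  rfl

theorem oneF_act (h : H) :
    oneF k H ∘ₗ trivAct (k := k) h = leftAct k H h ∘ₗ oneF k H := by
  refine LinearMap.ext_ring (LinearMap.ext fun x => ?_)
  rw [LinearMap.comp_apply, LinearMap.comp_apply, leftAct_apply, trivAct_apply]
  simp [oneF]

theorem IsLeftIntegral.counitF_act {t : H} (ht : IsLeftIntegral k t) (h : H) :
    counitF (k := k) t ∘ₗ leftAct k H h = trivAct (k := k) h ∘ₗ counitF t := by
  refine LinearMap.ext fun f => ?_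
  rw [LinearMap.comp_apply, LinearMap.comp_apply, leftAct_apply, trivAct_apply]
  simp [counitF, ht (antipode k h)]

variable [QuasitriangularHopfAlgebra k H] [FiniteDimensional k H]

variable (k H) in
/-- The right coregular action on `H*`, `(f · h)(x) = f(x S⁻¹(h))`. -/
noncomputable def rightAct : H →ₗ[k] (Module.Dual k H →ₗ[k] Module.Dual k H) :=
  Module.Dual.transpose ∘ₗ (LinearMap.mul k H).flip ∘ₗ antipodeInv k H

theorem rightAct_apply (h : H) (f : Module.Dual k H) :
    rightAct k H h f = f ∘ₗ LinearMap.mulRight k (antipodeInv k H h) := rfl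

theorem nestedDual_act₂_ract (p q : H ⊗[k] H) (t : Module.Dual k H ⊗[k] Module.Dual k H) :
    nestedDual k H (act₂ (rightAct k H) (rightAct k H) p t) q =
      nestedDual k H t
        (q * TensorProduct.comm k H H (TensorProduct.map (antipodeInv k H) (antipodeInv k H) p)) := by
  induction p with
  | zero => simp
  | add a b ha hb => simp only [map_add, LinearMap.add_apply, mul_add, ha, hb]
  | tmul a b =>
    induction t with
    | zero => simp
    | add s t hs ht => simp only [map_add, LinearMap.add_apply, hs, ht]
    | tmul f g =>
      induction q with
      | zero => simp
      | add p q hp hq => simp only [map_add, add_mul, hp, hq]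
      | tmul x y =>
        rw [act₂_tmul, TensorProduct.map_tmul, rightAct_apply,
          rightAct_apply]
        simp

theorem nestedDual_tensAct_ract (h : H) (q : H ⊗[k] H)
    (t : Module.Dual k H ⊗[k] Module.Dual k H) :
    nestedDual k H (tensAct (rightAct k H) (rightAct k H) h t) q =
      nestedDual k H t (q * comul (R := k) (antipodeInv k H h)) := by
  rw [tensAct_apply, nestedDual_act₂_ract, comul_antipodeInv]

theorem mulF_ract (h : H) :
    mulF k H ∘ₗ tensAct (rightAct k H) (rightAct k H) h =
      rightAct k H h ∘ₗ mulF k H := by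
  refine LinearMap.ext fun t => LinearMap.ext fun x => ?_
  rw [LinearMap.comp_apply, mulF_apply, nestedDual_tensAct_ract, ← Bialgebra.comul_mul]
  rfl

theorem oneF_ract (h : H) :
    oneF k H ∘ₗ trivAct (k := k) h = rightAct k H h ∘ₗ oneF k H := by
  refine LinearMap.ext_ring (LinearMap.ext fun x => ?_)
  rw [LinearMap.comp_apply, LinearMap.comp_apply, rightAct_apply, trivAct_apply]
  simp [oneF, counit_antipodeInv, mul_comm]

theorem IsRightCointegral.comulF_act {lam : Module.Dual k H} (hl : IsRightCointegral lam) (h : H) :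
    comulF lam ∘ₗ leftAct k H h =
      tensAct (leftAct k H) (leftAct k H) h ∘ₗ comulF lam := by
  refine LinearMap.ext fun f => (nestedDual k H).injective (LinearMap.ext fun q => ?_)
  rw [LinearMap.comp_apply, LinearMap.comp_apply, nestedDual_comulF, nestedDual_tensAct_act,
    nestedDual_comulF, hl.comulFPredual_comul_mul]
  rfl

/-- The transpose of right linearity of the predual product, hence the dependence on a two-sided
integral. -/
theorem comulF_ract {t : H} {lam : Module.Dual k H} (ht : IsLeftIntegral k t)
    (hl : IsRightCointegral lam) (hlt : lam t = 1) (hr : IsRightIntegral k t) (h : H) :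
    comulF lam ∘ₗ rightAct k H h =
      tensAct (rightAct k H) (rightAct k H) h ∘ₗ comulF lam := by
  refine LinearMap.ext fun f => (nestedDual k H).injective (LinearMap.ext fun q => ?_)
  rw [LinearMap.comp_apply, LinearMap.comp_apply, nestedDual_comulF, nestedDual_tensAct_ract,
    nestedDual_comulF, comulFPredual_mul_comul ht hl hlt hr]
  rfl

theorem IsRightIntegral.counitF_ract {t : H} (ht : IsRightIntegral k t) (h : H) :
    counitF (k := k) t ∘ₗ rightAct k H h = trivAct (k := k) h ∘ₗ counitF t := by
  refine LinearMap.ext fun f => ?_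
  rw [LinearMap.comp_apply, LinearMap.comp_apply, rightAct_apply, trivAct_apply]
  simp [counitF, ht (antipodeInv k H h), counit_antipodeInv]

theorem map_antipodeInv_antipodeInv_rMatrix :
    TensorProduct.map (antipodeInv k H) (antipodeInv k H) (rMatrix k H : H ⊗[k] H) =
      rMatrix k H := by
  conv_lhs => rw [← map_antipode_antipode_rMatrix]
  rw [← LinearMap.comp_apply, ← TensorProduct.map_comp,
    show antipodeInv k H ∘ₗ antipode k = LinearMap.id from LinearMap.ext antipodeInv_antipode,
    TensorProduct.map_id, LinearMap.id_apply]

/-- Commutativity of `m_F` with respect to the braiding. -/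
theorem mulF_braid (t : Module.Dual k H ⊗[k] Module.Dual k H) :
    mulF k H (act₂ (leftAct k H) (leftAct k H)
      (((rMatrix k H)⁻¹ : (H ⊗[k] H)ˣ) : H ⊗[k] H)
      (act₂ (rightAct k H) (rightAct k H) (rMatrix k H : H ⊗[k] H)
        (TensorProduct.comm k _ _ t))) = mulF k H t := by
  have hc : ∀ p q : H ⊗[k] H, TensorProduct.comm k H H (p * q) =
      TensorProduct.comm k H H p * TensorProduct.comm k H H q := map_mul (flipAlg k H)
  refine LinearMap.ext fun x => ?_
  -- After `S ⊗ S` and `S⁻¹ ⊗ S⁻¹` are absorbed by `R`, the left side evaluates `t` on `R⁻¹ Δ^op(x)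
  -- R = Δ(x)`.
  rw [mulF_apply, mulF_apply, nestedDual_act₂_act, nestedDual_act₂_ract, nestedDual_comm,
    map_antipode_antipode_rMatrix_inv, map_antipodeInv_antipodeInv_rMatrix, hc, hc,
    TensorProduct.comm_comm, TensorProduct.comm_comm, ← QuasitriangularHopfAlgebra.R_mul_comul_mul_inv]
  simp [mul_assoc]

end CoregularAction

end FactorizableHopf

namespace FactorizableHopf

open Coalgebra HopfAlgebra MonoidalCategory

/-! ### The Frobenius algebra `F_ω` and its specialization to `F`. -/

section TwistedFrobenius

variable {k H : Type u} [Field k] [Ring H] [HopfAlgebra k H]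

theorem act₂_comp_comp {X Y : Type u} [AddCommGroup X] [Module k X] [AddCommGroup Y] [Module k Y]
    (ω : H →ₗ[k] H) (ρ : H →ₗ[k] (X →ₗ[k] X)) (σ : H →ₗ[k] (Y →ₗ[k] Y)) (p : H ⊗[k] H) :
    act₂ (ρ ∘ₗ ω) (σ ∘ₗ ω) p = act₂ ρ σ (TensorProduct.map ω ω p) := by
  rw [act₂_comp_left, act₂_comp_right, ← LinearMap.lTensor_comp_rTensor, LinearMap.comp_apply]

/-- `ω` respects the coproduct, so twisting actions commutes with tensor products; right linearity
over `F_ω` thus follows from right linearity over `F` at `ω(h)`. -/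
theorem tensAct_comp_comp {X Y : Type u} [AddCommGroup X] [Module k X] [AddCommGroup Y]
    [Module k Y] (ω : H ≃ₐc[k] H) (ρ : H →ₗ[k] (X →ₗ[k] X)) (σ : H →ₗ[k] (Y →ₗ[k] Y)) (h : H) :
    tensAct (ρ ∘ₗ (ω : H →ₗ[k] H)) (σ ∘ₗ (ω : H →ₗ[k] H)) h = tensAct ρ σ (ω h) := by
  rw [tensAct_apply, act₂_comp_comp, tensAct_apply]
  exact congrArg _ (CoalgHomClass.map_comp_comul_apply ω h)

theorem trivAct_map (ω : H ≃ₐc[k] H) (h : H) : trivAct (k := k) (ω h) = trivAct (k := k) h := by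
  ext
  simp [trivAct_apply]

section

variable [QuasitriangularHopfAlgebra k H] [FiniteDimensional k H]

/-- Multiplication of `F_ω` as a morphism of bimodules. -/
noncomputable def mulHom (ω : H ≃ₐc[k] H) :
    HBimod.coregularTwisted k H ω ⊗ HBimod.coregularTwisted k H ω ⟶
      HBimod.coregularTwisted k H ω where
  lin := mulF k H
  lin_act h := mulF_act h
  lin_ract h := (congrArg (mulF k H ∘ₗ ·)
    (tensAct_comp_comp ω (rightAct k H) (rightAct k H) h)).trans (mulF_ract (ω h))

/-- Unit of `F_ω` as a morphism of bimodules. -/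
noncomputable def oneHom (ω : H ≃ₐc[k] H) :
    𝟙_ (HBimod k H) ⟶ HBimod.coregularTwisted k H ω where
  lin := oneF k H
  lin_act h := oneF_act h
  lin_ract h := by
    have e := oneF_ract (k := k) (ω h)
    rw [trivAct_map] at e
    exact e

variable {t : H} {lam : Module.Dual k H}

/-- Comultiplication of `F_ω` as a morphism of bimodules. -/
noncomputable def comulHom (ht : IsLeftIntegral k t) (hl : IsRightCointegral lam)
    (hlt : lam t = 1) (hr : IsRightIntegral k t) (ω : H ≃ₐc[k] H) :
    HBimod.coregularTwisted k H ω ⟶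
      HBimod.coregularTwisted k H ω ⊗ HBimod.coregularTwisted k H ω where
  lin := comulF lam
  lin_act h := hl.comulF_act h
  lin_ract h := (comulF_ract ht hl hlt hr (ω h)).trans (congrArg (· ∘ₗ comulF lam)
    (tensAct_comp_comp ω (rightAct k H) (rightAct k H) h).symm)

/-- Counit of `F_ω` as a morphism of bimodules. -/
noncomputable def counitHom (ht : IsLeftIntegral k t) (hr : IsRightIntegral k t)
    (ω : H ≃ₐc[k] H) : HBimod.coregularTwisted k H ω ⟶ 𝟙_ (HBimod k H) where
  lin := counitF t
  lin_act h := ht.counitF_act h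
  lin_ract h := by
    have e := hr.counitF_ract (ω h)
    rw [trivAct_map] at e
    exact e

/-- The Frobenius algebra `F_ω`. -/
@[reducible]
noncomputable def frobeniusObj (ht : IsLeftIntegral k t) (hl : IsRightCointegral lam)
    (hlt : lam t = 1) (hr : IsRightIntegral k t) (ω : H ≃ₐc[k] H) :
    FrobeniusObj (HBimod.coregularTwisted k H ω) where
  one := oneHom ω
  mul := mulHom ω
  one_mul := HBimod.hom_ext mulF_one_left
  mul_one := HBimod.hom_ext mulF_one_right
  mul_assoc := HBimod.hom_ext mulF_assoc
  counit := counitHom ht hr ω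
  comul := comulHom ht hl hlt hr ω
  counit_comul := HBimod.hom_ext (counitF_comulF_left ht hl hlt)
  comul_counit := HBimod.hom_ext (counitF_comulF_right ht hl hlt)
  comul_assoc := HBimod.hom_ext hl.comulF_assoc
  comul_mul_left := HBimod.hom_ext (comulF_mulF_left lam)
  comul_mul_right := HBimod.hom_ext hl.comulF_mulF_right

theorem isFrobenius_coregularTwisted (ht : IsLeftIntegral k t) (hl : IsRightCointegral lam)
    (hlt : lam t = 1) (hr : IsRightIntegral k t) (ω : H ≃ₐc[k] H) :
    HBimod.IsFrobenius (HBimod.coregularTwisted k H ω) (mulF k H) (oneF k H) (comulF lam)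
      (counitF t) :=
  ⟨frobeniusObj ht hl hlt hr ω, rfl, rfl, rfl, rfl⟩

/-- On `F_ω` the braiding differs from that on `F` only in that `(ω ⊗ ω)(R)` acts from the right,
which is `R` by assumption. -/
theorem braiding_mulHom {ω : H ≃ₐc[k] H}
    (hω : TensorProduct.map (ω : H →ₗ[k] H) (ω : H →ₗ[k] H) (rMatrix k H : H ⊗[k] H) =
      (rMatrix k H : H ⊗[k] H)) :
    (β_ (HBimod.coregularTwisted k H ω) (HBimod.coregularTwisted k H ω)).hom ≫ mulHom ω =
      mulHom ω := by
  apply HBimod.hom_ext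
  apply LinearMap.ext
  intro t
  refine Eq.trans ?_ (mulF_braid t)
  have e := (act₂_comp_comp (ω : H →ₗ[k] H) (rightAct k H) (rightAct k H)
    (rMatrix k H : H ⊗[k] H)).trans (congrArg _ hω)
  exact congrArg (fun T : Module.Dual k H ⊗[k] Module.Dual k H →ₗ[k]
      Module.Dual k H ⊗[k] Module.Dual k H =>
    mulF k H (act₂ (leftAct k H) (leftAct k H) (((rMatrix k H)⁻¹ : (H ⊗[k] H)ˣ) : H ⊗[k] H)
      (T (TensorProduct.comm k _ _ t)))) e

end

section

variable [RibbonHopfAlgebra k H]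

theorem map_ribbonElt_inv {ω : H ≃ₐc[k] H} (hω : ω (ribbonElt k H : H) = (ribbonElt k H : H)) :
    ω (((ribbonElt k H)⁻¹ : Hˣ) : H) = (((ribbonElt k H)⁻¹ : Hˣ) : H) := by
  refine left_inv_eq_right_inv (a := (ribbonElt k H : H)) ?_ (Units.mul_inv _)
  conv_lhs => rw [← hω]
  rw [← map_mul, Units.inv_mul, map_one]

theorem isRibbonAut_refl : IsRibbonAut (BialgEquiv.refl k H) :=
  ⟨LinearMap.congr_fun TensorProduct.map_id _, rfl⟩

variable [FiniteDimensional k H]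

/-- The twist sends `f` to `x ↦ f(S(v) x S⁻¹(ω(v⁻¹)))`; the two factors reduce to `v` and `v⁻¹` and
cancel by centrality. -/
theorem hasTrivialTwist_coregularTwisted {ω : H ≃ₐc[k] H}
    (hω : ω (ribbonElt k H : H) = (ribbonElt k H : H)) :
    HasTrivialTwist (HBimod.coregularTwisted k H ω) := by
  have hT : antipodeInv k H (((ribbonElt k H)⁻¹ : Hˣ) : H) = (((ribbonElt k H)⁻¹ : Hˣ) : H) := by
    conv_lhs => rw [← HBimod.antipode_v_inv (k := k) (H := H)]
    exact antipodeInv_antipode _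
  apply HBimod.hom_ext
  refine LinearMap.ext fun (f : Module.Dual k H) => LinearMap.ext fun x => ?_
  change f ((antipode k (ribbonElt k H : H) * x) *
    antipodeInv k H (ω (((ribbonElt k H)⁻¹ : Hˣ) : H))) = f x
  rw [map_ribbonElt_inv hω, hT, show antipode k (ribbonElt k H : H) = ribbonElt k H from
    RibbonHopfAlgebra.antipode_v, RibbonHopfAlgebra.v_central, mul_assoc, Units.mul_inv, mul_one]

theorem isCommSymmFrobenius_coregularTwisted {t : H} {lam : Module.Dual k H}
    (ht : IsLeftIntegral k t) (hl : IsRightCointegral lam) (hlt : lam t = 1)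
    (hr : IsRightIntegral k t) {ω : H ≃ₐc[k] H} (hω : IsRibbonAut ω) :
    HBimod.IsCommSymmFrobenius (HBimod.coregularTwisted k H ω) (mulF k H) (oneF k H) (comulF lam)
      (counitF t) := by
  let _ := frobeniusObj ht hl hlt hr ω
  have : IsCommMonObj (HBimod.coregularTwisted k H ω) := ⟨braiding_mulHom hω.1⟩
  exact ⟨frobeniusObj ht hl hlt hr ω, ⟨rfl, rfl, rfl, rfl⟩, inferInstance,
    isSymmetricFrobenius_of_isCommMonObj _ (hasTrivialTwist_coregularTwisted hω.2)⟩

end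

section

variable [RibbonHopfAlgebra k H] [FiniteDimensional k H]

/-- Transport from `F_id` to `F`. The types of the structure maps depend on the object, hence the
heterogeneous equalities. -/
theorem HBimod.IsCommSymmFrobenius.congr {A B : HBimod k H} (hAB : A = B)
    {m : A.V ⊗[k] A.V →ₗ[k] A.V} {e : k →ₗ[k] A.V} {d : A.V →ₗ[k] A.V ⊗[k] A.V} {c : A.V →ₗ[k] k}
    {m' : B.V ⊗[k] B.V →ₗ[k] B.V} {e' : k →ₗ[k] B.V} {d' : B.V →ₗ[k] B.V ⊗[k] B.V}
    {c' : B.V →ₗ[k] k} (h : HBimod.IsCommSymmFrobenius A m e d c)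
    (hm : HEq m m') (he : HEq e e') (hd : HEq d d') (hc : HEq c c') :
    HBimod.IsCommSymmFrobenius B m' e' d' c' := by
  subst hAB
  rwa [← eq_of_heq hm, ← eq_of_heq he, ← eq_of_heq hd, ← eq_of_heq hc]

theorem coregularTwisted_refl :
    HBimod.coregularTwisted k H (BialgEquiv.refl k H) = HBimod.coregular k H := rfl

theorem isCommSymmFrobenius_coregular {t : H} {lam : Module.Dual k H} (ht : IsLeftIntegral k t)
    (hl : IsRightCointegral lam) (hlt : lam t = 1) (hr : IsRightIntegral k t) :
    HBimod.IsCommSymmFrobenius (HBimod.coregular k H) (mulF k H) (oneF k H) (comulF lam)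
      (counitF t) :=
  (isCommSymmFrobenius_coregularTwisted ht hl hlt hr
    (isRibbonAut_refl (k := k) (H := H))).congr coregularTwisted_refl
      HEq.rfl HEq.rfl HEq.rfl HEq.rfl

theorem hasTrivialTwist_coregular : HasTrivialTwist (HBimod.coregular k H) :=
  hasTrivialTwist_coregularTwisted (ω := BialgEquiv.refl k H) rfl

end

end TwistedFrobenius

end FactorizableHopf

/-! ### The main theorem. -/

open FactorizableHopf FactorizableHopf.HBimod in
theorem theorem2 {k H : Type u} [Field k] [IsAlgClosed k] [CharZero k] [Ring H] [HopfAlgebra k H]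
    [FiniteDimensional k H] [RibbonHopfAlgebra k H] (hfact : IsFactorizable k H) :
    -- normalized integrals and cointegrals exist
    (∃ (Λ : H) (lam : Module.Dual k H), IsNormalizedPair Λ lam) ∧
    -- the coregular bimodule is the coend `F`, and its twisted version is the coend `F_ω`
    Nonempty (Limits.IsColimit (HMod.coregularCowedge k H)) ∧
    (∀ ω : H ≃ₐc[k] H, Nonempty (Limits.IsColimit (HMod.coregularTwistedCowedge k H ω))) ∧
    ∀ (Λ : H) (lam : Module.Dual k H), IsNormalizedPair Λ lam →
      -- the statement for `F`
      (IsCommSymmFrobenius (coregular k H) (mulF k H) (oneF k H) (comulF lam) (counitF Λ) ∧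
        HasTrivialTwist (coregular k H)) ∧
      -- the statement for `F_ω`
      ∀ ω : H ≃ₐc[k] H,
        IsFrobenius (coregularTwisted k H ω) (mulF k H) (oneF k H) (comulF lam) (counitF Λ) ∧
        (IsRibbonAut ω →
          IsCommSymmFrobenius (coregularTwisted k H ω) (mulF k H) (oneF k H) (comulF lam)
            (counitF Λ) ∧
          HasTrivialTwist (coregularTwisted k H ω)) := by
  refine ⟨hfact.exists_isNormalizedPair, ⟨HMod.coregularIsColimit k H⟩,
    fun ω => ⟨HMod.coregularTwistedIsColimit k H ω⟩, fun Λ lam hp => ?_⟩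
  have ht := hp.isLeftIntegral
  have hl := hp.isRightCointegral
  have hlt := hp.lam_apply
  -- From here on, factorizability acts only through unimodularity.
  have hr := hfact.isRightIntegral ht hl hlt
  exact ⟨⟨isCommSymmFrobenius_coregular ht hl hlt hr, hasTrivialTwist_coregular⟩,
    fun ω => ⟨isFrobenius_coregularTwisted ht hl hlt hr ω, fun hω =>
      ⟨isCommSymmFrobenius_coregularTwisted ht hl hlt hr hω,
        hasTrivialTwist_coregularTwisted hω.2⟩⟩⟩
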